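/- **Theorem (Wick rule for a product of fields).** *Setting.* Let $T$ be a locally compact Polish space and $\sigma$ a non-atomic Radon measure on its Borel sets. Let $A\subset T^2$ be a symmetric measurable set containing the diagonal with $\sigma^{\otimes2}(A)=0$, and let $Q:T^2\setminus A\to\{z\in\mathbb C:|z|=1\}$ be measurable with $Q(s,t)=\overline{Q(t,s)}$. On $L^2(T^n,\sigma^{\otimes n})$ (complex-valued functions) let $P_n=\frac1{n!}\sum_{\pi\in S_n}\Psi_\pi$ be the $Q$-symmetrization, where $\pi\mapsto\Psi_\pi$ is the unitary representation of $S_n$ with $$(\Psi_{(j,j+1)}f)(t_1,\dots,t_n)=Q(t_j,t_{j+1})f(\dots,t_{j+1},t_j,\dots).$$ Let $\mathcal F_{\rm fin}$ be the space of finite sequences $(f^{(n)})_{n\ge0}$, $f^{(n)}\in P_nL^2(T^n,\sigma^{\otimes n})$, with scalar product $\sum_n n!\,(f^{(n)},g^{(n)})$ and vacuum $\Omega=(1,0,0,\dots)$. On $\mathcal F_{\rm fin}$ let $a^+(h)f^{(n)}=P_{n+1}(h\otimes f^{(n)})$, let $a^-(h)$ be the adjoint of $a^+(h)$, and let $(a^0(h)f^{(n)})(t_1,\dots,t_n)=(h(t_1)+\dots+h(t_n))f^{(n)}(t_1,\dots,t_n)$.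 Fix $\lambda\in\mathbb R$. Write $B_0(X)$ and $B_0(X\to\mathbb C)$ for the real-valued and the complex-valued bounded measurable functions with compact support on $X$. For $f\in B_0(T)$ put $\langle f,\omega\rangle=a^+(f)+\lambda a^0(f)+a^-(f)$, i.e. $\langle f,\omega\rangle=\int_T\sigma(dt)f(t)\omega(t)$ with $\omega(t)=\partial_t^\dagger+\lambda\partial_t^\dagger\partial_t+\partial_t$. Let $\mathscr P$ be the complex unital $*$-algebra generated by the operators $\langle f,\omega\rangle$, $\tau(p)=(p\Omega,\Omega)$, and let $L^2(\tau)$ be the completion of $\mathscr P$ (modulo null vectors) for the scalar product $(p_1,p_2)=\tau(p_2^*p_1)$. Let $\mathscr{MP}^{(n)}$ be the closure in $L^2(\tau)$ of the polynomials of degree $\le n$ in the $\langle f,\omega\rangle$, and let $\mathscr{OP}^{(0)}=\mathscr{MP}^{(0)}$, $\mathscr{OP}^{(n)}=\mathscr{MP}^{(n)}\ominus\mathscr{MP}^{(n-1)}$ for $n\ge1$. For every $n\ge 0$, $f^{(n)}\mapsto\langle f^{(n)},\omega^{\otimes n}\rangle\in L^2(\tau)$, $f^{(n)}\in B_0(T^n\to\mathbb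 C)$, denotes the unique linear map with $\langle f_1\otimes\dots\otimes f_n,\omega^{\otimes n}\rangle=\langle f_1,\omega\rangle\cdots\langle f_n,\omega\rangle$ for $f_i\in B_0(T)$ which is sequentially continuous with respect to pointwise convergence of uniformly bounded functions supported in a common compact set; that this map exists and is unique is part of the assertion. Let $\langle f^{(n)},{:}\omega^{\otimes n}{:}\rangle$ be the orthogonal projection of $\langle f^{(n)},\omega^{\otimes n}\rangle$ onto $\mathscr{OP}^{(n)}$. *Marked partitions.* Let $\mathcal P_\pm^{(n)}$ be the set of partitions $\mathcal V$ of $\{1,\dots,n\}$ whose blocks $B$ carry a mark $m(B)\in\{+1,-1\}$, singletons having mark $+1$. Put $$Q(\mathcal V;t_1,\dots,t_n)=\prod_{\substack{m(B_1)=m(B_2)=-1\\ \min B_1<\min B_2<\max B_1<\max B_2}}Q(t_{\min B_2},t_{\max B_1})\prod_{\substack{m(B_1)=+1,\ m(B_2)=-1\\ \min B_2<\max B_1<\max B_2}}Q(t_{\min B_2},t_{\max B_1}).$$ The expression ${:}\omega(t_1)\cdots\omega(t_n){:}_{\mathcal V}$ is obtained from ${:}\omega(t_1)\cdots\omega(t_n){:}$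 as follows. For each block $B=\{i_1<\dots<i_k\}$ with mark $+1$, remove $\omega(t_{i_1}),\dots,\omega(t_{i_{k-1}})$ and multiply by $\lambda^{k-1}\delta(t_{i_1},\dots,t_{i_k})$ (do nothing if $k=1$). For each block $B=\{i_1<\dots<i_k\}$ with mark $-1$, remove $\omega(t_{i_1}),\dots,\omega(t_{i_k})$ and multiply by $\lambda^{k-2}\delta(t_{i_1},\dots,t_{i_k})$. Here $\int_{T^k}g\,\delta\,d\sigma^{\otimes k}=\int_T g(t,\dots,t)\,\sigma(dt)$. Thus, smeared with $f^{(n)}$, the term $Q(\mathcal V;t){:}\omega(t_1)\cdots\omega(t_n){:}_{\mathcal V}$ is $\langle g_{\mathcal V},{:}\omega^{\otimes k}{:}\rangle$. In this formula $k$ is the number of blocks with mark $+1$, listed as $B_1,\dots,B_k$ in increasing order of their maxima, $p$ is the number of blocks with mark $-1$, listed as $B'_1,\dots,B'_p$, and $$g_{\mathcal V}(s_1,\dots,s_k)=\lambda^{\sum_{j}(|B_j|-1)+\sum_{l}(|B'_l|-2)}\int_{T^p} f^{(n)}(t)\,Q(\mathcal V;t)\,\sigma(du_1)\cdots\sigma(du_p),$$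 where $t_i=s_j$ for $i\in B_j$ and $t_i=u_l$ for $i\in B'_l$ (and $0^0=1$). *Assertion.* For each $n$, $$\omega(t_1)\cdots\omega(t_n)=\sum_{\mathcal V\in\mathcal P_\pm^{(n)}}Q(\mathcal V;t_1,\dots,t_n)\,{:}\omega(t_1)\cdots\omega(t_n){:}_{\mathcal V}$$ after smearing: for every $f^{(n)}\in B_0(T^n\to\mathbb C)$, $$\langle f^{(n)},\omega^{\otimes n}\rangle=\sum_{\mathcal V\in\mathcal P^{(n)}_\pm}\langle g_{\mathcal V},{:}\omega^{\otimes k}{:}\rangle\quad\text{in }L^2(\tau).$$ -/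

import Mathlib

open MeasureTheory Filter Topology
open scoped ENNReal ComplexConjugate

noncomputable section

namespace QWick

/-- The data of a generalized statistics on `(T, σ)`: a symmetric measurable null set `A ⊆ T × T`
containing the diagonal, and a measurable Hermitian function `Q` with values in the unit circle
which is defined outside of `A`. -/
structure Statistics {T : Type*} [MeasurableSpace T] (σ : Measure T) where
  A : Set (T × T)
  measurableSet_A : MeasurableSet A
  symm_A : ∀ s t, (s, t) ∈ A → (t, s) ∈ A
  diag_mem_A : ∀ t, (t, t) ∈ A
  null_A : (σ.prod σ) A = 0
  Q : {p : T × T // p ∉ A} → ℂ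
  measurable_Q : Measurable Q
  norm_Q : ∀ p, ‖Q p‖ = 1
  hermitian_Q : ∀ s t (h : (s, t) ∉ A) (h' : (t, s) ∉ A), Q ⟨(s, t), h⟩ = conj (Q ⟨(t, s), h'⟩)

section Kernel

variable {T : Type*} [MeasurableSpace T] {σ : Measure T} (S : Statistics σ)

open Classical in
/-- The function `Q`, set equal to `1` on the null set where it is not defined. -/
def Statistics.q (s t : T) : ℂ := if h : (s, t) ∈ S.A then 1 else S.Q ⟨(s, t), h⟩

lemma Statistics.measurable_q : Measurable fun p : T × T => S.q p.1 p.2 := by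
  classical
  exact Measurable.dite (s := S.A) (f := fun _ => (1 : ℂ)) (g := fun p => S.Q ⟨p.1, p.2⟩)
    measurable_const S.measurable_Q S.measurableSet_A

lemma Statistics.norm_q (s t : T) : ‖S.q s t‖ = 1 := by
  unfold Statistics.q
  split_ifs
  · simp
  · exact S.norm_Q _

lemma Statistics.q_hermitian (s t : T) : S.q s t = conj (S.q t s) := by
  unfold Statistics.q
  by_cases h : (s, t) ∈ S.A
  · have h' := S.symm_A _ _ h
    simp [h, h']
  · have h' : (t, s) ∉ S.A := fun h' => h (S.symm_A _ _ h')
    simp only [h, h', dif_neg, not_false_eq_true]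
    exact S.hermitian_Q _ _ _ _

lemma Statistics.q_mul_q (s t : T) : S.q s t * S.q t s = 1 := by
  rw [S.q_hermitian t s, Complex.mul_conj, Complex.normSq_eq_norm_sq, S.norm_q]
  simp

/-- `Q_π(t₁, …, tₙ)`: the product of `Q(t_i, t_j)` over the inversions `i < j`, `π i > π j`. -/
def Statistics.qPerm {n : ℕ} (π : Equiv.Perm (Fin n)) (t : Fin n → T) : ℂ :=
  ∏ p ∈ Finset.univ.filter (fun p : Fin n × Fin n => p.1 < p.2 ∧ π p.2 < π p.1),
    S.q (t p.1) (t p.2)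

lemma Statistics.measurable_qPerm {n : ℕ} (π : Equiv.Perm (Fin n)) :
    Measurable (S.qPerm π) := by
  unfold Statistics.qPerm
  refine Finset.measurable_prod _ fun p _ => ?_
  exact S.measurable_q.comp (f := fun t : Fin n → T => (t p.1, t p.2))
    ((measurable_pi_apply _).prodMk (measurable_pi_apply _))

lemma Statistics.norm_qPerm {n : ℕ} (π : Equiv.Perm (Fin n)) (t : Fin n → T) :
    ‖S.qPerm π t‖ = 1 := by
  unfold Statistics.qPerm
  rw [norm_prod]
  exact Finset.prod_eq_one fun p _ => S.norm_q _ _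

lemma Statistics.qPerm_mul {n : ℕ} (π ρ : Equiv.Perm (Fin n)) (t : Fin n → T) :
    S.qPerm (π * ρ)⁻¹ t = S.qPerm π⁻¹ t * S.qPerm ρ⁻¹ (t ∘ π) := by
  classical
  have h1 : S.qPerm ρ⁻¹ (t ∘ π) = ∏ p ∈ Finset.univ.filter (fun p : Fin n × Fin n =>
      π⁻¹ p.1 < π⁻¹ p.2 ∧ (π * ρ)⁻¹ p.2 < (π * ρ)⁻¹ p.1), S.q (t p.1) (t p.2) := by
    unfold Statistics.qPerm
    refine Finset.prod_equiv (Equiv.prodCongr π π) ?_ ?_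
    · intro p; simp [mul_inv_rev]
    · intro p _; simp
  have h2 : ∀ r : Fin n → Fin n → Prop, ∀ [∀ a b, Decidable (r a b)],
      (∀ a, ¬ r a a) → ∏ p ∈ Finset.univ.filter (fun p : Fin n × Fin n => r p.1 p.2),
        S.q (t p.1) (t p.2) = ∏ p ∈ Finset.univ.filter (fun p : Fin n × Fin n => p.1 < p.2),
          ((if r p.1 p.2 then S.q (t p.1) (t p.2) else 1) *
            (if r p.2 p.1 then S.q (t p.2) (t p.1) else 1)) := by
    intro r _ hr
    rw [Finset.prod_mul_distrib]
    have h3 : ∏ p ∈ Finset.univ.filter (fun p : Fin n × Fin n => p.1 < p.2),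
        (if r p.2 p.1 then S.q (t p.2) (t p.1) else 1) =
        ∏ p ∈ Finset.univ.filter (fun p : Fin n × Fin n => p.2 < p.1),
        (if r p.1 p.2 then S.q (t p.1) (t p.2) else 1) := by
      refine Finset.prod_equiv (Equiv.prodComm _ _) (by simp) ?_
      intro p _
      rfl
    rw [h3, Finset.prod_filter, Finset.prod_filter, Finset.prod_filter, ← Finset.prod_mul_distrib]
    refine Finset.prod_congr rfl fun p _ => ?_
    rcases lt_trichotomy p.1 p.2 with h | h | h
    · simp [h, h.not_gt]
    · simp [h, hr]
    · simp [h, h.not_gt]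
  rw [h1]
  unfold Statistics.qPerm
  rw [h2 (fun a b => a < b ∧ (π * ρ)⁻¹ b < (π * ρ)⁻¹ a) (by simp),
    h2 (fun a b => a < b ∧ π⁻¹ b < π⁻¹ a) (by simp),
    h2 (fun a b => π⁻¹ a < π⁻¹ b ∧ (π * ρ)⁻¹ b < (π * ρ)⁻¹ a) (by simp),
    ← Finset.prod_mul_distrib]
  refine Finset.prod_congr rfl fun p hp => ?_
  have hp : p.1 < p.2 := by simpa using hp
  have e1 : π⁻¹ p.1 ≠ π⁻¹ p.2 := fun h => hp.ne (π⁻¹.injective h)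
  have e2 : (π * ρ)⁻¹ p.1 ≠ (π * ρ)⁻¹ p.2 := fun h => hp.ne ((π * ρ)⁻¹.injective h)
  have := S.q_mul_q (t p.1) (t p.2)
  rcases lt_or_gt_of_ne e1 with h1 | h1 <;> rcases lt_or_gt_of_ne e2 with h2 | h2 <;>
    simp only [hp, hp.not_gt, h1, h1.not_gt, h2, h2.not_gt, this, and_true, and_false,
      and_self, if_true, if_false, mul_one, one_mul]

end Kernel

section Operators

lemma memLp_mulOp {X : Type*} [MeasurableSpace X] (μ : Measure X) (c : X → ℂ) (hc : Measurable c)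
    (hb : ∃ C : ℝ, ∀ x, ‖c x‖ ≤ C) (f : Lp ℂ 2 μ) : MemLp (fun x => c x * f x) 2 μ :=
  (Lp.memLp f).of_le_mul (c := hb.choose) (hc.aestronglyMeasurable.mul (Lp.aestronglyMeasurable f))
    (ae_of_all _ fun x => by
      rw [norm_mul]; exact mul_le_mul_of_nonneg_right (hb.choose_spec x) (norm_nonneg _))

/-- Multiplication by a bounded measurable function, as an operator on `L²`. -/
def mulOp {X : Type*} [MeasurableSpace X] (μ : Measure X) (c : X → ℂ) (hc : Measurable c)
    (hb : ∃ C : ℝ, ∀ x, ‖c x‖ ≤ C) : Lp ℂ 2 μ →L[ℂ] Lp ℂ 2 μ :=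
  LinearMap.mkContinuous
    { toFun := fun f => (memLp_mulOp μ c hc hb f).toLp _
      map_add' := fun f g => by
        rw [← MemLp.toLp_add, MemLp.toLp_eq_toLp_iff]
        filter_upwards [Lp.coeFn_add f g] with x hx
        change c x * (f + g : Lp ℂ 2 μ) x = c x * f x + c x * g x
        rw [hx, Pi.add_apply, mul_add]
      map_smul' := fun a f => by
        rw [RingHom.id_apply, ← MemLp.toLp_const_smul, MemLp.toLp_eq_toLp_iff]
        filter_upwards [Lp.coeFn_smul a f] with x hx
        change c x * (a • f : Lp ℂ 2 μ) x = a * (c x * f x)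
        rw [hx, Pi.smul_apply, smul_eq_mul, mul_left_comm] }
    hb.choose fun f => by
      refine Lp.norm_le_mul_norm_of_ae_le_mul ?_
      filter_upwards [(memLp_mulOp μ c hc hb f).coeFn_toLp] with x hx
      simp only [LinearMap.coe_mk, AddHom.coe_mk, hx, norm_mul]
      exact mul_le_mul_of_nonneg_right (hb.choose_spec x) (norm_nonneg _)

lemma coeFn_mulOp {X : Type*} [MeasurableSpace X] (μ : Measure X) (c : X → ℂ) (hc : Measurable c)
    (hb : ∃ C : ℝ, ∀ x, ‖c x‖ ≤ C) (f : Lp ℂ 2 μ) :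
    mulOp μ c hc hb f =ᵐ[μ] fun x => c x * f x :=
  (memLp_mulOp μ c hc hb f).coeFn_toLp

variable {T : Type*} [MeasurableSpace T] (σ : Measure T) [SigmaFinite σ]

/-- The `n`-particle space `L²(Tⁿ, σ^{⊗n})` (for `n = 0` this is `ℂ`). -/
abbrev Particle (n : ℕ) : Type _ := Lp ℂ 2 (Measure.pi fun _ : Fin n => σ)

lemma measurePreserving_perm {n : ℕ} (π : Equiv.Perm (Fin n)) :
    MeasurePreserving (fun t : Fin n → T => t ∘ π)
      (Measure.pi fun _ : Fin n => σ) (Measure.pi fun _ : Fin n => σ) := by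
  have := measurePreserving_piCongrLeft (fun _ : Fin n => σ) π.symm
  convert this using 1
  ext t i
  have := Equiv.piCongrLeft_apply_apply (fun _ : Fin n => T) π.symm t (π i)
  simp at this
  exact this.symm

variable {σ} in
/-- The unitary operator `Ψ_π` on `L²(Tⁿ)`. By `coeFn_psi_swap` and `psi_mul` below, this is the
multiplicative extension of `π_j = (j, j+1) ↦ Ψ_j`,
`(Ψ_j f)(t) = Q(t_j, t_{j+1}) f(…, t_{j+1}, t_j, …)`. -/
def psi (S : Statistics σ) {n : ℕ} (π : Equiv.Perm (Fin n)) : Particle σ n →L[ℂ] Particle σ n :=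
  (mulOp _ (S.qPerm π⁻¹) (S.measurable_qPerm _) ⟨1, fun t => (S.norm_qPerm _ t).le⟩).comp
    (Lp.compMeasurePreservingₗᵢ ℂ _ (measurePreserving_perm σ π)).toContinuousLinearMap

variable {σ} in
lemma coeFn_psi (S : Statistics σ) {n : ℕ} (π : Equiv.Perm (Fin n)) (f : Particle σ n) :
    psi S π f =ᵐ[Measure.pi fun _ : Fin n => σ] fun t => S.qPerm π⁻¹ t * f (t ∘ π) := by
  refine (coeFn_mulOp _ (S.qPerm π⁻¹) (S.measurable_qPerm _)
    ⟨1, fun t => (S.norm_qPerm _ t).le⟩ _).trans ?_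
  filter_upwards [Lp.coeFn_compMeasurePreserving f (measurePreserving_perm σ π)] with t ht
  exact congrArg (S.qPerm π⁻¹ t * ·) ht

variable {σ} in
lemma psi_one (S : Statistics σ) (n : ℕ) : psi S (1 : Equiv.Perm (Fin n)) = 1 := by
  ext1 f
  refine Lp.ext ((coeFn_psi S 1 f).trans (ae_of_all _ fun t => ?_))
  have : S.qPerm (1 : Equiv.Perm (Fin n))⁻¹ t = 1 := by
    unfold Statistics.qPerm
    refine Finset.prod_eq_one fun p hp => ?_
    simp only [inv_one, Equiv.Perm.coe_one, id_eq, Finset.mem_filter, Finset.mem_univ,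
      true_and] at hp
    exact absurd hp.1 hp.2.not_gt
  change S.qPerm (1 : Equiv.Perm (Fin n))⁻¹ t * f t = f t
  rw [this, one_mul]

variable {σ} in
lemma psi_mul (S : Statistics σ) {n : ℕ} (π ρ : Equiv.Perm (Fin n)) :
    psi S (π * ρ) = psi S π * psi S ρ := by
  ext1 f
  refine Lp.ext ((coeFn_psi S _ f).trans (Filter.EventuallyEq.symm ?_))
  refine (coeFn_psi S π (psi S ρ f)).trans ?_
  filter_upwards [(measurePreserving_perm σ π).quasiMeasurePreserving.ae (coeFn_psi S ρ f)] with t ht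
  rw [ht, S.qPerm_mul, mul_assoc]
  rfl

variable {σ} in
lemma coeFn_psi_swap (S : Statistics σ) {n : ℕ} (j : Fin n) (f : Particle σ (n + 1)) :
    psi S (Equiv.swap j.castSucc j.succ) f =ᵐ[Measure.pi fun _ : Fin (n + 1) => σ]
      fun t => S.q (t j.castSucc) (t j.succ) * f (t ∘ Equiv.swap j.castSucc j.succ) := by
  refine (coeFn_psi S _ f).trans (ae_of_all _ fun t => ?_)
  have : S.qPerm (Equiv.swap j.castSucc j.succ)⁻¹ t =
      ∏ p ∈ {(j.castSucc, j.succ)}, S.q (t p.1) (t p.2) := by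
    refine Finset.prod_congr ?_ fun _ _ => rfl
    ext ⟨a, b⟩
    rw [Finset.mem_filter, Finset.mem_singleton, Prod.mk.injEq, Equiv.swap_inv,
      Equiv.swap_apply_def, Equiv.swap_apply_def]
    simp only [Finset.mem_univ, true_and, Fin.ext_iff, Fin.lt_def, Fin.val_castSucc, Fin.val_succ]
    constructor
    · rintro ⟨h1, h2⟩
      split_ifs at h2 <;> simp at h2 <;> omega
    · rintro ⟨h1, h2⟩
      simp only [h1, h2]
      simp
  simp only [this, Finset.prod_singleton]

variable {σ} in
/-- The `Q`-symmetrization operator `P_n = (1/n!) ∑_π Ψ_π`. -/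
def symmetrization (S : Statistics σ) (n : ℕ) : Particle σ n →L[ℂ] Particle σ n :=
  ((n.factorial : ℂ)⁻¹) • ∑ π : Equiv.Perm (Fin n), psi S π

variable {σ} in
lemma psi_mul_symmetrization (S : Statistics σ) {n : ℕ} (π : Equiv.Perm (Fin n)) :
    psi S π * symmetrization S n = symmetrization S n := by
  unfold symmetrization
  rw [mul_smul_comm, Finset.mul_sum]
  congr 1
  simp_rw [← psi_mul]
  exact Equiv.sum_comp (Equiv.mulLeft π) (fun ρ => psi S ρ)

variable {σ} in
lemma isIdempotentElem_symmetrization (S : Statistics σ) (n : ℕ) :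
    IsIdempotentElem (symmetrization S n) := by
  have h : (∑ π : Equiv.Perm (Fin n), psi S π) * symmetrization S n =
      (n.factorial : ℂ) • symmetrization S n := by
    simp [Finset.sum_mul, psi_mul_symmetrization, Fintype.card_perm, Nat.cast_smul_eq_nsmul]
  unfold IsIdempotentElem
  conv_lhs => enter [1]; unfold symmetrization
  rw [smul_mul_assoc, h, smul_smul, inv_mul_cancel₀ (by exact_mod_cast n.factorial_ne_zero),
    one_smul]

variable {σ} in
/-- The `n`-th `Q`-symmetric tensor power of `L²(T, σ)`, the range of `P_n`. -/
def QSym (S : Statistics σ) (n : ℕ) : Submodule ℂ (Particle σ n) :=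
  LinearMap.range (symmetrization S n).toLinearMap

instance {σ : Measure T} [SigmaFinite σ] (S : Statistics σ) (n : ℕ) : CompleteSpace (QSym S n) :=
  (ContinuousLinearMap.IsIdempotentElem.isClosed_range
    (isIdempotentElem_symmetrization S n)).completeSpace_coe

variable {σ} in
lemma mem_QSym_iff (S : Statistics σ) {n : ℕ} (f : Particle σ n) :
    f ∈ QSym S n ↔ symmetrization S n f = f := by
  constructor
  · rintro ⟨g, rfl⟩
    exact DFunLike.congr_fun (isIdempotentElem_symmetrization S n) g
  · exact fun h => ⟨f, h⟩

variable {σ} in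
lemma mem_QSym_iff_psi (S : Statistics σ) {n : ℕ} (f : Particle σ n) :
    f ∈ QSym S n ↔ ∀ π : Equiv.Perm (Fin n), psi S π f = f := by
  rw [mem_QSym_iff]
  constructor
  · intro h π
    rw [← h]
    exact DFunLike.congr_fun (psi_mul_symmetrization S π) f
  · intro h
    have : (n.factorial : ℂ) ≠ 0 := by exact_mod_cast n.factorial_ne_zero
    simp [symmetrization, h, Fintype.card_perm, ← Nat.cast_smul_eq_nsmul ℂ,
      smul_smul, this]

variable {σ} in
/-- `P_n` as an operator from `L²(Tⁿ)` onto the `Q`-symmetric functions. -/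
def toQSym (S : Statistics σ) (n : ℕ) : Particle σ n →L[ℂ] QSym S n :=
  (symmetrization S n).codRestrict (QSym S n) fun f => ⟨f, rfl⟩

lemma measurePreserving_split (n : ℕ) :
    MeasurePreserving (fun t : Fin (n + 1) → T => (t 0, Fin.tail t))
      (Measure.pi fun _ : Fin (n + 1) => σ) (σ.prod (Measure.pi fun _ : Fin n => σ)) :=
  measurePreserving_piFinSuccAbove (fun _ : Fin (n + 1) => σ) 0

variable {σ} in
lemma memLp_tensor (h : Lp ℂ 2 σ) {n : ℕ} (f : Particle σ n) :
    MemLp (fun t : Fin (n + 1) → T => h (t 0) * f (Fin.tail t)) 2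
      (Measure.pi fun _ : Fin (n + 1) => σ) := by
  have h1 := (memLp_two_iff_integrable_sq_norm (Lp.aestronglyMeasurable h)).1 (Lp.memLp h)
  have h2 := (memLp_two_iff_integrable_sq_norm (Lp.aestronglyMeasurable f)).1 (Lp.memLp f)
  have h3 : MemLp (fun z : T × (Fin n → T) => h z.1 * f z.2) 2
      (σ.prod (Measure.pi fun _ : Fin n => σ)) := by
    refine (memLp_two_iff_integrable_sq_norm
      ((Lp.aestronglyMeasurable h).comp_fst.mul (Lp.aestronglyMeasurable f).comp_snd)).2 ?_
    refine (h1.mul_prod h2).congr (ae_of_all _ fun z => ?_)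
    simp [mul_pow]
  exact h3.comp_measurePreserving (measurePreserving_split σ n)

lemma measurePreserving_snd_comp_split (n : ℕ) :
    Measure.QuasiMeasurePreserving (fun t : Fin (n + 1) → T => Fin.tail t)
      (Measure.pi fun _ : Fin (n + 1) => σ) (Measure.pi fun _ : Fin n => σ) :=
  Measure.quasiMeasurePreserving_snd.comp (measurePreserving_split σ n).quasiMeasurePreserving

variable {σ} in
lemma norm_tensor (h : Lp ℂ 2 σ) {n : ℕ} (f : Particle σ n) :
    ‖(memLp_tensor h f).toLp‖ ≤ ‖h‖ * ‖f‖ := by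
  have e : eLpNorm (fun t : Fin (n + 1) → T => h (t 0) * f (Fin.tail t)) 2
      (Measure.pi fun _ : Fin (n + 1) => σ) = eLpNorm h 2 σ *
        eLpNorm f 2 (Measure.pi fun _ : Fin n => σ) := by
    have e1 : AEStronglyMeasurable (fun z : T × (Fin n → T) => h z.1 * f z.2)
        (σ.prod (Measure.pi fun _ : Fin n => σ)) :=
      (Lp.aestronglyMeasurable h).comp_fst.mul (Lp.aestronglyMeasurable f).comp_snd
    have e2 := eLpNorm_comp_measurePreserving (p := 2) e1 (measurePreserving_split σ n)
    refine Eq.trans e2 ?_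
    simp only [eLpNorm_eq_lintegral_rpow_enorm_toReal (two_ne_zero) ENNReal.ofNat_ne_top]
    rw [← ENNReal.mul_rpow_of_nonneg _ _ (by positivity), ← lintegral_prod_mul]
    · simp [mul_pow]
    · exact (Lp.aestronglyMeasurable h).enorm.pow_const _
    · exact (Lp.aestronglyMeasurable f).enorm.pow_const _
  rw [Lp.norm_toLp, e, ENNReal.toReal_mul, Lp.norm_def, Lp.norm_def]

/-- The map `f ↦ h ⊗ f`, `(h ⊗ f)(t₁, …, t_{n+1}) = h(t₁) f(t₂, …, t_{n+1})`. -/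
def tensor (h : Lp ℂ 2 σ) (n : ℕ) : Particle σ n →L[ℂ] Particle σ (n + 1) :=
  LinearMap.mkContinuous
    { toFun := fun f => (memLp_tensor h f).toLp
      map_add' := fun f g => by
        rw [← MemLp.toLp_add, MemLp.toLp_eq_toLp_iff]
        filter_upwards [((measurePreserving_snd_comp_split σ n)).ae
          (Lp.coeFn_add f g)] with t ht
        change h (t 0) * (f + g : Particle σ n) (Fin.tail t) =
          h (t 0) * f (Fin.tail t) + h (t 0) * g (Fin.tail t)
        rw [ht, Pi.add_apply, mul_add]
      map_smul' := fun a f => by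
        rw [RingHom.id_apply, ← MemLp.toLp_const_smul, MemLp.toLp_eq_toLp_iff]
        filter_upwards [((measurePreserving_snd_comp_split σ n)).ae
          (Lp.coeFn_smul a f)] with t ht
        change h (t 0) * (a • f : Particle σ n) (Fin.tail t) = a * (h (t 0) * f (Fin.tail t))
        rw [ht, Pi.smul_apply, smul_eq_mul, mul_left_comm] }
    ‖h‖ fun f => norm_tensor h f

end Operators

section Fock

lemma bdd_sumFun {T : Type*} (h : T → ℂ) (hb : ∃ C : ℝ, ∀ t, ‖h t‖ ≤ C) (n : ℕ) :
    ∃ C : ℝ, ∀ t : Fin n → T, ‖∑ i, h (t i)‖ ≤ C :=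
  hb.elim fun C hC => ⟨∑ _i : Fin n, C, fun t =>
    (norm_sum_le _ _).trans (Finset.sum_le_sum fun i _ => hC (t i))⟩

lemma measurable_sumFun {T : Type*} [MeasurableSpace T] (h : T → ℂ) (hm : Measurable h) (n : ℕ) :
    Measurable fun t : Fin n → T => ∑ i, h (t i) :=
  Finset.measurable_sum _ fun i _ => hm.comp (measurable_pi_apply i)

variable {T : Type*} [MeasurableSpace T] {σ : Measure T} [SigmaFinite σ] (S : Statistics σ)

/-- The finite-particle subspace `F_fin^Q` of the `Q`-Fock space. -/
abbrev FockFin : Type _ := @DirectSum ℕ (fun n => QSym S n) fun _ => AddCommGroup.toAddCommMonoid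

/-- The inner product of the `Q`-Fock space, `∑ n! (f⁽ⁿ⁾, g⁽ⁿ⁾)` (conjugate linear in the first
argument). -/
def fockInner (F G : FockFin S) : ℂ :=
  ∑ᶠ n : ℕ, (n.factorial : ℂ) * inner ℂ (F n) (G n)

lemma hasFiniteSupport_fockInner (F G : FockFin S) :
    (Function.support fun n : ℕ => (n.factorial : ℂ) * inner ℂ (F n) (G n)).Finite := by
  classical
  refine (DFinsupp.support F).finite_toSet.subset fun n hn => ?_
  simp only [Finset.mem_coe, DFinsupp.mem_support_toFun]
  intro h
  apply hn
  have h' : F n = 0 := h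
  simp [h']

lemma fockInner_conj_symm (F G : FockFin S) : conj (fockInner S G F) = fockInner S F G := by
  unfold fockInner
  refine ((starRingEnd ℂ).toAddMonoidHom.map_finsum (hasFiniteSupport_fockInner S G F)).trans ?_
  refine finsum_congr fun n => ?_
  simp [inner_conj_symm]

lemma fockInner_add_left (F G H : FockFin S) :
    fockInner S (F + G) H = fockInner S F H + fockInner S G H := by
  unfold fockInner
  rw [← finsum_add_distrib (hasFiniteSupport_fockInner S F H) (hasFiniteSupport_fockInner S G H)]
  refine finsum_congr fun n => ?_
  rw [DirectSum.add_apply, inner_add_left, mul_add]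

lemma fockInner_smul_left (c : ℂ) (F G : FockFin S) :
    fockInner S (c • F) G = conj c * fockInner S F G := by
  unfold fockInner
  rw [← smul_eq_mul, smul_finsum' _ (hasFiniteSupport_fockInner S F G)]
  refine finsum_congr fun n => ?_
  rw [DirectSum.smul_apply, inner_smul_left, smul_eq_mul, mul_left_comm]

lemma fockInner_self_nonneg (F : FockFin S) : 0 ≤ (fockInner S F F).re := by
  unfold fockInner
  have h := Complex.reLm.toAddMonoidHom.map_finsum (hasFiniteSupport_fockInner S F F)
  refine le_of_le_of_eq (finsum_nonneg fun n => ?_) h.symm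
  have : (0 : ℝ) ≤ (inner ℂ (F n) (F n)).re := inner_self_nonneg (𝕜 := ℂ) (x := F n)
  change 0 ≤ ((n.factorial : ℂ) * inner ℂ (F n) (F n)).re
  rw [← Complex.ofReal_natCast, Complex.re_ofReal_mul]
  positivity

lemma memLp_vacuum {T : Type*} [MeasurableSpace T] {σ : Measure T} :
    MemLp (fun _ : Fin 0 → T => (1 : ℂ)) 2 (Measure.pi fun _ : Fin 0 => σ) := by
  rw [Measure.pi_of_empty]
  exact memLp_const 1

/-- The vacuum vector `Ω = (1, 0, 0, …)`. -/
def vacuum : FockFin S := DirectSum.lof ℂ ℕ (fun n => QSym S n) 0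
  ⟨(memLp_vacuum (σ := σ)).toLp, (mem_QSym_iff_psi S _).2 fun π => by
    rw [Subsingleton.elim π 1, psi_one]; rfl⟩

/-- `f⁽ⁿ⁾ ↦ h ⊛ f⁽ⁿ⁾ = P_{n+1}(h ⊗ f⁽ⁿ⁾)`. -/
def creationL (h : Lp ℂ 2 σ) (n : ℕ) : QSym S n →L[ℂ] QSym S (n + 1) :=
  (toQSym S (n + 1)).comp ((tensor σ h n).comp (QSym S n).subtypeL)

/-- The adjoint of `creationL` with respect to the weights `n!` and `(n+1)!` of the Fock space. -/
def annihilationL (h : Lp ℂ 2 σ) (n : ℕ) : QSym S (n + 1) →L[ℂ] QSym S n :=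
  ((n : ℂ) + 1) • ContinuousLinearMap.adjoint (creationL S h n)

/-- The creation operator `a⁺(h)`. -/
def creation (h : Lp ℂ 2 σ) : Module.End ℂ (FockFin S) :=
  DirectSum.toModule ℂ ℕ _ fun n =>
    DirectSum.lof ℂ ℕ (fun n => QSym S n) (n + 1) ∘ₗ (creationL S h n).toLinearMap

/-- The components of the annihilation operator. -/
def annihilationAux (h : Lp ℂ 2 σ) : (n : ℕ) → QSym S n →ₗ[ℂ] FockFin S
  | 0 => 0
  | n + 1 => DirectSum.lof ℂ ℕ (fun n => QSym S n) n ∘ₗ (annihilationL S h n).toLinearMap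

/-- The annihilation operator `a⁻(h)`, the adjoint of `a⁺(h)` (see `fockInner_creation`). -/
def annihilation (h : Lp ℂ 2 σ) : Module.End ℂ (FockFin S) :=
  DirectSum.toModule ℂ ℕ _ (annihilationAux S h)

lemma creation_apply_zero (h : Lp ℂ 2 σ) (F : FockFin S) : creation S h F 0 = 0 := by
  induction F using DirectSum.induction_on with
  | zero => simp
  | of n f =>
    rw [← DirectSum.lof_eq_of ℂ, creation, DirectSum.toModule_lof]
    exact DFinsupp.single_eq_of_ne (Nat.succ_ne_zero n).symm
  | add F G hF hG => rw [map_add, DirectSum.add_apply, hF, hG, add_zero]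

lemma creation_apply_succ (h : Lp ℂ 2 σ) (F : FockFin S) (n : ℕ) :
    creation S h F (n + 1) = creationL S h n (F n) := by
  induction F using DirectSum.induction_on with
  | zero => simp
  | of m f =>
    rw [← DirectSum.lof_eq_of ℂ, creation, DirectSum.toModule_lof]
    by_cases hm : m = n
    · subst hm
      simp [DirectSum.lof_apply]
    · have h1 : DirectSum.lof ℂ ℕ (fun n => QSym S n) m f n = 0 :=
        DFinsupp.single_eq_of_ne (Ne.symm hm)
      rw [h1, map_zero]
      exact DFinsupp.single_eq_of_ne (fun h => hm (Nat.succ_injective h).symm)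
  | add F G hF hG => rw [map_add, DirectSum.add_apply, hF, hG, DirectSum.add_apply, map_add]

lemma annihilation_apply (h : Lp ℂ 2 σ) (F : FockFin S) (n : ℕ) :
    annihilation S h F n = annihilationL S h n (F (n + 1)) := by
  induction F using DirectSum.induction_on with
  | zero => simp
  | of m f =>
    rw [← DirectSum.lof_eq_of ℂ, annihilation, DirectSum.toModule_lof]
    rcases m with _ | m
    · have h1 : DirectSum.lof ℂ ℕ (fun n => QSym S n) 0 f (n + 1) = 0 :=
        DFinsupp.single_eq_of_ne (Nat.succ_ne_zero n)
      rw [h1, map_zero]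
      rfl
    · by_cases hm : m = n
      · subst hm
        simp [annihilationAux, DirectSum.lof_apply]
      · have h1 : DirectSum.lof ℂ ℕ (fun n => QSym S n) (m + 1) f (n + 1) = 0 :=
          DFinsupp.single_eq_of_ne (fun h => hm (Nat.succ_injective h).symm)
        rw [h1, map_zero]
        exact DFinsupp.single_eq_of_ne (Ne.symm hm)
  | add F G hF hG => rw [map_add, DirectSum.add_apply, hF, hG, DirectSum.add_apply, map_add]

lemma fockInner_creation (h : Lp ℂ 2 σ) (F G : FockFin S) :
    fockInner S (creation S h F) G = fockInner S F (annihilation S h G) := by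
  classical
  obtain ⟨N, hN⟩ : ∃ N : ℕ, ∀ n, N ≤ n → F n = 0 := by
    refine ⟨(DFinsupp.support F).sup id + 1, fun n hn => ?_⟩
    by_contra hne
    have : n ∈ DFinsupp.support F := DFinsupp.mem_support_toFun _ _ |>.2 hne
    have := Finset.le_sup (f := id) this
    simp only [id_eq] at this
    omega
  have h1 : fockInner S (creation S h F) G = ∑ n ∈ Finset.range (N + 1),
      (n.factorial : ℂ) * inner ℂ (creation S h F n) (G n) := by
    refine finsum_eq_sum_of_support_subset _ fun n hn => ?_
    by_contra hne
    apply hn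
    obtain ⟨m, rfl⟩ : ∃ m, n = m + 1 := ⟨n - 1, by simp at hne; omega⟩
    have : F m = 0 := hN m (by simp at hne; omega)
    simp [creation_apply_succ, this]
  have h2 : fockInner S F (annihilation S h G) = ∑ n ∈ Finset.range N,
      (n.factorial : ℂ) * inner ℂ (F n) (annihilation S h G n) := by
    refine finsum_eq_sum_of_support_subset _ fun n hn => ?_
    by_contra hne
    apply hn
    have : F n = 0 := hN n (by simp at hne; omega)
    simp [this]
  rw [h1, h2, Finset.sum_range_succ', creation_apply_zero, inner_zero_left, mul_zero, add_zero]
  refine Finset.sum_congr rfl fun n _ => ?_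
  rw [creation_apply_succ, annihilation_apply, annihilationL, smul_apply,
    inner_smul_right, ContinuousLinearMap.adjoint_inner_right, Nat.factorial_succ]
  push_cast
  ring

variable (h : T → ℂ) (hm : Measurable h) (hb : ∃ C : ℝ, ∀ t, ‖h t‖ ≤ C)

/-- Multiplication by `h(t₁) + ⋯ + h(tₙ)`. -/
def neutralL (n : ℕ) : QSym S n →L[ℂ] QSym S n :=
  ((mulOp (Measure.pi fun _ : Fin n => σ) (fun t => ∑ i, h (t i))
    (measurable_sumFun h hm n) (bdd_sumFun h hb n)).comp
    (QSym S n).subtypeL).codRestrict (QSym S n) fun f => by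
      refine (mem_QSym_iff_psi S _).2 fun π => ?_
      have hf := (mem_QSym_iff_psi S f.1).1 f.2 π
      set g := mulOp (Measure.pi fun _ : Fin n => σ) (fun t => ∑ i, h (t i))
        (measurable_sumFun h hm n) (bdd_sumFun h hb n) f.1 with hg
      have hg' : g =ᵐ[Measure.pi fun _ : Fin n => σ] fun t => (∑ i, h (t i)) * f.1 t :=
        coeFn_mulOp _ _ _ _ _
      change psi S π g = g
      refine Lp.ext ((coeFn_psi S π g).trans ?_)
      have h1 := coeFn_psi S π f.1
      rw [hf] at h1
      filter_upwards [(measurePreserving_perm σ π).quasiMeasurePreserving.ae hg', hg', h1]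
        with t h2 h3 h4
      rw [h2, h3, h4, mul_left_comm]
      congr 1
      exact Equiv.sum_comp π fun i => h (t i)

/-- The neutral operator `a⁰(h)`. -/
def neutral : Module.End ℂ (FockFin S) :=
  DirectSum.toModule ℂ ℕ _ fun n =>
    DirectSum.lof ℂ ℕ (fun n => QSym S n) n ∘ₗ (neutralL S h hm hb n).toLinearMap

lemma neutral_apply (F : FockFin S) (n : ℕ) :
    neutral S h hm hb F n = neutralL S h hm hb n (F n) := by
  induction F using DirectSum.induction_on with
  | zero => simp
  | of m f =>
    rw [← DirectSum.lof_eq_of ℂ, neutral, DirectSum.toModule_lof]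
    by_cases hm : m = n
    · subst hm
      simp [DirectSum.lof_apply]
    · have h1 : DirectSum.lof ℂ ℕ (fun n => QSym S n) m f n = 0 :=
        DFinsupp.single_eq_of_ne (Ne.symm hm)
      rw [h1, map_zero]
      exact DFinsupp.single_eq_of_ne (Ne.symm hm)
  | add F G hF hG => rw [map_add, DirectSum.add_apply, hF, hG, DirectSum.add_apply, map_add]

lemma fockInner_annihilation (h : Lp ℂ 2 σ) (F G : FockFin S) :
    fockInner S (annihilation S h F) G = fockInner S F (creation S h G) := by
  rw [← fockInner_conj_symm, ← fockInner_creation, fockInner_conj_symm]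

lemma fockInner_neutral (hr : ∀ t, conj (h t) = h t) (F G : FockFin S) :
    fockInner S (neutral S h hm hb F) G = fockInner S F (neutral S h hm hb G) := by
  refine finsum_congr fun n => ?_
  rw [neutral_apply, neutral_apply]
  congr 1
  change inner ℂ (neutralL S h hm hb n (F n)).1 (G n).1 =
    inner ℂ (F n).1 (neutralL S h hm hb n (G n)).1
  have key : ∀ f : QSym S n, (neutralL S h hm hb n f).1 =ᵐ[Measure.pi fun _ : Fin n => σ]
      fun t => (∑ i, h (t i)) * f.1 t := fun f => coeFn_mulOp _ _ (measurable_sumFun h hm n)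
      (bdd_sumFun h hb n) _
  rw [L2.inner_def, L2.inner_def]
  refine integral_congr_ae ?_
  filter_upwards [key (F n), key (G n)] with t h1 h2
  rw [h1, h2]
  simp only [RCLike.inner_apply, map_mul, map_sum, hr]
  ring

end Fock

section Field

/-- `B₀(X → 𝕜)`: bounded measurable functions with compact support. -/
def B0 (X : Type*) [TopologicalSpace X] [MeasurableSpace X] (𝕜 : Type*) [RCLike 𝕜] :
    Submodule 𝕜 (X → 𝕜) where
  carrier := {f | Measurable f ∧ (∃ C : ℝ, ∀ x, ‖f x‖ ≤ C) ∧ HasCompactSupport f}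
  zero_mem' := ⟨measurable_const, ⟨0, by simp⟩, HasCompactSupport.zero⟩
  add_mem' := by
    rintro f g ⟨hf, ⟨C, hC⟩, hf'⟩ ⟨hg, ⟨D, hD⟩, hg'⟩
    exact ⟨hf.add hg, ⟨C + D, fun x => (norm_add_le _ _).trans (add_le_add (hC x) (hD x))⟩,
      hf'.add hg'⟩
  smul_mem' := by
    rintro c f ⟨hf, ⟨C, hC⟩, hf'⟩
    exact ⟨hf.const_smul c, ⟨‖c‖ * C, fun x => by
      rw [Pi.smul_apply, norm_smul]; exact mul_le_mul_of_nonneg_left (hC x) (norm_nonneg _)⟩,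
      hf'.smul_left (f := fun _ => c)⟩

variable {T : Type*} [TopologicalSpace T] [MeasurableSpace T] [OpensMeasurableSpace T]
  {σ : Measure T} [SigmaFinite σ] [IsFiniteMeasureOnCompacts σ] (S : Statistics σ) (lam : ℝ)

lemma memLp_B0 {T : Type*} [TopologicalSpace T] [MeasurableSpace T] [OpensMeasurableSpace T]
    {σ : Measure T} [IsFiniteMeasureOnCompacts σ] (f : B0 T ℝ) : MemLp (fun t => (f.1 t : ℂ)) 2 σ := by
  obtain ⟨hf, ⟨C, hC⟩, hs⟩ := f.2
  have h1 : MemLp ((tsupport f.1).indicator fun _ => C) 2 σ :=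
    memLp_indicator_const 2 (isClosed_tsupport _).measurableSet C (Or.inr hs.isCompact.measure_ne_top)
  refine h1.of_le (Complex.measurable_ofReal.comp hf).aestronglyMeasurable (ae_of_all _ fun t => ?_)
  by_cases ht : t ∈ tsupport f.1
  · rw [Set.indicator_of_mem ht, Complex.norm_real]
    exact (hC t).trans (le_abs_self C)
  · simp [image_eq_zero_of_notMem_tsupport ht]

/-- The operator `⟨f, ω⟩ = a⁺(f) + λ a⁰(f) + a⁻(f)`. -/
def field (f : B0 T ℝ) : Module.End ℂ (FockFin S) :=
  creation S (memLp_B0 f).toLp + (lam : ℂ) • neutral S (fun t => (f.1 t : ℂ))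
    (Complex.measurable_ofReal.comp f.2.1)
    (f.2.2.1.elim fun C hC => ⟨C, fun t => by rw [Complex.norm_real]; exact hC t⟩) +
  annihilation S (memLp_B0 f).toLp

/-- The algebra of noncommutative polynomials in the variables `⟨f, ω⟩`. As each `⟨f, ω⟩` is
Hermitian, the unital algebra generated by them is also the unital `*`-algebra generated by them. -/
def polyAlg : Subalgebra ℂ (Module.End ℂ (FockFin S)) :=
  Algebra.adjoin ℂ (Set.range (field S lam))

/-- `⟨f, ω⟩` as an element of the algebra of polynomials. -/
def polyField (f : B0 T ℝ) : polyAlg S lam :=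
  ⟨field S lam f, Algebra.subset_adjoin ⟨f, rfl⟩⟩

lemma fockInner_field (f : B0 T ℝ) (F G : FockFin S) :
    fockInner S (field S lam f F) G = fockInner S F (field S lam f G) := by
  have key : ∀ F G : FockFin S, fockInner S (field S lam f F) G =
      fockInner S (creation S (memLp_B0 f).toLp F) G +
      lam * fockInner S (neutral S (fun t => (f.1 t : ℂ)) (Complex.measurable_ofReal.comp f.2.1)
        (f.2.2.1.elim fun C hC => ⟨C, fun t => by rw [Complex.norm_real]; exact hC t⟩) F) G +
      fockInner S (annihilation S (memLp_B0 f).toLp F) G := fun F G => by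
    rw [field, LinearMap.add_apply, LinearMap.add_apply, LinearMap.smul_apply,
      fockInner_add_left, fockInner_add_left, fockInner_smul_left, Complex.conj_ofReal]
  rw [← fockInner_conj_symm S F, key, key, map_add, map_add, map_mul, fockInner_conj_symm,
    fockInner_conj_symm, fockInner_conj_symm, fockInner_creation, fockInner_annihilation,
    fockInner_neutral S _ _ _ fun t => Complex.conj_ofReal _, Complex.conj_ofReal]
  ring

/-- Every polynomial `p` has an adjoint `p*` which is again a polynomial. -/
lemma exists_adjoint (p : polyAlg S lam) : ∃ p' : polyAlg S lam,
    ∀ F G, fockInner S (p.1 F) G = fockInner S F (p'.1 G) := by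
  obtain ⟨p, hp⟩ := p
  have right : ∀ F G H : FockFin S, fockInner S F (G + H) = fockInner S F G + fockInner S F H :=
    fun F G H => by
      rw [← fockInner_conj_symm, fockInner_add_left, map_add, fockInner_conj_symm,
        fockInner_conj_symm]
  induction hp using Algebra.adjoin_induction with
  | mem x hx =>
    obtain ⟨f, rfl⟩ := hx
    exact ⟨polyField S lam f, fockInner_field S lam f⟩
  | algebraMap c =>
    refine ⟨algebraMap ℂ _ (conj c), fun F G => ?_⟩
    change fockInner S (c • F) G = fockInner S F (conj c • G)
    rw [← fockInner_conj_symm S F, fockInner_smul_left, fockInner_smul_left, map_mul,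
      fockInner_conj_symm, Complex.conj_conj]
  | add x y _ _ hx hy =>
    obtain ⟨x', hx'⟩ := hx
    obtain ⟨y', hy'⟩ := hy
    refine ⟨x' + y', fun F G => ?_⟩
    change fockInner S (x F + y F) G = fockInner S F (x'.1 G + y'.1 G)
    rw [fockInner_add_left, right, ← hx', ← hy']
  | mul x y _ _ hx hy =>
    obtain ⟨x', hx'⟩ := hx
    obtain ⟨y', hy'⟩ := hy
    exact ⟨y' * x', fun F G => (hx' _ _).trans (hy' _ _)⟩

/-- The space of polynomials equipped with the (semidefinite) scalar product `τ(p₂* p₁)`. -/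
def PreL2 : Type _ := polyAlg S lam

instance : AddCommGroup (PreL2 S lam) := inferInstanceAs (AddCommGroup (polyAlg S lam))
instance : Module ℂ (PreL2 S lam) := inferInstanceAs (Module ℂ (polyAlg S lam))

/-- The scalar product `(p₁, p₂) = τ(p₂* p₁) = (p₁Ω, p₂Ω)`, conjugate linear in the argument `p₂`
that is written first here. -/
@[reducible] def preL2Core : PreInnerProductSpace.Core ℂ (PreL2 S lam) where
  inner p₂ p₁ := fockInner S (p₂.1 (vacuum S)) (p₁.1 (vacuum S))
  conj_inner_symm _ _ := fockInner_conj_symm S _ _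
  re_inner_nonneg _ := fockInner_self_nonneg S _
  add_left _ _ _ := fockInner_add_left S _ _ _
  smul_left _ _ _ := fockInner_smul_left S _ _ _

instance : SeminormedAddCommGroup (PreL2 S lam) :=
  @InnerProductSpace.Core.toSeminormedAddCommGroup ℂ (PreL2 S lam) _ _ _ (preL2Core S lam)

instance : InnerProductSpace ℂ (PreL2 S lam) := InnerProductSpace.ofCore (preL2Core S lam)

/-- The noncommutative space `L²(τ)`: the completion of the polynomials modulo null vectors. -/
abbrev L2tau : Type _ := UniformSpace.Completion (PreL2 S lam)

/-- The canonical map from polynomials to `L²(τ)`. -/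
def toL2tau : polyAlg S lam →ₗ[ℂ] L2tau S lam :=
  (UniformSpace.Completion.toComplL (𝕜 := ℂ) (E := PreL2 S lam)).toLinearMap.comp
    (LinearMap.id : polyAlg S lam →ₗ[ℂ] polyAlg S lam)

/-- The vacuum state `τ(p) = (pΩ, Ω)`. -/
def vacuumState (p : polyAlg S lam) : ℂ := fockInner S (vacuum S) (p.1 (vacuum S))

/-- The scalar product of `L²(τ)` is `τ(p₂* p₁)`. -/
lemma inner_toL2tau (p₁ p₂ p₂' : polyAlg S lam)
    (h : ∀ F G, fockInner S (p₂.1 F) G = fockInner S F (p₂'.1 G)) :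
    inner ℂ (toL2tau S lam p₂) (toL2tau S lam p₁) = vacuumState S lam (p₂' * p₁) :=
  (UniformSpace.Completion.inner_coe (𝕜 := ℂ) (E := PreL2 S lam) p₂ p₁).trans (h _ _)

/-- The monomial `⟨f₁, ω⟩ ⋯ ⟨fₙ, ω⟩`. -/
def monomial {n : ℕ} (f : Fin n → B0 T ℝ) : polyAlg S lam :=
  (List.ofFn fun i => polyField S lam (f i)).prod

/-- The polynomials of degree at most `n`. -/
def polyDeg (n : ℕ) : Submodule ℂ (polyAlg S lam) :=
  Submodule.span ℂ {p | ∃ k ≤ n, ∃ f : Fin k → B0 T ℝ, p = monomial S lam f}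

/-- The closure in `L²(τ)` of the polynomials of degree at most `n`. -/
def MP (n : ℕ) : Submodule ℂ (L2tau S lam) :=
  ((polyDeg S lam n).map (toL2tau S lam)).topologicalClosure

/-- The orthogonal polynomials: `OP⁽⁰⁾ = MP⁽⁰⁾` and `OP⁽ⁿ⁾ = MP⁽ⁿ⁾ ⊖ MP⁽ⁿ⁻¹⁾`. -/
def OP : ℕ → Submodule ℂ (L2tau S lam)
  | 0 => MP S lam 0
  | n + 1 => MP S lam (n + 1) ⊓ (MP S lam n)ᗮ

lemma isClosed_OP (n : ℕ) : IsClosed (OP S lam n : Set (L2tau S lam)) := by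
  cases n with
  | zero => exact Submodule.isClosed_topologicalClosure _
  | succ n => exact (Submodule.isClosed_topologicalClosure _).inter (Submodule.isClosed_orthogonal _)

instance (n : ℕ) : CompleteSpace (OP S lam n) := (isClosed_OP S lam n).completeSpace_coe

/-- The linear map `X` is the extension of `f₁ ⊗ ⋯ ⊗ fₙ ↦ ⟨f₁, ω⟩ ⋯ ⟨fₙ, ω⟩` to
`f⁽ⁿ⁾ ↦ ⟨f⁽ⁿ⁾, ω^{⊗n}⟩`, `f⁽ⁿ⁾ ∈ B₀(Tⁿ → ℂ)`, by linearity and continuity, continuity being meant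
with respect to pointwise convergence of uniformly bounded functions with supports in a common
compact set. -/
structure IsSmearing (n : ℕ) (X : B0 (Fin n → T) ℂ →ₗ[ℂ] L2tau S lam) : Prop where
  map_tensor : ∀ (f : Fin n → B0 T ℝ) (g : B0 (Fin n → T) ℂ),
    (∀ t, g.1 t = ∏ i, ((f i).1 (t i) : ℂ)) → X g = toL2tau S lam (monomial S lam f)
  continuous : ∀ (g : ℕ → B0 (Fin n → T) ℂ) (g' : B0 (Fin n → T) ℂ) (C : ℝ) (K : Set (Fin n → T)),
    IsCompact K → (∀ j t, ‖(g j).1 t‖ ≤ C) → (∀ j, ∀ t ∉ K, (g j).1 t = 0) →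
    (∀ t, Tendsto (fun j => (g j).1 t) atTop (𝓝 (g'.1 t))) →
    Tendsto (fun j => X (g j)) atTop (𝓝 (X g'))

/-- `⟨g, :ω^{⊗n}:⟩`, the orthogonal projection of `⟨g, ω^{⊗n}⟩ = X g` onto the orthogonal
polynomials of degree `n`. -/
def wick {n : ℕ} (X : B0 (Fin n → T) ℂ →ₗ[ℂ] L2tau S lam) (g : B0 (Fin n → T) ℂ) : L2tau S lam :=
  (OP S lam n).starProjection (X g)

end Field

/-- A partition of `{1, …, n}` whose blocks are marked by `+1` or `-1`, singletons having the
mark `+1`. -/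
structure MarkedPartition (n : ℕ) where
  part : Finpartition (Finset.univ : Finset (Fin n))
  mark : {B : Finset (Fin n) // B ∈ part.parts} → ℤˣ
  mark_singleton : ∀ B, B.1.card = 1 → mark B = 1

namespace MarkedPartition

variable {n : ℕ}

instance : Fintype (MarkedPartition n) :=
  Fintype.ofInjective (β := Σ P : Finpartition (Finset.univ : Finset (Fin n)),
      ({B : Finset (Fin n) // B ∈ P.parts} → ℤˣ)) (fun V => ⟨V.part, V.mark⟩) (by
    rintro ⟨P, m, h⟩ ⟨P', m', h'⟩ heq
    simp only [Sigma.mk.injEq] at heq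
    obtain ⟨rfl, heq⟩ := heq
    obtain rfl := eq_of_heq heq
    rfl)

variable (V : MarkedPartition n)

/-- The blocks of the partition. -/
abbrev Block : Type := {B : Finset (Fin n) // B ∈ V.part.parts}

/-- The blocks with mark `-1`. -/
abbrev NegBlock : Type := {B : V.Block // V.mark B = -1}

/-- The minimal element of a block. -/
def min (B : V.Block) : Fin n := B.1.min' (V.part.nonempty_of_mem_parts B.2)

/-- The maximal element of a block. -/
def max (B : V.Block) : Fin n := B.1.max' (V.part.nonempty_of_mem_parts B.2)

/-- The block containing `i`. -/
def blockOf (i : Fin n) : V.Block := ⟨V.part.part i, V.part.part_mem.2 (Finset.mem_univ i)⟩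

/-- The maximal elements of the blocks with mark `+1`: the indices `i` for which the factor
`ω(t_i)` is not removed. -/
def kept : Finset (Fin n) := (Finset.univ.filter fun B : V.Block => V.mark B = 1).image V.max

lemma mark_eq_one {B : V.Block} (h : V.mark B ≠ -1) : V.mark B = 1 :=
  (Int.units_eq_one_or _).resolve_right h

lemma max_mem_kept {B : V.Block} (h : V.mark B ≠ -1) : V.max B ∈ V.kept :=
  Finset.mem_image_of_mem _ (Finset.mem_filter.2 ⟨Finset.mem_univ _, V.mark_eq_one h⟩)

lemma blockOf_max (B : V.Block) : V.blockOf (V.max B) = B :=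
  Subtype.ext (V.part.part_eq_of_mem B.2 (Finset.max'_mem _ _))

/-- The product of the powers `λ^{k-1}`, `λ^{k-2}` contributed by the blocks of size `k` with
mark `+1`, `-1` respectively. -/
def coeff (lam : ℝ) : ℂ :=
  ∏ B : V.Block, if V.mark B = 1 then (lam : ℂ) ^ (B.1.card - 1) else (lam : ℂ) ^ (B.1.card - 2)

section

variable {T : Type*}

/-- The point of `Tⁿ` on the support of the delta functions: all coordinates in the `j`-th block
with mark `+1` (in the order of the maximal elements) are equal to `s j`, and all coordinates in a
block `B` with mark `-1` are equal to `u B`. -/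
def expand (s : Fin V.kept.card → T) (u : V.NegBlock → T) (i : Fin n) : T :=
  if h : V.mark (V.blockOf i) = -1 then u ⟨V.blockOf i, h⟩
  else s ((V.kept.orderIsoOfFin rfl).symm ⟨V.max (V.blockOf i), V.max_mem_kept h⟩)

lemma expand_max_neg (s : Fin V.kept.card → T) (u : V.NegBlock → T) (B : V.NegBlock) :
    V.expand s u (V.max B.1) = u B := by
  have h : V.mark (V.blockOf (V.max B.1)) = -1 := by rw [V.blockOf_max]; exact B.2
  rw [expand, dif_pos h]
  congr 1
  exact Subtype.ext (V.blockOf_max B.1)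

lemma expand_kept (s : Fin V.kept.card → T) (u : V.NegBlock → T) (j : Fin V.kept.card) :
    V.expand s u (V.kept.orderIsoOfFin rfl j) = s j := by
  obtain ⟨B, hB, hBj⟩ := Finset.mem_image.1 (V.kept.orderIsoOfFin rfl j).2
  have hB1 : V.mark B = 1 := (Finset.mem_filter.1 hB).2
  have h : V.mark (V.blockOf (V.kept.orderIsoOfFin rfl j)) ≠ -1 := by
    rw [← hBj, V.blockOf_max, hB1]; decide
  rw [expand, dif_neg h]
  congr 1
  rw [OrderIso.symm_apply_eq]
  apply Subtype.ext
  change V.max (V.blockOf (V.kept.orderIsoOfFin rfl j)) = V.kept.orderIsoOfFin rfl j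
  rw [← hBj, V.blockOf_max]

variable [MeasurableSpace T] {σ : Measure T} (S : Statistics σ)

/-- The function `Q(𝒱; t₁, …, tₙ)`. -/
def q (t : Fin n → T) : ℂ :=
  (∏ p ∈ Finset.univ.filter (fun p : V.Block × V.Block => V.mark p.1 = -1 ∧ V.mark p.2 = -1 ∧
      V.min p.1 < V.min p.2 ∧ V.min p.2 < V.max p.1 ∧ V.max p.1 < V.max p.2),
    S.q (t (V.min p.2)) (t (V.max p.1))) *
  ∏ p ∈ Finset.univ.filter (fun p : V.Block × V.Block => V.mark p.1 = 1 ∧ V.mark p.2 = -1 ∧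
      V.min p.2 < V.max p.1 ∧ V.max p.1 < V.max p.2),
    S.q (t (V.min p.2)) (t (V.max p.1))

lemma norm_q (t : Fin n → T) : ‖V.q S t‖ = 1 := by
  simp [q, norm_prod, S.norm_q]

lemma measurable_q : Measurable (V.q S) := by
  have : ∀ i j : Fin n, Measurable fun t : Fin n → T => S.q (t i) (t j) := fun i j =>
    S.measurable_q.comp (f := fun t : Fin n → T => (t i, t j))
      ((measurable_pi_apply _).prodMk (measurable_pi_apply _))
  exact (Finset.measurable_prod _ fun p _ => this _ _).mul
    (Finset.measurable_prod _ fun p _ => this _ _)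

/-- The function obtained from `f(t) Q(𝒱; t)` by inserting the delta functions and the powers of
`λ` belonging to `𝒱` and integrating over the variables of the blocks with mark `-1`. Smearing
`Q(𝒱; t) :ω(t₁)⋯ω(tₙ):_𝒱` with `f` gives `:ω(s₁)⋯ω(s_k):` smeared with this function. -/
def reduceFun (lam : ℝ) (f : (Fin n → T) → ℂ) (s : Fin V.kept.card → T) : ℂ :=
  V.coeff lam * ∫ u : V.NegBlock → T, f (V.expand s u) * V.q S (V.expand s u)
    ∂(Measure.pi fun _ : V.NegBlock => σ)

lemma measurable_expand :
    Measurable fun p : (Fin V.kept.card → T) × (V.NegBlock → T) => V.expand p.1 p.2 := by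
  refine measurable_pi_lambda _ fun i => ?_
  unfold expand
  split_ifs with h
  · exact (measurable_pi_apply _).comp measurable_snd
  · exact (measurable_pi_apply _).comp measurable_fst

lemma reduceFun_mem [TopologicalSpace T] [T2Space T] [OpensMeasurableSpace T] [SigmaFinite σ]
    [IsFiniteMeasureOnCompacts σ] (lam : ℝ) (f : B0 (Fin n → T) ℂ) :
    V.reduceFun S lam f.1 ∈ B0 (Fin V.kept.card → T) ℂ := by
  obtain ⟨hf, ⟨C, hC⟩, hs⟩ := f.2
  let K : Set T := ⋃ i : Fin n, (fun t : Fin n → T => t i) '' tsupport f.1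
  have hK : IsCompact K := isCompact_iUnion fun i => hs.isCompact.image (continuous_apply i)
  have hfK : ∀ t : Fin n → T, ∀ i, t i ∉ K → f.1 t = 0 := fun t i ht => by
    by_contra hne
    exact ht (Set.mem_iUnion.2 ⟨i, t, subset_tsupport _ hne, rfl⟩)
  refine ⟨?_, ?_, ?_⟩
  · refine measurable_const.mul ?_
    have : StronglyMeasurable fun p : (Fin V.kept.card → T) × (V.NegBlock → T) =>
        f.1 (V.expand p.1 p.2) * V.q S (V.expand p.1 p.2) :=
      ((hf.comp V.measurable_expand).mul ((V.measurable_q S).comp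
        V.measurable_expand)).stronglyMeasurable
    exact (this.integral_prod_right' (ν := Measure.pi fun _ : V.NegBlock => σ)).measurable
  · let KN : Set (V.NegBlock → T) := Set.univ.pi fun _ => K
    refine ⟨‖V.coeff lam‖ * (C * (Measure.pi fun _ : V.NegBlock => σ).real KN), fun s => ?_⟩
    rw [reduceFun, norm_mul]
    refine mul_le_mul_of_nonneg_left ?_ (norm_nonneg _)
    rw [← setIntegral_eq_integral_of_forall_compl_eq_zero (s := KN)]
    · refine norm_setIntegral_le_of_norm_le_const ?_ fun u _ => ?_
      · rw [Measure.pi_pi]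
        exact ENNReal.prod_lt_top fun _ _ => hK.measure_lt_top
      · rw [norm_mul, V.norm_q, mul_one]
        exact hC _
    · intro u hu
      simp only [KN, Set.mem_pi, Set.mem_univ, true_imp_iff, not_forall] at hu
      obtain ⟨B, hB⟩ := hu
      rw [hfK _ (V.max B.1) (by rwa [V.expand_max_neg]), zero_mul]
  · refine HasCompactSupport.of_support_subset_isCompact
      (isCompact_univ_pi fun _ : Fin V.kept.card => hK) fun s hs j _ => ?_
    by_contra hj
    apply hs
    have : ∀ u : V.NegBlock → T, f.1 (V.expand s u) = 0 := fun u =>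
      hfK _ (V.kept.orderIsoOfFin rfl j) (by rwa [V.expand_kept])
    simp [reduceFun, this]

/-- `reduceFun` as an element of `B₀(T^k → ℂ)`. -/
def reduce [TopologicalSpace T] [T2Space T] [OpensMeasurableSpace T] [SigmaFinite σ]
    [IsFiniteMeasureOnCompacts σ] (lam : ℝ) (f : B0 (Fin n → T) ℂ) :
    B0 (Fin V.kept.card → T) ℂ :=
  ⟨V.reduceFun S lam f.1, V.reduceFun_mem S lam f⟩

end

end MarkedPartition

end QWick

end

noncomputable section

namespace QWick

set_option linter.unusedSectionVars false

/-! Everything is transported to the Fock space. For f in B₀(Tⁿ → ℂ) let W(f) = `wickVector` be the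
sum over all marked partitions V of the vector P_k g_V in degree k, where k is the number of blocks
with mark +1. The central identity is ⟨f₀, ω⟩ W(f) = W(f₀ ⊗ f) (`field_wickVector`); induction then
gives ⟨f₁, ω⟩ ⋯ ⟨fₙ, ω⟩ Ω = W(f₁ ⊗ ⋯ ⊗ fₙ) (`monomial_vacuum`).

The identity holds because a marked partition of n + 1 indices arises in exactly one way from one of
n indices by putting a new index in front (`BlockData.extend_bijective`). The new index is a
singleton, which is the effect of a⁺; or it joins a block with mark +1 that keeps its mark, which is
the effect of λa⁰; or it joins a block with mark +1 and turns the mark into -1, which is the effect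
of a⁻. In the last case a⁻ moves the j-th variable to the front by a cycle and collects a factor
Q(u, s_i) for each earlier variable s_i. These are exactly the crossings of the new block with the
+1 blocks of smaller maximum, while the old crossings stay as they were
(`BlockData.crossing_extend_succ`, `Enumeration.q_extendNeg`).

The maps p ↦ (pΩ)⁽ᵐ⁾ extend continuously to L²(τ). On MP⁽ⁿ⁾ only degrees up to n matter, and the
scalar product is the Fock scalar product of the components (`inner_MP`), so an element of MP⁽ⁿ⁾ is
determined by its components (`eq_of_component_eq`). The components of W are continuous under
bounded pointwise convergence. With a monotone class argument (`B0_induction`) this yields existence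
and uniqueness of ⟨f, ω^{⊗n}⟩ and shows that its components are those of W(f).

The partition into singletons contributes P_n f in degree n, and every other partition contributes
in a lower degree. Removing the lower terms by strong induction leaves an element of MP⁽ⁿ⁾ whose
only component is P_n f. It is orthogonal to MP⁽ⁿ⁻¹⁾ and differs from ⟨f, ω^{⊗n}⟩ by an element of
MP⁽ⁿ⁻¹⁾, hence it is the Wick product (`exists_component_eq_fockB0`, `IsSmearing.component_wick`).
The Wick rule is then an equality of components. -/

/-- A marked partition encoded by the map sending an index to the maximum of its block and by the
indicator function of the union of the blocks with mark `-1`. -/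
@[ext] structure BlockData (n : ℕ) where
  top : Fin n → Fin n
  neg : Fin n → Bool
  le_top : ∀ i, i ≤ top i
  top_top : ∀ i, top (top i) = top i
  neg_top : ∀ i, neg (top i) = neg i
  exists_ne : ∀ i, neg i = true → ∃ j, top j = top i ∧ j ≠ top i

/-! ### Marked partitions and their encodings -/

namespace MarkedPartition

variable {n : ℕ} (V : MarkedPartition n)

lemma mem_blockOf_iff {i j : Fin n} : i ∈ (V.blockOf j).1 ↔ V.blockOf i = V.blockOf j := by
  constructor
  · intro h
    exact Subtype.ext (V.part.part_eq_of_mem (V.blockOf j).2 h)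
  · intro h
    rw [← h]
    exact V.part.mem_part (Finset.mem_univ i)

lemma mem_block_iff {i : Fin n} (B : V.Block) : i ∈ B.1 ↔ V.blockOf i = B := by
  conv_lhs => rw [← V.blockOf_max B]
  rw [mem_blockOf_iff, blockOf_max]

lemma max_mem (B : V.Block) : V.max B ∈ B.1 := Finset.max'_mem _ _

lemma min_mem (B : V.Block) : V.min B ∈ B.1 := Finset.min'_mem _ _

lemma blockOf_min (B : V.Block) : V.blockOf (V.min B) = B :=
  (V.mem_block_iff B).1 (V.min_mem B)

lemma max_inj {B B' : V.Block} : V.max B = V.max B' ↔ B = B' :=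
  ⟨fun h => by rw [← V.blockOf_max B, h, V.blockOf_max], fun h => by rw [h]⟩

/-- The encoding of a marked partition. -/
def toBlockData : BlockData n where
  top i := V.max (V.blockOf i)
  neg i := decide (V.mark (V.blockOf i) = -1)
  le_top i := Finset.le_max' _ _ (V.mem_blockOf_iff.2 rfl)
  top_top i := by rw [V.blockOf_max]
  neg_top i := by rw [V.blockOf_max]
  exists_ne i h := by
    have h : V.mark (V.blockOf i) = -1 := by simpa using h
    -- Singletons carry the mark +1, so a block with mark -1 has an element other than its maximum.
    have hc : (V.blockOf i).1.card ≠ 1 := fun hc => by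
      rw [V.mark_singleton _ hc] at h
      exact absurd h (by decide)
    have hp : 0 < (V.blockOf i).1.card := Finset.card_pos.2 ⟨_, V.max_mem _⟩
    obtain ⟨j, hj, hne⟩ := Finset.exists_mem_ne (by omega : 1 < (V.blockOf i).1.card)
      (V.max (V.blockOf i))
    exact ⟨j, by rw [V.mem_blockOf_iff.1 hj], hne⟩

lemma toBlockData_top (i : Fin n) : V.toBlockData.top i = V.max (V.blockOf i) := rfl

lemma toBlockData_neg (i : Fin n) : V.toBlockData.neg i = true ↔ V.mark (V.blockOf i) = -1 := by
  simp [toBlockData]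

lemma toBlockData_neg_false (i : Fin n) :
    V.toBlockData.neg i = false ↔ V.mark (V.blockOf i) = 1 := by
  rw [← Bool.not_eq_true, toBlockData_neg]
  rcases Int.units_eq_one_or (V.mark (V.blockOf i)) with h | h <;> simp [h]

lemma toBlockData_top_eq_top {i j : Fin n} :
    V.toBlockData.top i = V.toBlockData.top j ↔ V.blockOf i = V.blockOf j := V.max_inj

/-- The fibres of `top` are the blocks, and `neg` at any element of a block gives back its mark. -/
lemma toBlockData_injective : Function.Injective (toBlockData (n := n)) := by
  intro V V' h
  have ht : ∀ i j, V.blockOf i = V.blockOf j ↔ V'.blockOf i = V'.blockOf j := fun i j => by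
    rw [← toBlockData_top_eq_top, ← toBlockData_top_eq_top, h]
  have hpart : ∀ i, V.part.part i = V'.part.part i := fun i => by
    ext j
    have := ht j i
    rwa [← mem_blockOf_iff, ← mem_blockOf_iff] at this
  have hle : ∀ W W' : MarkedPartition n, (∀ i, W.part.part i = W'.part.part i) →
      W.part.parts ⊆ W'.part.parts := fun W W' hW B hB => by
    have := congrArg Subtype.val (W.blockOf_max ⟨B, hB⟩)
    change W.part.part _ = B at this
    rw [← this, hW]
    exact (W'.blockOf _).2
  have hP : V.part = V'.part :=
    Finpartition.ext (Finset.Subset.antisymm (hle _ _ hpart) (hle _ _ fun i => (hpart i).symm))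
  have hm : ∀ i, V.mark (V.blockOf i) = V'.mark (V'.blockOf i) := fun i => by
    rcases Int.units_eq_one_or (V.mark (V.blockOf i)) with h1 | h1
    · rw [h1, eq_comm, ← toBlockData_neg_false, ← h, toBlockData_neg_false, h1]
    · rw [h1, eq_comm, ← toBlockData_neg, ← h, toBlockData_neg, h1]
  obtain ⟨P, m, h1⟩ := V
  obtain ⟨P', m', h2⟩ := V'
  obtain rfl : P = P' := hP
  congr 1
  funext B
  have := hm (MarkedPartition.max ⟨P, m, h1⟩ B)
  rw [blockOf_max] at this
  refine this.trans (congrArg m' ?_)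
  exact blockOf_max ⟨P, m, h1⟩ B

/-- Take the fibres of `top` as blocks. Since `top` is idempotent and i ≤ `top i`, the common value
of `top` on a fibre is its maximum; `exists_ne` rules out singletons with mark -1. -/
lemma toBlockData_surjective : Function.Surjective (toBlockData (n := n)) := by
  classical
  intro d
  let P : Finpartition (Finset.univ : Finset (Fin n)) := Finpartition.ofSetoid (Setoid.ker d.top)
  have hP : ∀ i j, j ∈ P.part i ↔ d.top i = d.top j := fun i j =>
    Finpartition.mem_part_ofSetoid_iff_rel
  have hmem : ∀ (B : {B : Finset (Fin n) // B ∈ P.parts}) (i j), i ∈ B.1 →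
      (j ∈ B.1 ↔ d.top i = d.top j) := fun B i j hi => by
    rw [← hP, P.part_eq_of_mem B.2 hi]
  have hmax : ∀ (B : {B : Finset (Fin n) // B ∈ P.parts}) (i), i ∈ B.1 →
      B.1.max' (P.nonempty_of_mem_parts B.2) = d.top i := fun B i hi => by
    refine le_antisymm (Finset.max'_le _ _ _ fun j hj => ?_) (Finset.le_max' _ _ ?_)
    · rw [(hmem B i j hi).1 hj]
      exact d.le_top j
    · rw [hmem B i _ hi, d.top_top]
  let V : MarkedPartition n :=
    { part := P
      mark := fun B => if d.neg (B.1.max' (P.nonempty_of_mem_parts B.2)) then -1 else 1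
      mark_singleton := fun B hB => by
        obtain ⟨i, hi⟩ := P.nonempty_of_mem_parts B.2
        rw [hmax B i hi, d.neg_top, if_neg]
        intro hneg
        obtain ⟨j, hj, hne⟩ := d.exists_ne i hneg
        have h1 : j ∈ B.1 := (hmem B i j hi).2 hj.symm
        have h2 : d.top i ∈ B.1 := (hmem B i _ hi).2 (d.top_top i).symm
        exact hne (Finset.card_le_one.1 hB.le _ h1 _ h2) }
  have htop : ∀ i, V.max (V.blockOf i) = d.top i := fun i =>
    hmax (V.blockOf i) i (P.mem_part (Finset.mem_univ i))
  refine ⟨V, BlockData.ext (funext htop) (funext fun i => ?_)⟩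
  have : V.mark (V.blockOf i) = if d.neg (V.max (V.blockOf i)) then -1 else 1 := rfl
  change decide (V.mark (V.blockOf i) = -1) = d.neg i
  rw [this, htop, d.neg_top]
  cases d.neg i <;> decide

/-- Marked partitions correspond bijectively to their encodings. -/
def blockDataEquiv (n : ℕ) : MarkedPartition n ≃ BlockData n :=
  Equiv.ofBijective toBlockData ⟨toBlockData_injective, toBlockData_surjective⟩

end MarkedPartition

/-! ### Recursion on encodings: adjoining an index at the front -/

namespace BlockData

variable {n : ℕ}

instance : Fintype (BlockData n) := Fintype.ofEquiv _ (MarkedPartition.blockDataEquiv n)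

variable (d : BlockData n)

/-- The indices of the factors that are kept. -/
abbrev Kept : Type := {i : Fin n // d.top i = i ∧ d.neg i = false}

/-- `i` is the minimum of its block. -/
def IsBot (i : Fin n) : Prop := ∀ j, d.top j = d.top i → i ≤ j

open Classical in
/-- The power of `λ` belonging to a marked partition. -/
def coeff (lam : ℝ) : ℂ :=
  ∏ i, if d.top i = i ∨ (d.neg i = true ∧ d.IsBot i) then 1 else (lam : ℂ)

/-- The index pairs contributing to `Q(𝒱; t)`. -/
def Crossing (p : Fin n × Fin n) : Prop :=
  d.top p.1 = p.1 ∧ d.IsBot p.2 ∧ d.neg p.2 = true ∧ p.2 < p.1 ∧ p.1 < d.top p.2 ∧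
    (d.neg p.1 = true → ∃ c < p.2, d.top c = d.top p.1)

open Classical in
/-- The function `Q(𝒱; t)`. -/
def q {T : Type*} [MeasurableSpace T] {σ : Measure T} (S : Statistics σ) (t : Fin n → T) : ℂ :=
  ∏ p ∈ Finset.univ.filter d.Crossing, S.q (t p.2) (t p.1)

/-- Adjoining an index at the front: either as a singleton, or to a block with mark `+1`, which then
keeps the mark (`false`) or has its mark changed to `-1` (`true`). -/
def extend : Option (d.Kept × Bool) → BlockData (n + 1)
  | none =>
    { top := Fin.cons 0 fun i => (d.top i).succ
      neg := Fin.cons false d.neg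
      le_top := Fin.cases (by simp) fun i => by simpa using d.le_top i
      top_top := Fin.cases (by simp) fun i => by simpa using d.top_top i
      neg_top := Fin.cases (by simp) fun i => by simpa using d.neg_top i
      exists_ne := Fin.cases (by simp) fun i hi => by
        obtain ⟨j, hj, hne⟩ := d.exists_ne i (by simpa using hi)
        exact ⟨j.succ, by simpa using hj, by simpa using hne⟩ }
  | some (j, b) =>
    { top := Fin.cons j.1.succ fun i => (d.top i).succ
      neg := Fin.cons b fun i => d.neg i || (b && decide (d.top i = j))
      le_top := Fin.cases (by simp) fun i => by simpa using d.le_top i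
      top_top := Fin.cases (by simpa using j.2.1) fun i => by simpa using d.top_top i
      neg_top := Fin.cases (by simp [j.2.1, j.2.2]) fun i => by
        simp [d.neg_top, d.top_top]
      exists_ne := Fin.cases (fun _ => ⟨0, by simp, by simp [Fin.ext_iff]⟩) fun i hi => by
        simp only [Fin.cons_succ, Bool.or_eq_true, Bool.and_eq_true, decide_eq_true_eq] at hi
        rcases hi with hi | ⟨-, hi⟩
        · obtain ⟨j, hj, hne⟩ := d.exists_ne i hi
          exact ⟨j.succ, by simpa using hj, by simpa using hne⟩
        · exact ⟨0, by simp [hi], by simp [Fin.ext_iff]⟩ }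

lemma extend_none_top : (d.extend none).top = Fin.cons 0 fun i => (d.top i).succ := rfl
lemma extend_none_neg : (d.extend none).neg = Fin.cons false d.neg := rfl
lemma extend_some_top (j : d.Kept) (b : Bool) :
    (d.extend (some (j, b))).top = Fin.cons j.1.succ fun i => (d.top i).succ := rfl
lemma extend_some_neg (j : d.Kept) (b : Bool) : (d.extend (some (j, b))).neg =
    Fin.cons b fun i => d.neg i || (b && decide (d.top i = j)) := rfl

lemma extend_top_succ (o : Option (d.Kept × Bool)) (i : Fin n) :
    (d.extend o).top i.succ = (d.top i).succ := by
  rcases o with _ | ⟨j, b⟩ <;> rfl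

/-- This recovers the old marks from the new ones. The new index joins only blocks that had mark +1,
so an old index had mark -1 exactly when it has it now and lies outside the block of 0. -/
lemma extend_neg_succ (o : Option (d.Kept × Bool)) (i : Fin n) :
    ((d.extend o).neg i.succ = true ∧ (d.extend o).top i.succ ≠ (d.extend o).top 0) ↔
      d.neg i = true := by
  rcases o with _ | ⟨j, b⟩
  · simp [extend_none_top, extend_none_neg]
  · simp only [extend_some_top, extend_some_neg, Fin.cons_succ, Fin.cons_zero, Bool.or_eq_true,
      Bool.and_eq_true, decide_eq_true_eq, ne_eq, Fin.succ_inj]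
    constructor
    · rintro ⟨h | h, h'⟩
      · exact h
      · exact absurd h.2 h'
    · refine fun h => ⟨Or.inl h, fun h' => ?_⟩
      have := d.neg_top i
      rw [h', j.2.2, h] at this
      exact absurd this (by decide)

/-- The inverse deletes the index 0 and gives the mark +1 back to what remains of its block. Whether
0 was a singleton, and otherwise which block it belonged to and with which mark, is read off from
`top 0` and `neg 0`. -/
lemma extend_bijective : Function.Bijective
    fun x : Σ d : BlockData n, Option (d.Kept × Bool) => x.1.extend x.2 := by
  constructor
  · rintro ⟨d, o⟩ ⟨d', o'⟩ h
    simp only at h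
    have h1 : d = d' := by
      refine BlockData.ext (funext fun i => Fin.succ_injective _ ?_) (funext fun i => ?_)
      · rw [← extend_top_succ d o, ← extend_top_succ d' o', h]
      · rw [Bool.eq_iff_iff, ← extend_neg_succ d o, ← extend_neg_succ d' o', h]
    subst h1
    have h0 : (d.extend o).top 0 = (d.extend o').top 0 := by rw [h]
    have h0' : (d.extend o).neg 0 = (d.extend o').neg 0 := by rw [h]
    have : o = o' := by
      rcases o with _ | ⟨j, b⟩ <;> rcases o' with _ | ⟨j', b'⟩
      · rfl
      · simp [extend_some_top, extend_none_top, Fin.ext_iff] at h0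
      · simp [extend_some_top, extend_none_top, Fin.ext_iff] at h0
      · simp only [extend_some_top, Fin.cons_zero, Fin.succ_inj, extend_some_neg] at h0 h0'
        rw [Subtype.ext h0, h0']
    rw [this]
  · intro d'
    have hne : ∀ i : Fin n, d'.top i.succ ≠ 0 := fun i h => by
      have := d'.le_top i.succ
      rw [h] at this
      exact absurd this (by simp)
    -- Resetting the mark of the block of 0 to +1 is what keeps `exists_ne` true: a block that still
    -- has mark -1 does not contain 0, so its second element survives the deletion.
    let d : BlockData n :=
      { top := fun i => (d'.top i.succ).pred (hne i)
        neg := fun i => d'.neg i.succ && decide (d'.top i.succ ≠ d'.top 0)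
        le_top := fun i => by
          rw [← Fin.succ_le_succ_iff, Fin.succ_pred]; exact d'.le_top _
        top_top := fun i => by
          apply Fin.succ_injective; simp [d'.top_top]
        neg_top := fun i => by simp [d'.top_top, d'.neg_top]
        exists_ne := fun i hi => by
          simp only [Bool.and_eq_true, decide_eq_true_eq] at hi
          obtain ⟨j, hj, hne'⟩ := d'.exists_ne _ hi.1
          have hj0 : j ≠ 0 := fun h => hi.2 (by rw [← hj, h])
          obtain ⟨j, rfl⟩ := Fin.exists_succ_eq.2 hj0
          refine ⟨j, by simp [hj], fun h => hne' ?_⟩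
          rw [h, Fin.succ_pred] }
    have hdt : ∀ i, (d.top i).succ = d'.top i.succ := fun i => Fin.succ_pred _ (hne i)
    have hdn : ∀ i, d.neg i = (d'.neg i.succ && decide (d'.top i.succ ≠ d'.top 0)) := fun i => rfl
    by_cases h0 : d'.top 0 = 0
    · have hn0 : d'.neg 0 = false := by
        rw [← Bool.not_eq_true]
        intro hn
        obtain ⟨j, hj, hne'⟩ := d'.exists_ne 0 hn
        rw [h0] at hj hne'
        obtain ⟨j, rfl⟩ := Fin.exists_succ_eq.2 hne'
        exact hne j hj
      refine ⟨⟨d, none⟩, BlockData.ext (funext fun i => ?_) (funext fun i => ?_)⟩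
      · refine Fin.cases ?_ (fun i => ?_) i
        · simp [extend_none_top, h0]
        · simp [extend_none_top, hdt]
      · refine Fin.cases ?_ (fun i => ?_) i
        · simp [extend_none_neg, hn0]
        · simp [extend_none_neg, hdn, h0, hne]
    · have hj : ((d'.top 0).pred h0).succ = d'.top 0 := Fin.succ_pred _ _
      let j : d.Kept := ⟨(d'.top 0).pred h0, by
        apply Fin.succ_injective; rw [hdt, hj, d'.top_top], by
        rw [hdn, hj]; simp [d'.top_top]⟩
      refine ⟨⟨d, some (j, d'.neg 0)⟩, BlockData.ext (funext fun i => ?_) (funext fun i => ?_)⟩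
      · refine Fin.cases ?_ (fun i => ?_) i
        · simp only [extend_some_top, Fin.cons_zero]; exact hj
        · simp [extend_some_top, hdt]
      · refine Fin.cases ?_ (fun i => ?_) i
        · simp [extend_some_neg]
        · simp only [extend_some_neg, Fin.cons_succ, hdn]
          have h1 : d.top i = j ↔ d'.top i.succ = d'.top 0 := by
            rw [← Fin.succ_inj, hdt, ← hj]
          by_cases h2 : d'.top i.succ = d'.top 0
          · have : d'.neg i.succ = d'.neg 0 := by rw [← d'.neg_top, h2, d'.neg_top]
            simp [h2, h1, this]
          · simp [h2, h1]

/-- The three groups of terms will be matched with creation, the neutral operator and annihilation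
respectively. -/
lemma sum_extend {M : Type*} [AddCommMonoid M] (F : BlockData (n + 1) → M) :
    ∑ d, F d = ∑ d : BlockData n, (F (d.extend none) +
      (∑ j : d.Kept, F (d.extend (some (j, false))) +
        ∑ j : d.Kept, F (d.extend (some (j, true))))) := by
  rw [← Function.Bijective.sum_comp extend_bijective F, Fintype.sum_sigma]
  refine Finset.sum_congr rfl fun d _ => ?_
  rw [Fintype.sum_option, Fintype.sum_prod_type_right, Fintype.sum_bool, add_comm (∑ j : d.Kept, _)]

end BlockData

/-! ### The power of λ and the Q-factor in terms of encodings -/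

namespace MarkedPartition

variable {n : ℕ} (V : MarkedPartition n)

lemma isBot_iff (i : Fin n) : V.toBlockData.IsBot i ↔ V.min (V.blockOf i) = i := by
  constructor
  · intro h
    refine le_antisymm (Finset.min'_le _ _ (V.mem_blockOf_iff.2 rfl)) (h _ ?_)
    rw [toBlockData_top_eq_top, blockOf_min]
  · intro h j hj
    rw [toBlockData_top_eq_top] at hj
    rw [← h]
    exact Finset.min'_le _ _ (V.mem_blockOf_iff.2 hj)

/-- Grouped by blocks, a factor λ comes from every index except the maximum and, in a block with
mark -1, also the minimum. -/
lemma coeff_toBlockData (lam : ℝ) : V.toBlockData.coeff lam = V.coeff lam := by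
  classical
  unfold BlockData.coeff MarkedPartition.coeff
  rw [← Finset.prod_fiberwise Finset.univ V.blockOf]
  refine Finset.prod_congr rfl fun B _ => ?_
  have hB : Finset.univ.filter (fun i => V.blockOf i = B) = B.1 := by
    ext i; simp [mem_block_iff]
  rw [hB]
  have h1 : ∀ i ∈ B.1, (V.toBlockData.top i = i ∨
      (V.toBlockData.neg i = true ∧ V.toBlockData.IsBot i)) ↔
      (i = V.max B ∨ (V.mark B = -1 ∧ i = V.min B)) := fun i hi => by
    rw [isBot_iff, toBlockData_neg, toBlockData_top, (V.mem_block_iff B).1 hi, eq_comm,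
      eq_comm (a := i) (b := V.min B)]
  rw [Finset.prod_congr rfl fun i hi => by rw [if_congr (h1 i hi) rfl rfl]]
  rw [Finset.prod_ite, Finset.prod_const_one, one_mul, Finset.prod_const]
  split_ifs with hm
  · congr 1
    rw [← Finset.card_erase_of_mem (V.max_mem B)]
    congr 1
    ext i
    simp [hm, and_comm]
  · have hm : V.mark B = -1 := (Int.units_eq_one_or _).resolve_left hm
    -- A block with mark -1 is not a singleton, so two distinct indices are removed and the exponent
    -- is |B| - 2.
    have hne : V.min B ≠ V.max B := fun h => by
      have : B.1.card = 1 := by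
        refine le_antisymm (Finset.card_le_one.2 fun a ha b hb => ?_)
          (Finset.card_pos.2 ⟨_, V.max_mem B⟩)
        have h1 : ∀ a ∈ B.1, a = V.max B := fun a ha =>
          le_antisymm (Finset.le_max' _ _ ha) (h ▸ Finset.min'_le _ _ ha)
        rw [h1 a ha, h1 b hb]
      rw [V.mark_singleton B this] at hm
      exact absurd hm (by decide)
    have h2 := Finset.card_erase_of_mem (Finset.mem_erase.2 ⟨hne, V.min_mem B⟩)
    rw [Finset.card_erase_of_mem (V.max_mem B), Nat.sub_sub] at h2
    rw [← h2]
    congr 2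
    ext i
    simp [hm]
    tauto

/-- A pair of blocks (B₁, B₂) corresponds to the pair of indices (max B₁, min B₂). The single
predicate `Crossing` covers both products: for mark +1 on B₁ its last clause is vacuous, and for
mark -1 the element c < min B₂ of B₁ expresses min B₁ < min B₂. -/
lemma q_toBlockData {T : Type*} [MeasurableSpace T] {σ : Measure T} (S : Statistics σ)
    (t : Fin n → T) : V.toBlockData.q S t = V.q S t := by
  classical
  unfold BlockData.q MarkedPartition.q
  rw [← Finset.prod_union]
  · refine Finset.prod_bij' (fun p _ => (V.blockOf p.1, V.blockOf p.2))
      (fun p _ => (V.max p.1, V.min p.2)) ?_ ?_ ?_ ?_ ?_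
    · rintro ⟨a, b⟩ hp
      simp only [Finset.mem_filter, Finset.mem_univ, true_and, BlockData.Crossing, isBot_iff,
        toBlockData_neg, toBlockData_top] at hp
      obtain ⟨h1, h2, h3, h4, h5, h6⟩ := hp
      simp only [Finset.mem_union, Finset.mem_filter, Finset.mem_univ, true_and, h1, h2, h3, h4, h5,
        and_true]
      rcases Int.units_eq_one_or (V.mark (V.blockOf a)) with h | h
      · exact Or.inr h
      · obtain ⟨c, hc, hc'⟩ := h6 h
        refine Or.inl ⟨h, lt_of_le_of_lt (Finset.min'_le _ _ ?_) hc⟩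
        rw [mem_blockOf_iff, ← max_inj, hc']
    · rintro ⟨B, B'⟩ hp
      simp only [Finset.mem_union, Finset.mem_filter, Finset.mem_univ, true_and] at hp
      simp only [Finset.mem_filter, Finset.mem_univ, true_and, BlockData.Crossing, isBot_iff,
        toBlockData_neg, toBlockData_top, blockOf_max, blockOf_min]
      rcases hp with ⟨h1, h2, h3, h4, h5⟩ | ⟨h1, h2, h3, h4⟩
      · exact ⟨h2, h4, h5, fun _ => ⟨_, h3, by rw [blockOf_min]⟩⟩
      · refine ⟨h2, h3, h4, fun h => ?_⟩
        rw [h1] at h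
        exact absurd h (by decide)
    · rintro ⟨a, b⟩ hp
      simp only [Finset.mem_filter, Finset.mem_univ, true_and, BlockData.Crossing, isBot_iff,
        toBlockData_top] at hp
      simp [hp.1, hp.2.1]
    · rintro ⟨B, B'⟩ hp
      simp [blockOf_max, blockOf_min]
    · rintro ⟨a, b⟩ hp
      simp only [Finset.mem_filter, Finset.mem_univ, true_and, BlockData.Crossing, isBot_iff,
        toBlockData_top] at hp
      simp [hp.1, hp.2.1]
  · rw [Finset.disjoint_filter]
    rintro ⟨B, B'⟩ _ ⟨h1, -⟩ ⟨h2, -⟩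
    simp only at h1 h2
    rw [h1] at h2
    exact absurd h2 (by decide)

end MarkedPartition

/-! ### How the power of λ and the Q-factor change when an index is adjoined -/

namespace BlockData

variable {n : ℕ} (d : BlockData n)

lemma isBot_zero (d : BlockData (n + 1)) : d.IsBot 0 := fun _ _ => Fin.zero_le _

lemma isBot_extend_succ (o : Option (d.Kept × Bool)) (i : Fin n) :
    (d.extend o).IsBot i.succ ↔ d.IsBot i ∧ (d.extend o).top i.succ ≠ (d.extend o).top 0 := by
  unfold IsBot
  rw [Fin.forall_fin_succ]
  simp only [extend_top_succ, Fin.succ_inj, Fin.succ_le_succ_iff]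
  constructor
  · rintro ⟨h1, h2⟩
    exact ⟨h2, fun h => absurd (h1 h.symm) (by simp)⟩
  · rintro ⟨h1, h2⟩
    exact ⟨fun h => absurd h.symm h2, h1⟩

/-- A block that absorbs 0 loses its old minimum, but it had mark +1 before, so that minimum was not
counted. -/
lemma neg_and_isBot_extend_succ (o : Option (d.Kept × Bool)) (i : Fin n) :
    ((d.extend o).neg i.succ = true ∧ (d.extend o).IsBot i.succ) ↔
      d.neg i = true ∧ d.IsBot i := by
  rw [isBot_extend_succ, ← extend_neg_succ d o i]
  tauto

/-- Old indices keep their factors. The index 0, always the minimum of its block, contributes λ only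
if it joins a block that keeps the mark +1. -/
lemma coeff_extend (o : Option (d.Kept × Bool)) (lam : ℝ) : (d.extend o).coeff lam =
    (if (d.extend o).top 0 = 0 ∨ (d.extend o).neg 0 = true then 1 else (lam : ℂ)) *
      d.coeff lam := by
  classical
  unfold coeff
  rw [Fin.prod_univ_succ]
  congr 1
  · simp only [isBot_zero, and_true]
  · refine Finset.prod_congr rfl fun i _ => if_congr ?_ rfl rfl
    rw [neg_and_isBot_extend_succ, extend_top_succ, Fin.succ_inj]

lemma not_crossing_zero (d : BlockData (n + 1)) (b : Fin (n + 1)) : ¬ d.Crossing (0, b) :=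
  fun h => absurd h.2.2.2.1 (by simp)

/-- No index precedes 0, so the last clause of `Crossing` forces the first block to have mark +1. As
it is not the block of 0, its mark is the old one. -/
lemma crossing_extend_zero (o : Option (d.Kept × Bool)) (a : Fin n) :
    (d.extend o).Crossing (a.succ, 0) ↔ (d.extend o).neg 0 = true ∧ d.top a = a ∧
      a.succ < (d.extend o).top 0 ∧ d.neg a = false := by
  unfold Crossing
  simp only [extend_top_succ, Fin.succ_inj, isBot_zero, true_and, Fin.succ_pos, Fin.not_lt_zero,
    false_and, exists_false]
  constructor
  · rintro ⟨h1, h2, h3, h4⟩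
    refine ⟨h2, h1, h3, ?_⟩
    rw [← Bool.not_eq_true, ← extend_neg_succ d o]
    exact fun h => h4 h.1
  · rintro ⟨h1, h2, h3, h4⟩
    refine ⟨h2, h1, h3, fun h => ?_⟩
    rw [← Bool.not_eq_true, ← extend_neg_succ d o] at h4
    exact h4 ⟨h, by rw [extend_top_succ, h2]; exact h3.ne⟩

/-- The delicate case is a first block whose mark has just become -1: the clause about c, previously
vacuous, is now satisfied by c = 0. Thus no crossing between old indices appears or disappears. -/
lemma crossing_extend_succ (o : Option (d.Kept × Bool)) (a b : Fin n) :
    (d.extend o).Crossing (a.succ, b.succ) ↔ d.Crossing (a, b) := by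
  have hn := neg_and_isBot_extend_succ d o b
  have h : ((d.extend o).neg a.succ = true → ∃ c < b.succ,
      (d.extend o).top c = (d.extend o).top a.succ) ↔
      (d.neg a = true → ∃ c < b, d.top c = d.top a) := by
    rw [← extend_neg_succ d o a]
    simp only [Fin.exists_fin_succ, Fin.succ_pos, true_and, extend_top_succ, Fin.succ_inj,
      Fin.succ_lt_succ_iff]
    constructor
    · rintro h ⟨h1, h2⟩
      exact (h h1).resolve_left (Ne.symm h2)
    · intro h h1
      by_cases h2 : (d.extend o).top 0 = (d.top a).succ
      · exact Or.inl h2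
      · exact Or.inr (h ⟨h1, fun h => h2 h.symm⟩)
  unfold Crossing
  simp only at *
  rw [h]
  simp only [extend_top_succ, Fin.succ_inj, Fin.succ_lt_succ_iff]
  tauto

open Classical in
lemma q_extend {T : Type*} [MeasurableSpace T] {σ : Measure T} (S : Statistics σ)
    (o : Option (d.Kept × Bool)) (t : Fin (n + 1) → T) : (d.extend o).q S t =
    (∏ a : Fin n, if (d.extend o).Crossing (a.succ, 0) then S.q (t 0) (t a.succ) else 1) *
      d.q S (Fin.tail t) := by
  unfold q
  rw [Finset.prod_filter, Finset.prod_filter, Fintype.prod_prod_type_right,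
    Fintype.prod_prod_type_right, Fin.prod_univ_succ, Fin.prod_univ_succ]
  simp only [not_crossing_zero, if_false, one_mul]
  congr 1
  refine Finset.prod_congr rfl fun b _ => ?_
  rw [Fin.prod_univ_succ]
  simp only [not_crossing_zero, if_false, one_mul, crossing_extend_succ]
  rfl

end BlockData

/-! ### Fock space vectors attached to functions and to marked partitions -/

section FockTerm

variable {T : Type*} [TopologicalSpace T] [T2Space T] [SecondCountableTopology T]
  [MeasurableSpace T] [BorelSpace T] {σ : Measure T} [IsLocallyFiniteMeasure σ]

lemma memLp_of_mem_B0 {X : Type*} [TopologicalSpace X] [MeasurableSpace X] [OpensMeasurableSpace X]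
    (μ : Measure X) [IsFiniteMeasureOnCompacts μ] (p : ℝ≥0∞) (f : B0 X ℂ) : MemLp f.1 p μ := by
  obtain ⟨hf, ⟨C, hC⟩, hs⟩ := f.2
  have h1 : MemLp ((tsupport f.1).indicator fun _ => C) p μ :=
    memLp_indicator_const p (isClosed_tsupport _).measurableSet C (Or.inr hs.isCompact.measure_ne_top)
  refine h1.of_le hf.aestronglyMeasurable (ae_of_all _ fun t => ?_)
  by_cases ht : t ∈ tsupport f.1
  · rw [Set.indicator_of_mem ht]
    exact (hC t).trans (le_abs_self C)
  · simp [image_eq_zero_of_notMem_tsupport ht]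

variable (σ) in
/-- A function in `B₀(Tⁿ → ℂ)` as an element of `L²(Tⁿ)`. -/
def toParticle (n : ℕ) : B0 (Fin n → T) ℂ →ₗ[ℂ] Particle σ n where
  toFun f := (memLp_of_mem_B0 (Measure.pi fun _ : Fin n => σ) 2 f).toLp
  map_add' _ _ := MemLp.toLp_add _ _
  map_smul' _ _ := MemLp.toLp_const_smul _ _

lemma coeFn_toParticle {n : ℕ} (f : B0 (Fin n → T) ℂ) :
    toParticle σ n f =ᵐ[Measure.pi fun _ : Fin n => σ] f.1 :=
  (memLp_of_mem_B0 (Measure.pi fun _ : Fin n => σ) 2 f).coeFn_toLp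

variable (S : Statistics σ) (lam : ℝ)

/-- The Fock space vector with the only component `P_n f` at level `n`. -/
def fockB0 (n : ℕ) : B0 (Fin n → T) ℂ →ₗ[ℂ] FockFin S :=
  DirectSum.lof ℂ ℕ (fun n => QSym S n) n ∘ₗ (toQSym S n).toLinearMap ∘ₗ toParticle σ n

/-- The term of the Wick rule belonging to a marked partition. -/
def fockTerm {n : ℕ} (V : MarkedPartition n) (f : B0 (Fin n → T) ℂ) : FockFin S :=
  fockB0 S V.kept.card (V.reduce S lam f)

end FockTerm

/-! ### Computing a term with an arbitrary labelling of the blocks -/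

/-- An enumeration of the blocks of a marked partition: those with mark `+1` are enumerated by
`Fin k` in the order of their maxima, those with mark `-1` by `ι`. -/
structure Enumeration {n : ℕ} (d : BlockData n) (k : ℕ) (ι : Type) where
  index : Fin n → Fin k ⊕ ι
  rep : Fin k ⊕ ι → Fin n
  index_rep : ∀ x, index (rep x) = x
  rep_index : ∀ i, rep (index i) = d.top i
  neg_rep : ∀ x, d.neg (rep x) = x.isRight
  strictMono : StrictMono (rep ∘ Sum.inl)

namespace Enumeration

variable {n : ℕ} {d : BlockData n} {k : ℕ} {ι : Type} (P : Enumeration d k ι)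

lemma top_rep (x : Fin k ⊕ ι) : d.top (P.rep x) = P.rep x := by
  rw [← P.rep_index, P.index_rep]

lemma rep_injective : Function.Injective P.rep :=
  Function.LeftInverse.injective P.index_rep

lemma neg_eq (i : Fin n) : d.neg i = (P.index i).isRight := by
  rw [← d.neg_top, ← P.rep_index, P.neg_rep]

/-- The point all whose coordinates in a block are equal to the given coordinate. -/
def expand {T : Type*} (s : Fin k → T) (u : ι → T) (i : Fin n) : T := Sum.elim s u (P.index i)

lemma expand_rep {T : Type*} (s : Fin k → T) (u : ι → T) (x : Fin k ⊕ ι) :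
    P.expand s u (P.rep x) = Sum.elim s u x := by rw [expand, P.index_rep]

/-- The blocks with mark `+1`. -/
def keptEquiv : Fin k ≃ d.Kept where
  toFun j := ⟨P.rep (Sum.inl j), P.top_rep _, by rw [P.neg_rep]; rfl⟩
  invFun i := (P.index i).getLeft (by
    have := i.2.2
    rw [P.neg_eq] at this
    simpa using this)
  left_inv j := by simp [P.index_rep]
  right_inv i := by
    apply Subtype.ext
    simp [P.rep_index, i.2.1]

/-- The blocks with mark `-1`. -/
def removedEquiv : ι ≃ {i : Fin n // d.top i = i ∧ d.neg i = true} where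
  toFun j := ⟨P.rep (Sum.inr j), P.top_rep _, by rw [P.neg_rep]; rfl⟩
  invFun i := (P.index i).getRight (by
    have := i.2.2
    rwa [P.neg_eq] at this)
  left_inv j := by simp [P.index_rep]
  right_inv i := by
    apply Subtype.ext
    simp [P.rep_index, i.2.1]

lemma eq_of_enumeration {k' : ℕ} {ι' : Type} (P : Enumeration d k ι) (P' : Enumeration d k' ι') : k = k' := by
  simpa using Fintype.card_congr (P.keptEquiv.trans P'.keptEquiv.symm)

/-- A finite set has only one increasing enumeration, so the labels of the +1 blocks are forced. The
labels of the -1 blocks are free up to a bijection. -/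
lemma index_eq {ι' : Type} (P' : Enumeration d k ι') (i : Fin n) :
    P'.index i = (P.index i).map id (P.removedEquiv.trans P'.removedEquiv.symm) := by
  have h0 : ∀ {ι'' : Type} (P'' : Enumeration d k ι''), Set.range (P''.rep ∘ Sum.inl) =
      {i | d.top i = i ∧ d.neg i = false} := fun P'' => by
    ext i
    constructor
    · rintro ⟨j, rfl⟩
      exact (P''.keptEquiv j).2
    · intro hi
      exact ⟨P''.keptEquiv.symm ⟨i, hi⟩,
        congrArg Subtype.val (P''.keptEquiv.apply_symm_apply ⟨i, hi⟩)⟩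
  have h1 : P.rep ∘ Sum.inl = P'.rep ∘ Sum.inl :=
    (P.strictMono.range_inj P'.strictMono).1 ((h0 P).trans (h0 P').symm)
  apply P'.rep_injective
  rw [P'.rep_index, ← P.rep_index]
  rcases P.index i with j | l
  · exact congrFun h1 j
  · exact (congrArg Subtype.val (P'.removedEquiv.apply_symm_apply (P.removedEquiv l))).symm

/-- The enumeration belonging to `MarkedPartition.expand`. -/
def ofMarkedPartition (V : MarkedPartition n) :
    Enumeration V.toBlockData V.kept.card V.NegBlock where
  index i := if h : V.mark (V.blockOf i) = -1 then Sum.inr ⟨V.blockOf i, h⟩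
    else Sum.inl ((V.kept.orderIsoOfFin rfl).symm ⟨V.max (V.blockOf i), V.max_mem_kept h⟩)
  rep := Sum.elim (fun j => V.kept.orderIsoOfFin rfl j) fun B => V.max B.1
  index_rep x := by
    rcases x with j | B
    · obtain ⟨B, hB, hBj⟩ := Finset.mem_image.1 (V.kept.orderIsoOfFin rfl j).2
      have hB1 : V.mark B = 1 := (Finset.mem_filter.1 hB).2
      have h : V.mark (V.blockOf (V.kept.orderIsoOfFin rfl j)) ≠ -1 := by
        rw [← hBj, V.blockOf_max, hB1]; decide
      rw [Sum.elim_inl, dif_neg h]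
      congr 1
      rw [OrderIso.symm_apply_eq]
      apply Subtype.ext
      change V.max (V.blockOf (V.kept.orderIsoOfFin rfl j)) = V.kept.orderIsoOfFin rfl j
      rw [← hBj, V.blockOf_max]
    · have h : V.mark (V.blockOf (V.max B.1)) = -1 := by rw [V.blockOf_max]; exact B.2
      rw [Sum.elim_inr, dif_pos h]
      congr 1
      exact Subtype.ext (V.blockOf_max B.1)
  rep_index i := by
    split_ifs with h
    · rfl
    · rw [Sum.elim_inl, OrderIso.apply_symm_apply]; rfl
  neg_rep x := by
    rcases x with j | B
    · obtain ⟨B, hB, hBj⟩ := Finset.mem_image.1 (V.kept.orderIsoOfFin rfl j).2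
      have hB1 : V.mark B = 1 := (Finset.mem_filter.1 hB).2
      rw [Sum.elim_inl, Sum.isRight_inl, V.toBlockData_neg_false, ← hBj, V.blockOf_max, hB1]
    · rw [Sum.elim_inr, Sum.isRight_inr, V.toBlockData_neg, V.blockOf_max, B.2]
  strictMono _ _ h := (V.kept.orderIsoOfFin rfl).strictMono h

lemma expand_ofMarkedPartition {T : Type*} (V : MarkedPartition n) (s : Fin V.kept.card → T)
    (u : V.NegBlock → T) : (ofMarkedPartition V).expand s u = V.expand s u := by
  funext i
  unfold expand MarkedPartition.expand ofMarkedPartition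
  dsimp only
  split_ifs <;> rfl

variable {T : Type*} [TopologicalSpace T] [T2Space T] [SecondCountableTopology T]
  [MeasurableSpace T] [BorelSpace T] {σ : Measure T} [IsLocallyFiniteMeasure σ]
  (S : Statistics σ) (lam : ℝ)

/-- The -1 variables are integrated against a product of copies of σ, so relabelling them does not
change the integral. This allows each term to be computed with whichever labelling suits the
recursion, without transport along equalities of partitions. -/
lemma exists_fockTerm_eq {V : MarkedPartition n} [Fintype ι]
    (P : Enumeration V.toBlockData k ι) (f : B0 (Fin n → T) ℂ) :
    ∃ G : B0 (Fin k → T) ℂ, (∀ s, G.1 s = V.toBlockData.coeff lam *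
      ∫ u : ι → T, f.1 (P.expand s u) * V.toBlockData.q S (P.expand s u)
        ∂(Measure.pi fun _ : ι => σ)) ∧ fockTerm S lam V f = fockB0 S k G := by
  obtain rfl := (ofMarkedPartition V).eq_of_enumeration P
  refine ⟨V.reduce S lam f, fun s => ?_, rfl⟩
  change V.reduceFun S lam f.1 s = _
  rw [MarkedPartition.reduceFun, V.coeff_toBlockData]
  congr 1
  let e := P.removedEquiv.trans (ofMarkedPartition V).removedEquiv.symm
  rw [← (measurePreserving_piCongrLeft (fun _ : V.NegBlock => σ) e).integral_comp'
    (g := fun u => f.1 (V.expand s u) * V.q S (V.expand s u))]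
  refine integral_congr_ae (ae_of_all _ fun u => ?_)
  have h : V.expand s (MeasurableEquiv.piCongrLeft (fun _ : V.NegBlock => T) e u) =
      P.expand s u := by
    rw [← expand_ofMarkedPartition]
    funext i
    rw [expand, P.index_eq (ofMarkedPartition V), expand]
    rcases P.index i with j | l
    · rfl
    · exact Equiv.piCongrLeft_apply_apply (fun _ : V.NegBlock => T) e u l
  simp only [h, V.q_toBlockData]

end Enumeration

/-! ### Labellings, Q-factors and powers of λ after adjoining an index -/

namespace Enumeration

variable {n : ℕ} {d : BlockData n} {k : ℕ} {ι : Type}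

/-- The enumeration of the blocks after adjoining a singleton at the front. -/
def extendNone (P : Enumeration d k ι) : Enumeration (d.extend none) (k + 1) ι where
  index := Fin.cons (Sum.inl 0) fun i => (P.index i).map Fin.succ id
  rep := Sum.elim (Fin.cons 0 fun j => (P.rep (Sum.inl j)).succ) fun l => (P.rep (Sum.inr l)).succ
  index_rep x := by
    rcases x with j | l
    · refine Fin.cases ?_ (fun j => ?_) j <;> simp [P.index_rep]
    · simp [P.index_rep]
  rep_index i := by
    refine Fin.cases ?_ (fun i => ?_) i
    · simp [BlockData.extend_none_top]
    · rw [Fin.cons_succ, BlockData.extend_top_succ, ← P.rep_index]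
      rcases P.index i with j | l <;> simp
  neg_rep x := by
    rcases x with j | l
    · refine Fin.cases ?_ (fun j => ?_) j <;> simp [BlockData.extend_none_neg, P.neg_rep]
    · simp [BlockData.extend_none_neg, P.neg_rep]
  strictMono := by
    intro a b
    refine Fin.cases ?_ (fun a => ?_) a <;> refine Fin.cases ?_ (fun b => ?_) b
    · simp
    · simp
    · simp
    · simpa using fun h => P.strictMono h

/-- The enumeration of the blocks after adjoining an index at the front to a block with
mark `+1`. -/
def extendPos (P : Enumeration d k ι) (j : Fin k) :
    Enumeration (d.extend (some (P.keptEquiv j, false))) k ι where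
  index := Fin.cons (Sum.inl j) P.index
  rep x := (P.rep x).succ
  index_rep x := by simp [P.index_rep]
  rep_index i := by
    refine Fin.cases ?_ (fun i => ?_) i
    · simp [BlockData.extend_some_top, keptEquiv]
    · simp [BlockData.extend_top_succ, P.rep_index]
  neg_rep x := by simp [BlockData.extend_some_neg, P.neg_rep]
  strictMono := by
    intro a b h
    simpa using P.strictMono h

/-- The enumeration of the blocks after adjoining an index at the front to a block with mark `+1`
and changing the mark to `-1`. -/
def extendNeg (P : Enumeration d (k + 1) ι) (j : Fin (k + 1)) :
    Enumeration (d.extend (some (P.keptEquiv j, true))) k (Option ι) where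
  index := Fin.cons (Sum.inr none) fun i => Sum.elim
    (fun j' => (finSuccEquiv' j j').elim (Sum.inr none) Sum.inl) (Sum.inr ∘ some) (P.index i)
  rep := Sum.elim (fun m => (P.rep (Sum.inl (j.succAbove m))).succ)
    fun l => l.elim (P.rep (Sum.inl j)).succ fun l => (P.rep (Sum.inr l)).succ
  index_rep x := by
    rcases x with m | (_ | l) <;> simp [P.index_rep]
  rep_index i := by
    refine Fin.cases ?_ (fun i => ?_) i
    · simp [BlockData.extend_some_top, keptEquiv]
    · rw [BlockData.extend_top_succ, ← P.rep_index, Fin.cons_succ]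
      rcases P.index i with j' | l
      · rw [Sum.elim_inl]
        rcases eq_or_ne j' j with rfl | h
        · simp
        · obtain ⟨m, rfl⟩ := Fin.exists_succAbove_eq h
          simp
      · simp
  neg_rep x := by
    have h : ∀ x y, P.rep x = P.rep y ↔ x = y := fun x y => P.rep_injective.eq_iff
    rcases x with m | (_ | l)
    · simp [BlockData.extend_some_neg, P.neg_rep, keptEquiv, P.top_rep, h]
    · simp [BlockData.extend_some_neg, P.neg_rep, keptEquiv, P.top_rep]
    · simp [BlockData.extend_some_neg, P.neg_rep]
  strictMono := by
    intro a b h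
    simpa using P.strictMono (Fin.strictMono_succAbove j h)

variable {T : Type*}

lemma expand_extendNone (P : Enumeration d k ι) (s : Fin (k + 1) → T) (u : ι → T) :
    P.extendNone.expand s u = Fin.cons (s 0) (P.expand (Fin.tail s) u) := by
  funext i
  refine Fin.cases ?_ (fun i => ?_) i
  · rfl
  · simp only [expand, extendNone, Fin.cons_succ]
    rcases P.index i with j | l <;> rfl

lemma expand_extendPos (P : Enumeration d k ι) (j : Fin k) (s : Fin k → T) (u : ι → T) :
    (P.extendPos j).expand s u = Fin.cons (s j) (P.expand s u) := by
  funext i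
  refine Fin.cases ?_ (fun i => ?_) i <;> rfl

/-- The variable `u none` of the new -1 block is the value at the index 0 and also at the former +1
block j, so it is inserted as the j-th variable of the old point. -/
lemma expand_extendNeg (P : Enumeration d (k + 1) ι) (j : Fin (k + 1)) (s : Fin k → T)
    (u : Option ι → T) : (P.extendNeg j).expand s u =
      Fin.cons (u none) (P.expand (j.insertNth (u none) s) fun l => u (some l)) := by
  funext i
  refine Fin.cases ?_ (fun i => ?_) i
  · rfl
  · simp only [expand, extendNeg, Fin.cons_succ]
    rcases P.index i with j' | l
    · rcases eq_or_ne j' j with rfl | h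
      · simp
      · obtain ⟨m, rfl⟩ := Fin.exists_succAbove_eq h
        simp
    · rfl

variable [MeasurableSpace T] {σ : Measure T} (S : Statistics σ) (lam : ℝ)

lemma q_extendNone (t : Fin (n + 1) → T) : (d.extend none).q S t = d.q S (Fin.tail t) := by
  classical
  rw [BlockData.q_extend]
  simp [BlockData.crossing_extend_zero, BlockData.extend_none_neg]

lemma q_extendPos (j : d.Kept) (t : Fin (n + 1) → T) :
    (d.extend (some (j, false))).q S t = d.q S (Fin.tail t) := by
  classical
  rw [BlockData.q_extend]
  simp [BlockData.crossing_extend_zero, BlockData.extend_some_neg]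

/-- The new crossings are with the +1 blocks whose maximum lies below that of block j. As +1 blocks
are listed by their maxima, these are the blocks before j, and the resulting product is the phase of
the cycle in `qPerm_cycleRange_inv`. -/
lemma q_extendNeg (P : Enumeration d (k + 1) ι) (j : Fin (k + 1)) (t : Fin (n + 1) → T) :
    (d.extend (some (P.keptEquiv j, true))).q S t =
      (∏ i : Fin k, if i.castSucc < j then
        S.q (t 0) (Fin.tail t (P.rep (Sum.inl (j.succAbove i)))) else 1) *
      d.q S (Fin.tail t) := by
  classical
  have h1 : ∀ a, (d.extend (some (P.keptEquiv j, true))).Crossing (a.succ, 0) ↔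
      d.top a = a ∧ a < P.rep (Sum.inl j) ∧ d.neg a = false := fun a => by
    simp [BlockData.crossing_extend_zero, BlockData.extend_some_neg, BlockData.extend_some_top,
      keptEquiv]
  rw [BlockData.q_extend]
  congr 1
  symm
  refine Fintype.prod_of_injective (fun i => P.rep (Sum.inl (j.succAbove i))) ?_ _ _ ?_ ?_
  · exact P.rep_injective.comp (Sum.inl_injective.comp Fin.succAbove_right_injective)
  · intro a ha
    rw [if_neg]
    rw [h1]
    rintro ⟨h2, h3, h4⟩
    obtain ⟨j', hj'⟩ : ∃ j', P.rep (Sum.inl j') = a := ⟨P.keptEquiv.symm ⟨a, h2, h4⟩,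
        congrArg Subtype.val (P.keptEquiv.apply_symm_apply ⟨a, h2, h4⟩)⟩
    have hne : j' ≠ j := by
      rintro rfl
      exact h3.ne hj'.symm
    obtain ⟨m, rfl⟩ := Fin.exists_succAbove_eq hne
    exact ha ⟨m, hj'⟩
  · intro i
    refine if_congr ?_ rfl rfl
    have h2 : P.rep (Sum.inl (j.succAbove i)) < P.rep (Sum.inl j) ↔ j.succAbove i < j :=
      P.strictMono.lt_iff_lt
    rw [h1, h2, P.top_rep, P.neg_rep, Fin.succAbove_lt_iff_castSucc_lt]
    simp

lemma coeff_extendNone : (d.extend none).coeff lam = d.coeff lam := by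
  rw [BlockData.coeff_extend]
  simp [BlockData.extend_none_top]

lemma coeff_extendPos (j : d.Kept) : (d.extend (some (j, false))).coeff lam =
    lam * d.coeff lam := by
  rw [BlockData.coeff_extend]
  simp [BlockData.extend_some_top, BlockData.extend_some_neg]

lemma coeff_extendNeg (j : d.Kept) : (d.extend (some (j, true))).coeff lam = d.coeff lam := by
  rw [BlockData.coeff_extend]
  simp [BlockData.extend_some_neg]

end Enumeration

/-! ### The symmetrization as an orthogonal projection, and its decomposition over cycles -/

section Symmetrization

variable {T : Type*} [MeasurableSpace T] {σ : Measure T} [SigmaFinite σ] (S : Statistics σ)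

lemma inner_mulOp_mulOp {X : Type*} [MeasurableSpace X] (μ : Measure X) (c : X → ℂ)
    (hc : Measurable c) (hb : ∃ C : ℝ, ∀ x, ‖c x‖ ≤ C) (h1 : ∀ x, ‖c x‖ = 1) (f g : Lp ℂ 2 μ) :
    inner ℂ (mulOp μ c hc hb f) (mulOp μ c hc hb g) = inner ℂ f g := by
  rw [L2.inner_def, L2.inner_def]
  refine integral_congr_ae ?_
  filter_upwards [coeFn_mulOp μ c hc hb f, coeFn_mulOp μ c hc hb g] with x hf hg
  rw [hf, hg]
  have : c x * conj (c x) = 1 := by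
    rw [Complex.mul_conj, Complex.normSq_eq_norm_sq, h1]; simp
  simp only [RCLike.inner_apply, map_mul]
  calc c x * g x * (conj (c x) * conj (f x)) = (c x * conj (c x)) * (g x * conj (f x)) := by ring
    _ = _ := by rw [this, one_mul]

lemma inner_psi_psi {n : ℕ} (π : Equiv.Perm (Fin n)) (f g : Particle σ n) :
    inner ℂ (psi S π f) (psi S π g) = inner ℂ f g :=
  (inner_mulOp_mulOp _ _ (S.measurable_qPerm _) ⟨1, fun t => (S.norm_qPerm _ t).le⟩
    (S.norm_qPerm _) _ _).trans (LinearIsometry.inner_map_map _ _ _)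

lemma psi_inv_apply_psi {n : ℕ} (π : Equiv.Perm (Fin n)) (f : Particle σ n) :
    psi S π (psi S π⁻¹ f) = f := by
  have := DFunLike.congr_fun (psi_mul S π π⁻¹) f
  rw [mul_inv_cancel, psi_one] at this
  exact this.symm

lemma inner_psi_left {n : ℕ} (π : Equiv.Perm (Fin n)) (f g : Particle σ n) :
    inner ℂ (psi S π f) g = inner ℂ f (psi S π⁻¹ g) := by
  conv_lhs => rw [← psi_inv_apply_psi S π g]
  rw [inner_psi_psi]

/-- Each Ψ_π is unitary with adjoint Ψ_{π⁻¹}, and inversion permutes the group over which P_n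
averages. -/
lemma inner_symmetrization_left {n : ℕ} (f g : Particle σ n) :
    inner ℂ (symmetrization S n f) g = inner ℂ f (symmetrization S n g) := by
  simp only [symmetrization, smul_apply, sum_apply, inner_smul_left, inner_smul_right,
    sum_inner, inner_sum, inner_psi_left]
  congr 1
  · simp
  · exact Equiv.sum_comp (Equiv.inv (Equiv.Perm (Fin n))) fun π => inner ℂ f (psi S π g)

/-- This follows from Ψ_π P_n = P_n by taking adjoints. -/
lemma symmetrization_psi {n : ℕ} (π : Equiv.Perm (Fin n)) (f : Particle σ n) :
    symmetrization S n (psi S π f) = symmetrization S n f := by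
  refine ext_inner_left ℂ fun g => ?_
  rw [← inner_symmetrization_left, ← inner_symmetrization_left]
  have h : psi S π⁻¹ (symmetrization S n g) = symmetrization S n g :=
    DFunLike.congr_fun (psi_mul_symmetrization S π⁻¹) g
  conv_lhs => rw [← psi_inv_apply_psi S π (symmetrization S n g), h]
  rw [inner_psi_psi]

/-- The permutation `π` acting on all but the first index. -/
def shiftPerm {n : ℕ} (π : Equiv.Perm (Fin n)) : Equiv.Perm (Fin (n + 1)) :=
  Equiv.Perm.decomposeFin.symm (0, π)

@[simp] lemma shiftPerm_zero {n : ℕ} (π : Equiv.Perm (Fin n)) : shiftPerm π 0 = 0 := by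
  simp [shiftPerm]

@[simp] lemma shiftPerm_succ {n : ℕ} (π : Equiv.Perm (Fin n)) (i : Fin n) :
    shiftPerm π i.succ = (π i).succ := by
  simp [shiftPerm]

lemma shiftPerm_inv {n : ℕ} (π : Equiv.Perm (Fin n)) : (shiftPerm π)⁻¹ = shiftPerm π⁻¹ := by
  rw [inv_eq_iff_mul_eq_one]
  ext i
  refine Fin.cases ?_ (fun i => ?_) i <;> simp

lemma tail_comp_shiftPerm {n : ℕ} (π : Equiv.Perm (Fin n)) (t : Fin (n + 1) → T) :
    Fin.tail (t ∘ shiftPerm π) = Fin.tail t ∘ π := by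
  funext i
  simp [Fin.tail]

lemma qPerm_succ {n : ℕ} (π : Equiv.Perm (Fin (n + 1))) (t : Fin (n + 1) → T) :
    S.qPerm π t = (∏ i : Fin n, if π i.succ < π 0 then S.q (t 0) (t i.succ) else 1) *
      ∏ p : Fin n × Fin n, if p.1 < p.2 ∧ π p.2.succ < π p.1.succ then
        S.q (t p.1.succ) (t p.2.succ) else 1 := by
  unfold Statistics.qPerm
  rw [Finset.prod_filter, Fintype.prod_prod_type, Fintype.prod_prod_type, Fin.prod_univ_succ]
  congr 1
  · rw [Fin.prod_univ_succ]
    simp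
  · refine Finset.prod_congr rfl fun i _ => ?_
    rw [Fin.prod_univ_succ]
    simp

lemma qPerm_shiftPerm {n : ℕ} (π : Equiv.Perm (Fin n)) (t : Fin (n + 1) → T) :
    S.qPerm (shiftPerm π) t = S.qPerm π (Fin.tail t) := by
  rw [qPerm_succ]
  unfold Statistics.qPerm
  rw [Finset.prod_filter]
  simp [Fin.tail]

lemma coeFn_tensor (h : Lp ℂ 2 σ) (n : ℕ) (f : Particle σ n) :
    tensor σ h n f =ᵐ[Measure.pi fun _ : Fin (n + 1) => σ] fun t => h (t 0) * f (Fin.tail t) :=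
  (memLp_tensor h f).coeFn_toLp

lemma psi_shiftPerm_tensor (h : Lp ℂ 2 σ) {n : ℕ} (π : Equiv.Perm (Fin n)) (f : Particle σ n) :
    psi S (shiftPerm π) (tensor σ h n f) = tensor σ h n (psi S π f) := by
  refine Lp.ext ((coeFn_psi S _ _).trans (EventuallyEq.trans ?_ (coeFn_tensor h n _).symm))
  filter_upwards [(measurePreserving_perm σ (shiftPerm π)).quasiMeasurePreserving.ae
    (coeFn_tensor h n f), (measurePreserving_snd_comp_split σ n).ae (coeFn_psi S π f)] with t h1 h2
  rw [h1, h2, shiftPerm_inv, qPerm_shiftPerm, tail_comp_shiftPerm]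
  simp only [Function.comp_apply, shiftPerm_zero]
  ring

/-- Each Ψ_π on the last n variables is Ψ of a permutation of all n + 1 variables, which P_{n+1}
absorbs. The inner average therefore disappears. -/
lemma symmetrization_tensor_symmetrization (h : Lp ℂ 2 σ) {n : ℕ} (f : Particle σ n) :
    symmetrization S (n + 1) (tensor σ h n (symmetrization S n f)) =
      symmetrization S (n + 1) (tensor σ h n f) := by
  conv_lhs => enter [2, 2]; rw [symmetrization]
  simp only [smul_apply, sum_apply, map_smul, map_sum, ← psi_shiftPerm_tensor, symmetrization_psi]
  rw [Finset.sum_const, Finset.card_univ, Fintype.card_perm, Fintype.card_fin,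
    ← Nat.cast_smul_eq_nsmul ℂ, smul_smul, inv_mul_cancel₀, one_smul]
  exact_mod_cast n.factorial_ne_zero

lemma psi_mulOp_sum (h : T → ℂ) (hm : Measurable h) (hb : ∃ C : ℝ, ∀ t, ‖h t‖ ≤ C) {n : ℕ}
    (π : Equiv.Perm (Fin n)) (f : Particle σ n) :
    psi S π (mulOp _ (fun t => ∑ i, h (t i)) (measurable_sumFun h hm n) (bdd_sumFun h hb n) f) =
      mulOp _ (fun t => ∑ i, h (t i)) (measurable_sumFun h hm n) (bdd_sumFun h hb n)
        (psi S π f) := by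
  refine Lp.ext ((coeFn_psi S π _).trans (EventuallyEq.trans ?_ (coeFn_mulOp _ _ _ _ _).symm))
  filter_upwards [(measurePreserving_perm σ π).quasiMeasurePreserving.ae
    (coeFn_mulOp _ _ (measurable_sumFun h hm n) (bdd_sumFun h hb n) f), coeFn_psi S π f]
    with t h1 h2
  rw [h1, h2, mul_left_comm]
  congr 1
  exact Equiv.sum_comp π fun i => h (t i)

lemma symmetrization_mulOp_sum (h : T → ℂ) (hm : Measurable h) (hb : ∃ C : ℝ, ∀ t, ‖h t‖ ≤ C)
    {n : ℕ} (f : Particle σ n) :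
    symmetrization S n (mulOp _ (fun t => ∑ i, h (t i)) (measurable_sumFun h hm n)
      (bdd_sumFun h hb n) f) =
      mulOp _ (fun t => ∑ i, h (t i)) (measurable_sumFun h hm n) (bdd_sumFun h hb n)
        (symmetrization S n f) := by
  simp only [symmetrization, smul_apply, sum_apply, psi_mulOp_sum S h hm hb, map_smul, map_sum]

/-- Every permutation is uniquely a cycle moving some index to the front followed by a permutation
of the remaining indices. -/
lemma shiftPerm_mul_cycleRange_bijective (n : ℕ) : Function.Bijective
    fun x : Fin (n + 1) × Equiv.Perm (Fin n) => shiftPerm x.2 * x.1.cycleRange := by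
  rw [Fintype.bijective_iff_injective_and_card]
  constructor
  · rintro ⟨j, ρ⟩ ⟨j', ρ'⟩ h
    simp only at h
    have h1 : j = j' := by
      have h2 : (shiftPerm ρ' * j'.cycleRange) j = 0 := by
        rw [← h]; simp
      have h3 : (shiftPerm ρ' * j'.cycleRange) j' = 0 := by simp
      exact (shiftPerm ρ' * j'.cycleRange).injective (h2.trans h3.symm)
    subst h1
    have h2 := mul_right_cancel h
    have : ρ = ρ' := by
      ext i
      have := DFunLike.congr_fun h2 i.succ
      simp only [shiftPerm_succ, Fin.succ_inj] at this
      rw [this]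
    rw [this]
  · simp [Fintype.card_perm, Nat.factorial_succ]

/-- Write each permutation as one fixing the front index times a cycle. The first factor leaves h ⊗
φ invariant because φ is Q-symmetric, so averaging over it gives n! equal terms. What remains of (n
+ 1)/(n + 1)! is then 1. -/
lemma inner_tensor_symmetrization (h : Lp ℂ 2 σ) {n : ℕ} (φ : QSym S n)
    (g : Particle σ (n + 1)) :
    ((n : ℂ) + 1) * inner ℂ (tensor σ h n φ.1) (symmetrization S (n + 1) g) =
      ∑ j : Fin (n + 1), inner ℂ (tensor σ h n φ.1) (psi S j.cycleRange g) := by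
  have h1 : ∀ x : Fin (n + 1) × Equiv.Perm (Fin n),
      inner ℂ (tensor σ h n φ.1) (psi S (shiftPerm x.2 * x.1.cycleRange) g) =
      inner ℂ (tensor σ h n φ.1) (psi S x.1.cycleRange g) := fun x => by
    have h2 : tensor σ h n φ.1 = psi S (shiftPerm x.2) (tensor σ h n φ.1) := by
      rw [psi_shiftPerm_tensor, (mem_QSym_iff_psi S _).1 φ.2]
    have h3 : psi S (shiftPerm x.2 * x.1.cycleRange) g =
      psi S (shiftPerm x.2) (psi S x.1.cycleRange g) := DFunLike.congr_fun (psi_mul S _ _) g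
    conv_lhs => rw [h2, h3]
    rw [inner_psi_psi]
  have hn : (n.factorial : ℂ) ≠ 0 := by exact_mod_cast n.factorial_ne_zero
  have hn1 : (n : ℂ) + 1 ≠ 0 := by exact_mod_cast n.succ_ne_zero
  simp only [symmetrization, smul_apply, sum_apply, inner_smul_right, inner_sum]
  rw [← (shiftPerm_mul_cycleRange_bijective n).sum_comp
    (fun π => inner ℂ (tensor σ h n φ.1) (psi S π g)), Finset.sum_congr rfl fun x _ => h1 x,
    Fintype.sum_prod_type]
  simp only [Finset.sum_const, Finset.card_univ, Fintype.card_perm, Fintype.card_fin]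
  rw [← Finset.smul_sum, nsmul_eq_mul, Nat.factorial_succ]
  push_cast
  field_simp

/-- The inverse cycle sends 0 to j and is increasing on the other indices, so every inversion
involves 0. -/
lemma qPerm_cycleRange_inv {n : ℕ} (j : Fin (n + 1)) (t : Fin (n + 1) → T) :
    S.qPerm j.cycleRange⁻¹ t =
      ∏ i : Fin n, if i.castSucc < j then S.q (t 0) (t i.succ) else 1 := by
  have h0 : j.cycleRange⁻¹ 0 = j := Fin.cycleRange_symm_zero j
  have h1 : ∀ i : Fin n, j.cycleRange⁻¹ i.succ = j.succAbove i := Fin.cycleRange_symm_succ j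
  rw [qPerm_succ]
  simp only [h0, h1, Fin.succAbove_lt_iff_castSucc_lt]
  rw [Finset.prod_eq_one (s := (Finset.univ : Finset (Fin n × Fin n))), mul_one]
  intro p _
  rw [if_neg]
  rintro ⟨h2, h3⟩
  exact absurd (Fin.strictMono_succAbove j h2) h3.not_gt

lemma coeFn_psi_cycleRange {n : ℕ} (j : Fin (n + 1)) (g : Particle σ (n + 1)) :
    psi S j.cycleRange g =ᵐ[Measure.pi fun _ : Fin (n + 1) => σ] fun t =>
      (∏ i : Fin n, if i.castSucc < j then S.q (t 0) (Fin.tail t i) else 1) *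
        g (t ∘ j.cycleRange) := by
  refine (coeFn_psi S _ g).trans (ae_of_all _ fun t => ?_)
  simp only [qPerm_cycleRange_inv]
  rfl

lemma comp_cycleRange {n : ℕ} (j : Fin (n + 1)) (t : Fin (n + 1) → T) :
    t ∘ j.cycleRange = j.insertNth (t 0) (Fin.tail t) := by
  rw [← Fin.cons_comp_cycleRange, Fin.cons_self_tail]

end Symmetrization

/-! ### Action of creation, neutral and annihilation operators on P_n g -/

section FieldAction

variable {T : Type*} [TopologicalSpace T] [T2Space T] [SecondCountableTopology T]
  [MeasurableSpace T] [BorelSpace T] {σ : Measure T} [IsLocallyFiniteMeasure σ]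
  (S : Statistics σ) (lam : ℝ)

lemma ofReal_bounded (f₀ : B0 T ℝ) : ∃ C : ℝ, ∀ t, ‖(f₀.1 t : ℂ)‖ ≤ C :=
  f₀.2.2.1.elim fun C hC => ⟨C, fun t => by rw [Complex.norm_real]; exact hC t⟩

lemma tensorB0_mem (f₀ : B0 T ℝ) {n : ℕ} (g : B0 (Fin n → T) ℂ) :
    (fun t => (f₀.1 (t 0) : ℂ) * g.1 (Fin.tail t)) ∈ B0 (Fin (n + 1) → T) ℂ := by
  obtain ⟨C, hC⟩ := ofReal_bounded f₀
  obtain ⟨hg, ⟨D, hD⟩, hs⟩ := g.2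
  refine ⟨?_, ⟨C * D, fun t => ?_⟩, ?_⟩
  · exact ((Complex.measurable_ofReal.comp f₀.2.1).comp (measurable_pi_apply 0)).mul
      (hg.comp (measurable_pi_lambda _ fun i => measurable_pi_apply i.succ))
  · rw [norm_mul]
    exact mul_le_mul (hC _) (hD _) (norm_nonneg _) ((norm_nonneg _).trans (hC (t 0)))
  · have hc : Continuous fun p : T × (Fin n → T) => (Fin.cons p.1 p.2 : Fin (n + 1) → T) :=
      continuous_pi fun i => by
        refine Fin.cases ?_ (fun i => ?_) i
        · exact continuous_fst
        · exact (continuous_apply i).comp continuous_snd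
    refine HasCompactSupport.of_support_subset_isCompact
      ((f₀.2.2.2.isCompact.prod hs.isCompact).image hc) fun t ht => ?_
    rw [Function.mem_support, mul_ne_zero_iff] at ht
    exact ⟨(t 0, Fin.tail t), ⟨subset_tsupport _ fun h => ht.1 (by rw [h]; simp),
      subset_tsupport _ ht.2⟩, Fin.cons_self_tail t⟩

/-- The tensor product `f₀ ⊗ g`. -/
def tensorB0 (f₀ : B0 T ℝ) {n : ℕ} (g : B0 (Fin n → T) ℂ) : B0 (Fin (n + 1) → T) ℂ :=
  ⟨_, tensorB0_mem f₀ g⟩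

lemma fockB0_apply (n : ℕ) (g : B0 (Fin n → T) ℂ) : fockB0 S n g =
    DirectSum.lof ℂ ℕ (fun n => QSym S n) n (toQSym S n (toParticle σ n g)) := rfl

lemma creation_fockB0 (f₀ : B0 T ℝ) {n : ℕ} (g : B0 (Fin n → T) ℂ) :
    creation S (memLp_B0 f₀).toLp (fockB0 S n g) = fockB0 S (n + 1) (tensorB0 f₀ g) := by
  rw [fockB0_apply, fockB0_apply, creation, DirectSum.toModule_lof]
  refine congrArg (DirectSum.lof ℂ ℕ (fun n => QSym S n) (n + 1)) (Subtype.ext ?_)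
  refine (symmetrization_tensor_symmetrization S _ _).trans
    (congrArg (symmetrization S (n + 1)) ?_)
  refine Lp.ext ((coeFn_tensor _ _ _).trans (EventuallyEq.trans ?_ (coeFn_toParticle _).symm))
  have h1 := (measurePreserving_split σ n).quasiMeasurePreserving.ae
    (Measure.quasiMeasurePreserving_fst.ae (memLp_B0 (σ := σ) f₀).coeFn_toLp)
  filter_upwards [h1, (measurePreserving_snd_comp_split σ n).ae (coeFn_toParticle (σ := σ) g)]
    with t h1 h2
  rw [h1, h2]
  rfl

/-- Multiplication by the symmetric sum commutes with P_n, so it can be applied to g and expanded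
into one term per variable. -/
lemma neutral_fockB0 (f₀ : B0 T ℝ) {n : ℕ} (g : B0 (Fin n → T) ℂ)
    (G : Fin n → B0 (Fin n → T) ℂ) (hG : ∀ j t, (G j).1 t = f₀.1 (t j) * g.1 t) :
    neutral S (fun t => (f₀.1 t : ℂ)) (Complex.measurable_ofReal.comp f₀.2.1) (ofReal_bounded f₀)
      (fockB0 S n g) = ∑ j, fockB0 S n (G j) := by
  rw [← map_sum, fockB0_apply, fockB0_apply, neutral, DirectSum.toModule_lof]
  refine congrArg (DirectSum.lof ℂ ℕ (fun n => QSym S n) n) (Subtype.ext ?_)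
  refine (symmetrization_mulOp_sum S _ (Complex.measurable_ofReal.comp f₀.2.1) (ofReal_bounded f₀)
    _).symm.trans
    (congrArg (symmetrization S n) ?_)
  refine Lp.ext ((coeFn_mulOp _ _ _ _ _).trans (EventuallyEq.trans ?_ (coeFn_toParticle _).symm))
  filter_upwards [coeFn_toParticle (σ := σ) g] with t ht
  rw [ht]
  simp [hG, Finset.sum_mul, Finset.sum_apply]

lemma annihilation_fockB0_zero (h : Lp ℂ 2 σ) (g : B0 (Fin 0 → T) ℂ) :
    annihilation S h (fockB0 S 0 g) = 0 := by
  rw [fockB0_apply, annihilation, DirectSum.toModule_lof]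
  rfl

/-- After the cycle the variable u = t₀ sits in position j of g, and f₀ is real, so Fubini
integrates u out first and leaves the scalar product with G. -/
lemma inner_tensor_psi_cycleRange (f₀ : B0 T ℝ) {n : ℕ} (φ : Particle σ n)
    (g : B0 (Fin (n + 1) → T) ℂ) (j : Fin (n + 1)) (G : B0 (Fin n → T) ℂ)
    (hG : ∀ s, G.1 s = ∫ u, f₀.1 u * ((∏ i : Fin n, if i.castSucc < j then S.q u (s i) else 1) *
      g.1 (j.insertNth u s)) ∂σ) :
    inner ℂ (tensor σ (memLp_B0 f₀).toLp n φ) (psi S j.cycleRange (toParticle σ (n + 1) g)) =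
      inner ℂ φ (toParticle σ n G) := by
  set μ := Measure.pi fun _ : Fin n => σ
  let H : T × (Fin n → T) → ℂ := fun p => f₀.1 p.1 *
    ((∏ i : Fin n, if i.castSucc < j then S.q p.1 (p.2 i) else 1) *
      g.1 (j.insertNth p.1 p.2)) * conj (φ p.2)
  let e := MeasurableEquiv.piFinSuccAbove (fun _ : Fin (n + 1) => T) 0
  have he : MeasurePreserving e (Measure.pi fun _ : Fin (n + 1) => σ) (σ.prod μ) :=
    measurePreserving_piFinSuccAbove (fun _ : Fin (n + 1) => σ) 0
  have key : (fun t => inner ℂ (tensor σ (memLp_B0 f₀).toLp n φ t)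
      (psi S j.cycleRange (toParticle σ (n + 1) g) t))
      =ᵐ[Measure.pi fun _ : Fin (n + 1) => σ] fun t => H (e t) := by
    have h1 := (measurePreserving_split σ n).quasiMeasurePreserving.ae
      (Measure.quasiMeasurePreserving_fst.ae (memLp_B0 (σ := σ) f₀).coeFn_toLp)
    filter_upwards [h1, coeFn_tensor (memLp_B0 (σ := σ) f₀).toLp n φ,
      coeFn_psi_cycleRange S j (toParticle σ (n + 1) g),
      (measurePreserving_perm σ j.cycleRange).quasiMeasurePreserving.ae
        (coeFn_toParticle (σ := σ) g)] with t h1 h2 h3 h4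
    rw [h2, h3, h4, h1, comp_cycleRange]
    change _ = (f₀.1 (t 0) : ℂ) * ((∏ i : Fin n, if i.castSucc < j then
      S.q (t 0) (Fin.tail t i) else 1) * g.1 (j.insertNth (t 0) (Fin.tail t))) *
      conj (φ (Fin.tail t))
    simp only [RCLike.inner_apply, map_mul, Complex.conj_ofReal]
    ring
  -- Fubini is justified because, in the original variables, H is the pointwise scalar product of
  -- two L² functions.
  have hint : Integrable H (σ.prod μ) := by
    rw [← he.integrable_comp_emb e.measurableEmbedding]
    exact (L2.integrable_inner _ _).congr key
  rw [L2.inner_def, L2.inner_def, integral_congr_ae key, he.integral_comp' (g := H),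
    integral_prod_symm _ hint]
  refine integral_congr_ae ?_
  filter_upwards [coeFn_toParticle (σ := σ) G] with s hs
  rw [hs, RCLike.inner_apply, hG, ← integral_mul_const]

/-- Tested against φ in P_n L², the weight n + 1 from the factorials of the Fock space cancels the
averaging over the n + 1 cycles. This gives one contraction of f₀ with each variable of g. -/
lemma annihilation_fockB0_succ (f₀ : B0 T ℝ) {n : ℕ} (g : B0 (Fin (n + 1) → T) ℂ)
    (G : Fin (n + 1) → B0 (Fin n → T) ℂ)
    (hG : ∀ j s, (G j).1 s = ∫ u, f₀.1 u *
      ((∏ i : Fin n, if i.castSucc < j then S.q u (s i) else 1) * g.1 (j.insertNth u s)) ∂σ) :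
    annihilation S (memLp_B0 f₀).toLp (fockB0 S (n + 1) g) = ∑ j, fockB0 S n (G j) := by
  rw [← map_sum, fockB0_apply, fockB0_apply, annihilation, DirectSum.toModule_lof]
  refine congrArg (DirectSum.lof ℂ ℕ (fun n => QSym S n) n) ?_
  refine ext_inner_left ℂ fun φ => ?_
  change inner ℂ φ (annihilationL S _ n _) = _
  rw [annihilationL, smul_apply, inner_smul_right,
    ContinuousLinearMap.adjoint_inner_right]
  change ((n : ℂ) + 1) * inner ℂ (symmetrization S (n + 1) (tensor σ _ n φ.1))
    (symmetrization S (n + 1) (toParticle σ (n + 1) g)) =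
    inner ℂ φ.1 (symmetrization S n (toParticle σ n (∑ j, G j)))
  have h1 : symmetrization S (n + 1) (symmetrization S (n + 1) (toParticle σ (n + 1) g)) =
      symmetrization S (n + 1) (toParticle σ (n + 1) g) :=
    DFunLike.congr_fun (isIdempotentElem_symmetrization S (n + 1)) _
  rw [inner_symmetrization_left, h1, inner_tensor_symmetrization, ← inner_symmetrization_left,
    (mem_QSym_iff S _).1 φ.2, map_sum, inner_sum]
  exact Finset.sum_congr rfl fun j _ => inner_tensor_psi_cycleRange S f₀ φ.1 g j (G j) (hG j)

end FieldAction

/-! ### The vector of the Wick rule and its recursion -/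

section WickVector

variable {T : Type*} [TopologicalSpace T] [T2Space T] [SecondCountableTopology T]
  [MeasurableSpace T] [BorelSpace T] {σ : Measure T} [IsLocallyFiniteMeasure σ]
  (S : Statistics σ) (lam : ℝ)

lemma BlockData.norm_q {n : ℕ} (d : BlockData n) (t : Fin n → T) : ‖d.q S t‖ = 1 := by
  rw [BlockData.q, norm_prod]
  exact Finset.prod_eq_one fun p _ => S.norm_q _ _

lemma BlockData.measurable_q {n : ℕ} (d : BlockData n) : Measurable (d.q S) := by
  refine Finset.measurable_prod _ fun p _ => ?_
  exact S.measurable_q.comp (f := fun t : Fin n → T => (t p.2, t p.1))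
    ((measurable_pi_apply _).prodMk (measurable_pi_apply _))

lemma Enumeration.integrand_mem_B0 {n k : ℕ} {ι : Type} {d : BlockData n} (P : Enumeration d k ι)
    (f : B0 (Fin n → T) ℂ) (s : Fin k → T) :
    (fun u : ι → T => f.1 (P.expand s u) * d.q S (P.expand s u)) ∈ B0 (ι → T) ℂ := by
  obtain ⟨hf, ⟨C, hC⟩, hs⟩ := f.2
  have hm : Measurable fun u : ι → T => P.expand s u := measurable_pi_lambda _ fun i => by
    unfold Enumeration.expand
    rcases P.index i with j | l
    · exact measurable_const
    · exact measurable_pi_apply l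
  refine ⟨(hf.comp hm).mul ((d.measurable_q S).comp hm), ⟨C, fun u => ?_⟩, ?_⟩
  · rw [norm_mul, d.norm_q, mul_one]
    exact hC _
  · have hc : Continuous fun t : Fin n → T => fun l : ι => t (P.rep (Sum.inr l)) :=
      continuous_pi fun l => continuous_apply _
    refine HasCompactSupport.of_support_subset_isCompact (hs.isCompact.image hc) fun u hu => ?_
    rw [Function.mem_support, mul_ne_zero_iff] at hu
    exact ⟨P.expand s u, subset_tsupport _ hu.1, funext fun l => P.expand_rep s u (Sum.inr l)⟩

lemma Enumeration.integrable_integrand {n k : ℕ} {ι : Type} [Fintype ι] {d : BlockData n}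
    (P : Enumeration d k ι) (f : B0 (Fin n → T) ℂ) (s : Fin k → T) :
    Integrable (fun u : ι → T => f.1 (P.expand s u) * d.q S (P.expand s u))
      (Measure.pi fun _ : ι => σ) :=
  memLp_one_iff_integrable.1 (memLp_of_mem_B0 _ 1 ⟨_, P.integrand_mem_B0 S f s⟩)

/-- The term of the Wick rule belonging to an encoded marked partition. -/
def dataTerm {n : ℕ} (d : BlockData n) (f : B0 (Fin n → T) ℂ) : FockFin S :=
  fockTerm S lam ((MarkedPartition.blockDataEquiv n).symm d) f

/-- The vector `⟨f, ω^{⊗n}⟩Ω`, as given by the Wick rule. -/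
def wickVector {n : ℕ} (f : B0 (Fin n → T) ℂ) : FockFin S :=
  ∑ V : MarkedPartition n, fockTerm S lam V f

lemma wickVector_eq_sum {n : ℕ} (f : B0 (Fin n → T) ℂ) :
    wickVector S lam f = ∑ d : BlockData n, dataTerm S lam d f :=
  ((MarkedPartition.blockDataEquiv n).symm.sum_comp fun V => fockTerm S lam V f).symm

lemma exists_dataTerm_eq {n k : ℕ} {ι : Type} [Fintype ι] {d : BlockData n}
    (P : Enumeration d k ι) (f : B0 (Fin n → T) ℂ) :
    ∃ G : B0 (Fin k → T) ℂ, (∀ s, G.1 s = d.coeff lam *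
      ∫ u : ι → T, f.1 (P.expand s u) * d.q S (P.expand s u) ∂(Measure.pi fun _ : ι => σ)) ∧
      dataTerm S lam d f = fockB0 S k G := by
  obtain ⟨V, rfl⟩ := (MarkedPartition.blockDataEquiv n).surjective d
  have h : dataTerm S lam (MarkedPartition.blockDataEquiv n V) f = fockTerm S lam V f := by
    rw [dataTerm, Equiv.symm_apply_apply]
  rw [h]
  exact P.exists_fockTerm_eq S lam f

lemma exists_enumeration {n : ℕ} (d : BlockData n) :
    ∃ (k : ℕ) (ι : Type) (_ : Fintype ι), Nonempty (Enumeration d k ι) := by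
  obtain ⟨V, rfl⟩ := (MarkedPartition.blockDataEquiv n).surjective d
  exact ⟨_, _, inferInstance, ⟨Enumeration.ofMarkedPartition V⟩⟩

/-- This separates the variable of the newly created -1 block, which a⁻ integrates, from those of
the older -1 blocks. -/
lemma integral_option {ι : Type} [Fintype ι] (H : (Option ι → T) → ℂ)
    (hH : Integrable H (Measure.pi fun _ : Option ι => σ)) :
    ∫ u, H u ∂(Measure.pi fun _ : Option ι => σ) =
      ∫ x, ∫ u : ι → T, H (fun l => l.elim x u) ∂(Measure.pi fun _ : ι => σ) ∂σ := by
  let e := (MeasurableEquiv.piOptionEquivProd fun _ : Option ι => T).symm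
  have he : MeasurePreserving e ((Measure.pi fun _ : ι => σ).prod σ)
      (Measure.pi fun _ : Option ι => σ) :=
    ⟨e.measurable, Measure.pi_map_piOptionEquivProd fun _ : Option ι => σ⟩
  have hH' := (he.integrable_comp_emb e.measurableEmbedding).2 hH
  rw [← he.integral_comp']
  refine (integral_prod_symm _ hH').trans ?_
  refine integral_congr_ae (ae_of_all _ fun x => integral_congr_ae (ae_of_all _ fun u => ?_))
  change H _ = H _
  congr 1
  funext l
  rcases l with _ | l <;> rfl

/-- The three summands of the field operator are matched one by one with the three ways of adjoining
an index. Each amounts to comparing the integrands over the old -1 variables. -/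
lemma field_dataTerm {n : ℕ} (d : BlockData n) (f₀ : B0 T ℝ) (f : B0 (Fin n → T) ℂ) :
    field S lam f₀ (dataTerm S lam d f) = dataTerm S lam (d.extend none) (tensorB0 f₀ f) +
      (∑ j : d.Kept, dataTerm S lam (d.extend (some (j, false))) (tensorB0 f₀ f) +
        ∑ j : d.Kept, dataTerm S lam (d.extend (some (j, true))) (tensorB0 f₀ f)) := by
  obtain ⟨k, ι, _, ⟨P⟩⟩ := exists_enumeration d
  obtain ⟨G, hG, hG'⟩ := exists_dataTerm_eq S lam P f
  have hF : ∀ (x : T) (t : Fin n → T),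
      (tensorB0 f₀ f).1 (Fin.cons x t) = f₀.1 x * f.1 t := fun x t => rfl
  rw [hG', field, LinearMap.add_apply, LinearMap.add_apply, LinearMap.smul_apply, add_assoc,
    creation_fockB0]
  congr 1
  · obtain ⟨G₁, hG₁, hG₁'⟩ := exists_dataTerm_eq S lam P.extendNone (tensorB0 f₀ f)
    rw [hG₁']
    congr 1
    refine Subtype.ext (funext fun s => ?_)
    rw [hG₁]
    change (f₀.1 (s 0) : ℂ) * G.1 (Fin.tail s) = _
    simp only [hG, Enumeration.coeff_extendNone, Enumeration.expand_extendNone, hF,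
      Enumeration.q_extendNone, Fin.tail_cons, mul_assoc, integral_const_mul]
    ring
  · congr 1
    · rw [← P.keptEquiv.sum_comp]
      choose G₁ hG₁ hG₁' using fun j => exists_dataTerm_eq S lam (P.extendPos j) (tensorB0 f₀ f)
      choose G₂ hG₂ using fun j : Fin k => (⟨⟨fun t => (f₀.1 (t j) : ℂ) * G.1 t, by
        obtain ⟨C, hC⟩ := ofReal_bounded f₀
        obtain ⟨hg, ⟨D, hD⟩, hs⟩ := G.2
        refine ⟨((Complex.measurable_ofReal.comp f₀.2.1).comp (measurable_pi_apply j)).mul hg,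
          ⟨C * D, fun t => ?_⟩, hs.mul_left⟩
        rw [norm_mul]
        exact mul_le_mul (hC _) (hD _) (norm_nonneg _) ((norm_nonneg _).trans (hC (t j)))⟩,
          fun t => rfl⟩ : ∃ G₂ : B0 (Fin k → T) ℂ, ∀ t, G₂.1 t = f₀.1 (t j) * G.1 t)
      rw [neutral_fockB0 S f₀ G G₂ hG₂, Finset.smul_sum]
      refine Finset.sum_congr rfl fun j _ => ?_
      rw [hG₁', ← map_smul]
      congr 1
      refine Subtype.ext (funext fun s => ?_)
      rw [hG₁]
      change (lam : ℂ) * (G₂ j).1 s = _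
      simp only [hG₂, hG, Enumeration.coeff_extendPos, Enumeration.expand_extendPos, hF,
        Enumeration.q_extendPos, Fin.tail_cons, mul_assoc, integral_const_mul]
      ring
    · rw [← P.keptEquiv.sum_comp]
      -- Without +1 blocks the vector lies in degree 0: annihilation kills it, and there is no block
      -- whose mark could be changed.
      rcases k with _ | k
      · rw [annihilation_fockB0_zero]
        simp
      · choose G₁ hG₁ hG₁' using
          fun j => exists_dataTerm_eq S lam (P.extendNeg j) (tensorB0 f₀ f)
        simp only [hG₁']
        refine annihilation_fockB0_succ S f₀ G G₁ fun j s => ?_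
        rw [hG₁, integral_option _ ((P.extendNeg j).integrable_integrand S (tensorB0 f₀ f) s),
          Enumeration.coeff_extendNeg, ← integral_const_mul]
        refine integral_congr_ae (ae_of_all _ fun x => ?_)
        -- The new Q-factors only see kept variables other than the contracted one, so they do not
        -- depend on u and agree with the phase produced by annihilation.
        have h : ∀ (u : ι → T) (i : Fin k), P.expand (j.insertNth x s) u
            (P.rep (Sum.inl (j.succAbove i))) = s i := fun u i => by
          rw [P.expand_rep]; simp
        simp only [Enumeration.expand_extendNeg, Option.elim_none, Option.elim_some, hF,
          Enumeration.q_extendNeg, Fin.cons_zero, Fin.tail_cons, h, hG]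
        rw [← integral_const_mul, ← integral_const_mul, ← integral_const_mul, ← integral_const_mul]
        refine integral_congr_ae (ae_of_all _ fun u => ?_)
        simp only
        ring

lemma field_wickVector {n : ℕ} (f₀ : B0 T ℝ) (f : B0 (Fin n → T) ℂ) :
    field S lam f₀ (wickVector S lam f) = wickVector S lam (tensorB0 f₀ f) := by
  rw [wickVector_eq_sum, wickVector_eq_sum, map_sum, BlockData.sum_extend]
  exact Finset.sum_congr rfl fun d _ => field_dataTerm S lam d f₀ f

/-- The encoding of the partition into singletons. -/
def BlockData.trivial (n : ℕ) : BlockData n where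
  top i := i
  neg _ := false
  le_top i := le_rfl
  top_top _ := rfl
  neg_top _ := rfl
  exists_ne _ h := absurd h (by decide)

/-- This is the start of the induction in degree 0, and in general the term of top degree. -/
lemma dataTerm_trivial {n : ℕ} (f : B0 (Fin n → T) ℂ) :
    dataTerm S lam (BlockData.trivial n) f = fockB0 S n f := by
  let P : Enumeration (BlockData.trivial n) n Empty :=
    { index := Sum.inl
      rep := Sum.elim id Empty.elim
      index_rep := by rintro (j | l) <;> [rfl; exact l.elim]
      rep_index := fun _ => rfl
      neg_rep := by rintro (j | l) <;> [rfl; exact l.elim]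
      strictMono := strictMono_id }
  obtain ⟨G, hG, hG'⟩ := exists_dataTerm_eq S lam P f
  rw [hG']
  congr 1
  refine Subtype.ext (funext fun s => ?_)
  have h1 : (BlockData.trivial n).coeff lam = 1 :=
    Finset.prod_eq_one fun i _ => if_pos (Or.inl rfl)
  have h2 : ∀ t : Fin n → T, (BlockData.trivial n).q S t = 1 := fun t => by
    classical
    refine Finset.prod_eq_one fun p hp => ?_
    exact absurd (Finset.mem_filter.1 hp).2.2.2.1 (by simp [BlockData.trivial])
  have h3 : ∀ u : Empty → T, P.expand s u = s := fun u => rfl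
  rw [hG, h1, one_mul]
  simp only [h2, h3, mul_one]
  rw [Measure.pi_of_empty]
  simp

lemma fockB0_zero_eq_vacuum (g : B0 (Fin 0 → T) ℂ) (hg : ∀ t, g.1 t = 1) :
    fockB0 S 0 g = vacuum S := by
  rw [fockB0_apply, vacuum]
  refine congrArg (DirectSum.lof ℂ ℕ (fun n => QSym S n) 0) (Subtype.ext ?_)
  have h : toParticle σ 0 g = (memLp_vacuum (σ := σ)).toLp := by
    exact (MemLp.toLp_eq_toLp_iff (memLp_of_mem_B0 _ 2 g) memLp_vacuum).2 (ae_of_all _ hg)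
  change symmetrization S 0 (toParticle σ 0 g) = _
  rw [h]
  exact (mem_QSym_iff S _).1 ((mem_QSym_iff_psi S _).2 fun π => by
    rw [Subsingleton.elim π 1, psi_one]; rfl)

instance : Subsingleton (BlockData 0) :=
  ⟨fun _ _ => BlockData.ext (Subsingleton.elim _ _) (Subsingleton.elim _ _)⟩

lemma prod_mem_B0 {n : ℕ} (f : Fin n → B0 T ℝ) :
    (fun t : Fin n → T => ∏ i, ((f i).1 (t i) : ℂ)) ∈ B0 (Fin n → T) ℂ := by
  refine ⟨Finset.measurable_prod _ fun i _ =>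
    (Complex.measurable_ofReal.comp (f i).2.1).comp (measurable_pi_apply i), ?_, ?_⟩
  · choose C hC using fun i : Fin n => ofReal_bounded (f i)
    refine ⟨∏ i, C i, fun t => ?_⟩
    rw [norm_prod]
    exact Finset.prod_le_prod (fun _ _ => norm_nonneg _) fun i _ => hC i _
  · refine HasCompactSupport.of_support_subset_isCompact
      (isCompact_univ_pi fun i : Fin n => (f i).2.2.2.isCompact) fun t ht i _ => ?_
    rw [Function.mem_support, Finset.prod_ne_zero_iff] at ht
    exact subset_tsupport _ fun h => ht i (Finset.mem_univ i) (by rw [h]; simp)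

/-- Induction on n: the leftmost field operator acts on the vector of the remaining ones by
`field_wickVector`, and for n = 0 the only encoding yields Ω. -/
lemma monomial_vacuum {n : ℕ} (f : Fin n → B0 T ℝ) (g : B0 (Fin n → T) ℂ)
    (hg : ∀ t, g.1 t = ∏ i, ((f i).1 (t i) : ℂ)) :
    (monomial S lam f).1 (vacuum S) = wickVector S lam g := by
  induction n with
  | zero =>
    rw [wickVector_eq_sum, Fintype.sum_subsingleton _ (BlockData.trivial 0), dataTerm_trivial,
      fockB0_zero_eq_vacuum S g (by simpa using hg)]
    rfl
  | succ n ih =>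
    have hp := prod_mem_B0 fun i => f i.succ
    have h1 : monomial S lam f = polyField S lam (f 0) * monomial S lam (fun i => f i.succ) := by
      rw [monomial, List.ofFn_succ, List.prod_cons]; rfl
    have h2 : g = tensorB0 (f 0) ⟨_, hp⟩ := Subtype.ext (funext fun t => by
      rw [hg, Fin.prod_univ_succ]; rfl)
    rw [h1, h2, ← field_wickVector, ← ih _ ⟨_, hp⟩ fun t => rfl]
    rfl

end WickVector

/-! ### Linearity and continuity of the Wick vector under bounded convergence -/

/-- Pointwise convergence of uniformly bounded functions with supports in a common compact set. -/
def BoundedConv {X : Type*} [TopologicalSpace X] [MeasurableSpace X] (g : ℕ → B0 X ℂ)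
    (g' : B0 X ℂ) : Prop :=
  ∃ (C : ℝ) (K : Set X), IsCompact K ∧ (∀ j t, ‖(g j).1 t‖ ≤ C) ∧ (∀ j, ∀ t ∉ K, (g j).1 t = 0) ∧
    ∀ t, Tendsto (fun j => (g j).1 t) atTop (𝓝 (g'.1 t))

lemma BoundedConv.tendsto_integral {X : Type*} [TopologicalSpace X] [T2Space X] [MeasurableSpace X]
    [OpensMeasurableSpace X] {μ : Measure X} [IsFiniteMeasureOnCompacts μ] {g : ℕ → B0 X ℂ}
    {g' : B0 X ℂ} (h : BoundedConv g g') :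
    Tendsto (fun j => ∫ t, (g j).1 t ∂μ) atTop (𝓝 (∫ t, g'.1 t ∂μ)) := by
  obtain ⟨C, K, hK, hC, hgK, hlim⟩ := h
  refine tendsto_integral_of_dominated_convergence (K.indicator fun _ => C)
    (fun j => (g j).2.1.aestronglyMeasurable) ?_ (fun j => ae_of_all _ fun t => ?_)
    (ae_of_all _ hlim)
  · exact (integrable_indicator_iff hK.measurableSet).2
      (integrableOn_const hK.measure_lt_top.ne)
  · by_cases ht : t ∈ K
    · rw [Set.indicator_of_mem ht]; exact hC j t
    · rw [Set.indicator_of_notMem ht, hgK j t ht, norm_zero]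

section

variable {T : Type*} [TopologicalSpace T] [T2Space T] [SecondCountableTopology T]
  [MeasurableSpace T] [BorelSpace T] {σ : Measure T} [IsLocallyFiniteMeasure σ]
  (S : Statistics σ) (lam : ℝ)

lemma BoundedConv.tendsto_toParticle {n : ℕ} {g : ℕ → B0 (Fin n → T) ℂ} {g' : B0 (Fin n → T) ℂ}
    (h : BoundedConv g g') :
    Tendsto (fun j => toParticle σ n (g j)) atTop (𝓝 (toParticle σ n g')) := by
  obtain ⟨C, K, hK, hC, hgK, hlim⟩ := h
  have hnorm : ∀ f : B0 (Fin n → T) ℂ, ‖toParticle σ n f‖ ^ 2 =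
      ∫ t, ‖f.1 t‖ ^ 2 ∂(Measure.pi fun _ : Fin n => σ) := fun f => by
    rw [← inner_self_eq_norm_sq (𝕜 := ℂ), L2.inner_def, ← integral_re (L2.integrable_inner _ _)]
    refine integral_congr_ae ?_
    filter_upwards [coeFn_toParticle (σ := σ) f] with t ht
    rw [ht, inner_self_eq_norm_sq]
  have h' : ∀ t, ‖g'.1 t‖ ≤ C := fun t =>
    le_of_tendsto (hlim t).norm (Eventually.of_forall fun j => hC j t)
  have hK' : ∀ t ∉ K, g'.1 t = 0 := fun t ht =>
    tendsto_nhds_unique (hlim t) (by simp [hgK _ t ht])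
  rw [tendsto_iff_norm_sub_tendsto_zero]
  have hsq : Tendsto (fun j => ‖toParticle σ n (g j) - toParticle σ n g'‖ ^ 2) atTop (𝓝 0) := by
    simp only [← map_sub, hnorm]
    rw [← integral_zero (Fin n → T) ℝ (μ := Measure.pi fun _ : Fin n => σ)]
    refine tendsto_integral_of_dominated_convergence (K.indicator fun _ => (C + C) ^ 2)
      (fun j => ((g j - g').2.1.norm.pow_const 2).aestronglyMeasurable) ?_
      (fun j => ae_of_all _ fun t => ?_) (ae_of_all _ fun t => ?_)
    · exact (integrable_indicator_iff hK.measurableSet).2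
        (integrableOn_const hK.measure_lt_top.ne)
    · change ‖‖(g j).1 t - g'.1 t‖ ^ 2‖ ≤ _
      by_cases ht : t ∈ K
      · rw [Set.indicator_of_mem ht, norm_pow, norm_norm]
        exact pow_le_pow_left₀ (norm_nonneg _)
          ((norm_sub_le _ _).trans (add_le_add (hC j t) (h' t))) 2
      · rw [Set.indicator_of_notMem ht, hgK j t ht, hK' t ht]
        simp
    · have := ((hlim t).sub_const (g'.1 t)).norm.pow 2
      rw [sub_self, norm_zero, zero_pow two_ne_zero] at this
      exact this
  have := hsq.sqrt
  simpa [Real.sqrt_sq] using this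

/-- The integrand defining `MarkedPartition.reduceFun`. -/
def reduceIntegrand {n : ℕ} (V : MarkedPartition n) (f : B0 (Fin n → T) ℂ)
    (s : Fin V.kept.card → T) : B0 (V.NegBlock → T) ℂ :=
  ⟨fun u => f.1 (V.expand s u) * V.q S (V.expand s u), by
    have := (Enumeration.ofMarkedPartition V).integrand_mem_B0 S f s
    simpa only [Enumeration.expand_ofMarkedPartition, V.q_toBlockData] using this⟩

lemma reduce_apply {n : ℕ} (V : MarkedPartition n) (f : B0 (Fin n → T) ℂ)
    (s : Fin V.kept.card → T) : (V.reduce S lam f).1 s =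
      V.coeff lam * ∫ u, (reduceIntegrand S V f s).1 u ∂(Measure.pi fun _ : V.NegBlock => σ) := rfl

lemma integrable_reduceIntegrand {n : ℕ} (V : MarkedPartition n) (f : B0 (Fin n → T) ℂ)
    (s : Fin V.kept.card → T) :
    Integrable (reduceIntegrand S V f s).1 (Measure.pi fun _ : V.NegBlock => σ) :=
  memLp_one_iff_integrable.1 (memLp_of_mem_B0 _ 1 _)

lemma reduce_add {n : ℕ} (V : MarkedPartition n) (f g : B0 (Fin n → T) ℂ) :
    V.reduce S lam (f + g) = V.reduce S lam f + V.reduce S lam g := by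
  refine Subtype.ext (funext fun s => ?_)
  change _ = (V.reduce S lam f).1 s + (V.reduce S lam g).1 s
  rw [reduce_apply, reduce_apply, reduce_apply, ← mul_add,
    ← integral_add (integrable_reduceIntegrand S V f s) (integrable_reduceIntegrand S V g s)]
  congr 1
  exact integral_congr_ae (ae_of_all _ fun u => add_mul _ _ _)

lemma reduce_smul {n : ℕ} (V : MarkedPartition n) (c : ℂ) (f : B0 (Fin n → T) ℂ) :
    V.reduce S lam (c • f) = c • V.reduce S lam f := by
  refine Subtype.ext (funext fun s => ?_)
  change _ = c * (V.reduce S lam f).1 s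
  have h : ∀ u, (reduceIntegrand S V (c • f) s).1 u = c * (reduceIntegrand S V f s).1 u :=
    fun u => mul_assoc c (f.1 (V.expand s u)) _
  rw [reduce_apply, reduce_apply]
  simp only [h, integral_const_mul]
  ring

lemma wickVector_add {n : ℕ} (f g : B0 (Fin n → T) ℂ) :
    wickVector S lam (f + g) = wickVector S lam f + wickVector S lam g := by
  simp only [wickVector, fockTerm, reduce_add, map_add, Finset.sum_add_distrib]

lemma wickVector_smul {n : ℕ} (c : ℂ) (f : B0 (Fin n → T) ℂ) :
    wickVector S lam (c • f) = c • wickVector S lam f := by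
  simp only [wickVector, fockTerm, reduce_smul, map_smul, Finset.smul_sum]

/-- The maxima of the blocks recover the variables s and u from a point of the expanded diagonal.
The supports in s and in u therefore lie in coordinate images of K, and dominated convergence
applies for each s. -/
lemma BoundedConv.reduce {n : ℕ} (V : MarkedPartition n) {g : ℕ → B0 (Fin n → T) ℂ}
    {g' : B0 (Fin n → T) ℂ} (h : BoundedConv g g') :
    BoundedConv (fun j => V.reduce S lam (g j)) (V.reduce S lam g') := by
  obtain ⟨C, K, hK, hC, hgK, hlim⟩ := h
  let KN : Set (V.NegBlock → T) := (fun t B => t (V.max B.1)) '' K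
  have hKN : IsCompact KN := hK.image (continuous_pi fun B => continuous_apply _)
  have hN : ∀ s j, ∀ u ∉ KN, (reduceIntegrand S V (g j) s).1 u = 0 := fun s j u hu => by
    change (g j).1 (V.expand s u) * V.q S (V.expand s u) = 0
    rw [hgK j _ fun h => hu ⟨_, h, funext fun B => V.expand_max_neg s u B⟩, zero_mul]
  have hb : ∀ s j u, ‖(reduceIntegrand S V (g j) s).1 u‖ ≤ C := fun s j u => by
    change ‖(g j).1 (V.expand s u) * V.q S (V.expand s u)‖ ≤ C
    rw [norm_mul, V.norm_q, mul_one]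
    exact hC _ _
  let KP : Set (Fin V.kept.card → T) := (fun t j => t (V.kept.orderIsoOfFin rfl j)) '' K
  refine ⟨‖V.coeff lam‖ * (C * (Measure.pi fun _ : V.NegBlock => σ).real KN), KP,
    hK.image (continuous_pi fun B => continuous_apply _), fun j s => ?_, fun j s hs => ?_,
    fun s => ?_⟩
  · rw [reduce_apply, norm_mul]
    refine mul_le_mul_of_nonneg_left ?_ (norm_nonneg _)
    rw [← setIntegral_eq_integral_of_forall_compl_eq_zero (s := KN) (hN s j)]
    exact norm_setIntegral_le_of_norm_le_const hKN.measure_lt_top fun u _ => hb s j u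
  · have : ∀ u, (reduceIntegrand S V (g j) s).1 u = 0 := fun u => by
      change (g j).1 (V.expand s u) * V.q S (V.expand s u) = 0
      rw [hgK j _ fun h => hs ⟨_, h, funext fun i => V.expand_kept s u i⟩, zero_mul]
    rw [reduce_apply]
    simp [this]
  · refine Tendsto.const_mul _ (BoundedConv.tendsto_integral
      (g := fun j => reduceIntegrand S V (g j) s)
      (g' := reduceIntegrand S V g' s) ⟨C, KN, hKN, hb s, hN s, fun u => ?_⟩)
    exact (hlim _).mul_const _

lemma BoundedConv.tendsto_fockB0 {n : ℕ} {g : ℕ → B0 (Fin n → T) ℂ} {g' : B0 (Fin n → T) ℂ}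
    (h : BoundedConv g g') (m : ℕ) :
    Tendsto (fun j => fockB0 S n (g j) m) atTop (𝓝 (fockB0 S n g' m)) := by
  rcases eq_or_ne n m with rfl | hne
  · simp only [fockB0_apply, DirectSum.lof_apply]
    exact ((toQSym S n).continuous.tendsto _).comp h.tendsto_toParticle
  · have : ∀ f : B0 (Fin n → T) ℂ, fockB0 S n f m = 0 := fun f =>
      DFinsupp.single_eq_of_ne hne.symm
    simp [this]

lemma BoundedConv.tendsto_wickVector {n : ℕ} {g : ℕ → B0 (Fin n → T) ℂ} {g' : B0 (Fin n → T) ℂ}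
    (h : BoundedConv g g') (m : ℕ) :
    Tendsto (fun j => wickVector S lam (g j) m) atTop (𝓝 (wickVector S lam g' m)) := by
  simp only [wickVector, DirectSum.sum_apply]
  exact tendsto_finsetSum _ fun V _ => (h.reduce S lam V).tendsto_fockB0 S m

lemma fockB0_eq_zero {n m : ℕ} (hne : m ≠ n) (f : B0 (Fin n → T) ℂ) : fockB0 S n f m = 0 :=
  DFinsupp.single_eq_of_ne hne

/-- At most n indices are kept, so no term has degree above n. -/
lemma wickVector_eq_zero {n m : ℕ} (h : n < m) (f : B0 (Fin n → T) ℂ) :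
    wickVector S lam f m = 0 := by
  simp only [wickVector, DirectSum.sum_apply]
  refine Finset.sum_eq_zero fun V _ => fockB0_eq_zero S ?_ _
  have := card_finset_fin_le V.kept
  omega

end

/-! ### A monotone class argument for B₀ -/

section MonotoneClass

variable {T : Type*} [TopologicalSpace T] [T2Space T] [SecondCountableTopology T]
  [MeasurableSpace T] [BorelSpace T]

lemma indicator_mem_B0 {X : Type*} [TopologicalSpace X] [T2Space X] [MeasurableSpace X]
    (𝕜 : Type*) [RCLike 𝕜] {K : Set X} (hK : IsCompact K) {E : Set X} (hE : MeasurableSet E)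
    (hEK : E ⊆ K) : (E.indicator fun _ => (1 : 𝕜)) ∈ B0 X 𝕜 := by
  refine ⟨measurable_const.indicator hE, ⟨1, fun x => ?_⟩, ?_⟩
  · refine (norm_indicator_le_norm_self _ _).trans ?_
    simp
  · refine HasCompactSupport.of_support_subset_isCompact hK fun x hx => hEK ?_
    by_contra h
    exact hx (Set.indicator_of_notMem h _)

/-- A subspace of `B₀(Tⁿ → ℂ)` which contains the tensor products and is closed under bounded
pointwise convergence is the whole space. -/
lemma B0_induction {n : ℕ} (M : Submodule ℂ (B0 (Fin n → T) ℂ))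
    (htensor : ∀ (f : Fin n → B0 T ℝ) (g : B0 (Fin n → T) ℂ),
      (∀ t, g.1 t = ∏ i, ((f i).1 (t i) : ℂ)) → g ∈ M)
    (hlim : ∀ (g : ℕ → B0 (Fin n → T) ℂ) (g' : B0 (Fin n → T) ℂ), BoundedConv g g' →
      (∀ j, g j ∈ M) → g' ∈ M) (f : B0 (Fin n → T) ℂ) : f ∈ M := by
  classical
  obtain ⟨hf, ⟨C, hC⟩, hs⟩ := f.2
  let K : Set T := ⋃ i : Fin n, (fun t : Fin n → T => t i) '' tsupport f.1
  have hK : IsCompact K := isCompact_iUnion fun i => hs.isCompact.image (continuous_apply i)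
  let KN : Set (Fin n → T) := Set.univ.pi fun _ => K
  have hKN : IsCompact KN := isCompact_univ_pi fun _ => hK
  have hfK : ∀ t ∉ KN, f.1 t = 0 := fun t ht => by
    by_contra hne
    exact ht fun i _ => Set.mem_iUnion.2 ⟨i, t, subset_tsupport _ hne, rfl⟩
  -- Cutting with a compact cube KN containing the support puts all indicators into B₀ and keeps
  -- rectangles rectangular.
  have hind : ∀ E : Set (Fin n → T), MeasurableSet E → ((E ∩ KN).indicator fun _ => (1 : ℂ)) ∈
      B0 (Fin n → T) ℂ := fun E hE =>
    indicator_mem_B0 ℂ hKN (hE.inter hKN.measurableSet) Set.inter_subset_right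
  have hindM : ∀ (E : Set (Fin n → T)) (hE : MeasurableSet E),
      (⟨_, hind E hE⟩ : B0 (Fin n → T) ℂ) ∈ M := by
    have hrect : ∀ s : Fin n → Set T, (∀ i, MeasurableSet (s i)) →
        ∀ hE : MeasurableSet (Set.univ.pi s), (⟨_, hind _ hE⟩ : B0 (Fin n → T) ℂ) ∈ M := by
      intro s hs hE
      refine htensor (fun i => ⟨_, indicator_mem_B0 ℝ hK ((hs i).inter hK.measurableSet)
        Set.inter_subset_right⟩) _ fun t => ?_
      change (Set.univ.pi s ∩ KN).indicator (fun _ => (1 : ℂ)) t =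
        ∏ i, (((s i ∩ K).indicator (fun _ => (1 : ℝ)) (t i) : ℝ) : ℂ)
      by_cases ht : ∀ i, t i ∈ s i ∩ K
      · rw [Set.indicator_of_mem (show t ∈ Set.univ.pi s ∩ KN from
          ⟨fun i _ => (ht i).1, fun i _ => (ht i).2⟩)]
        refine (Finset.prod_eq_one fun i _ => ?_).symm
        rw [Set.indicator_of_mem (ht i), Complex.ofReal_one]
      · rw [Set.indicator_of_notMem fun h => ht fun i =>
          ⟨h.1 i (Set.mem_univ i), h.2 i (Set.mem_univ i)⟩]
        obtain ⟨i, hi⟩ := not_forall.1 ht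
        refine (Finset.prod_eq_zero (Finset.mem_univ i) ?_).symm
        rw [Set.indicator_of_notMem hi, Complex.ofReal_zero]
    have huniv : (⟨_, hind _ MeasurableSet.univ⟩ : B0 (Fin n → T) ℂ) ∈ M := by
      have := hrect (fun _ => Set.univ) (fun _ => MeasurableSet.univ) (by simp)
      simpa only [Set.pi_univ] using this
    intro E hE
    -- Dynkin's π-λ theorem, with the measurable rectangles as the generating π-system.
    induction E, hE using MeasurableSpace.induction_on_inter
      (s := Set.pi Set.univ '' Set.pi Set.univ fun _ : Fin n => {s : Set T | MeasurableSet s})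
      generateFrom_pi.symm isPiSystem_pi with
    | empty =>
      convert M.zero_mem
      simp only [Set.empty_inter, Set.indicator_empty]
      rfl
    | basic E hE =>
      obtain ⟨s, hs, rfl⟩ := hE
      exact hrect s (fun i => hs i (Set.mem_univ i))
        (MeasurableSet.univ_pi fun i => hs i (Set.mem_univ i))
    | compl E hE ih =>
      convert M.sub_mem huniv ih
      funext t
      change _ = (Set.univ ∩ KN).indicator (fun _ => (1 : ℂ)) t -
        (E ∩ KN).indicator (fun _ => (1 : ℂ)) t
      by_cases h1 : t ∈ KN <;> by_cases h2 : t ∈ E <;> simp [h1, h2]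
    | iUnion E hd hE ih =>
      refine hlim (fun N => ∑ i ∈ Finset.range N, ⟨_, hind (E i) (hE i)⟩) _ ?_
        fun N => M.sum_mem fun i _ => ih i
      -- By disjointness the partial sums are indicators of partial unions, hence bounded by 1.
      have hval : ∀ N t, (∑ i ∈ Finset.range N, (⟨_, hind (E i) (hE i)⟩ : B0 (Fin n → T) ℂ)).1 t =
          ((⋃ i ∈ Finset.range N, E i) ∩ KN).indicator (fun _ => (1 : ℂ)) t := fun N t => by
        have h1 : (∑ i ∈ Finset.range N, (⟨_, hind (E i) (hE i)⟩ : B0 (Fin n → T) ℂ)).1 t =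
            ∑ i ∈ Finset.range N, (E i ∩ KN).indicator (fun _ => (1 : ℂ)) t := by
          rw [Submodule.coe_sum, Finset.sum_apply]
        rw [h1]
        by_cases h : ∃ i ∈ Finset.range N, t ∈ E i ∩ KN
        · obtain ⟨i, hi, hti⟩ := h
          rw [Set.indicator_of_mem (show t ∈ (⋃ i ∈ Finset.range N, E i) ∩ KN from
              ⟨Set.mem_biUnion (Finset.mem_coe.2 hi) hti.1, hti.2⟩),
            Finset.sum_eq_single_of_mem i hi fun j _ hj => ?_, Set.indicator_of_mem hti]
          exact Set.indicator_of_notMem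
            (fun h => Set.disjoint_left.1 (hd hj) h.1 hti.1) _
        · push Not at h
          rw [Finset.sum_eq_zero fun i hi => Set.indicator_of_notMem (h i hi) _,
            Set.indicator_of_notMem]
          rintro ⟨h1, h2⟩
          obtain ⟨i, hi, hti⟩ := Set.mem_iUnion₂.1 h1
          exact h i hi ⟨hti, h2⟩
      refine ⟨1, KN, hKN, fun N t => ?_, fun N t ht => ?_, fun t => ?_⟩
      · rw [hval]
        refine (norm_indicator_le_norm_self _ _).trans ?_
        simp
      · rw [hval, Set.indicator_of_notMem fun h => ht h.2]
      · simp only [hval]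
        change Tendsto _ atTop (𝓝 (((⋃ i, E i) ∩ KN).indicator (fun _ => (1 : ℂ)) t))
        refine tendsto_const_nhds.congr' ?_
        by_cases h : t ∈ (⋃ i, E i) ∩ KN
        · obtain ⟨i, hi⟩ := Set.mem_iUnion.1 h.1
          filter_upwards [eventually_gt_atTop i] with N hN
          rw [Set.indicator_of_mem h, Set.indicator_of_mem
            (show t ∈ (⋃ i ∈ Finset.range N, E i) ∩ KN from
              ⟨Set.mem_biUnion (Finset.mem_coe.2 (Finset.mem_range.2 hN)) hi, h.2⟩)]
        · refine Eventually.of_forall fun N => ?_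
          dsimp only
          rw [Set.indicator_of_notMem h, Set.indicator_of_notMem]
          rintro ⟨h1, h2⟩
          obtain ⟨i, _, hi⟩ := Set.mem_iUnion₂.1 h1
          exact h ⟨Set.mem_iUnion.2 ⟨i, hi⟩, h2⟩
  have hsimple : ∀ φ : SimpleFunc (Fin n → T) ℂ,
      ∃ g ∈ M, ∀ t, g.1 t = KN.indicator φ t := by
    intro φ
    refine ⟨∑ c ∈ φ.range, c • ⟨_, hind (φ ⁻¹' {c}) (φ.measurableSet_preimage _)⟩,
      M.sum_mem fun c _ => M.smul_mem c (hindM _ (φ.measurableSet_preimage _)), fun t => ?_⟩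
    rw [Submodule.coe_sum, Finset.sum_apply]
    change ∑ c ∈ φ.range, c * (φ ⁻¹' {c} ∩ KN).indicator (fun _ => (1 : ℂ)) t = _
    by_cases ht : t ∈ KN
    · rw [Set.indicator_of_mem ht, Finset.sum_eq_single_of_mem (φ t) (φ.mem_range_self t),
        Set.indicator_of_mem (show t ∈ φ ⁻¹' {φ t} ∩ KN from ⟨rfl, ht⟩), mul_one]
      intro c _ hc
      rw [Set.indicator_of_notMem fun h => hc h.1.symm, mul_zero]
    · rw [Set.indicator_of_notMem ht]
      refine Finset.sum_eq_zero fun c _ => ?_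
      rw [Set.indicator_of_notMem fun h => ht h.2, mul_zero]
  have hfs : StronglyMeasurable f.1 := hf.stronglyMeasurable
  -- The bounded simple approximation is used with a nonnegative bound, hence the maximum with 0.
  choose g hgM hg using fun j => hsimple (hfs.approxBounded (max C 0) j)
  have hC0 : (0 : ℝ) ≤ max C 0 := le_max_right _ _
  refine hlim g f ⟨max C 0, KN, hKN, fun j t => ?_, fun j t ht => ?_, fun t => ?_⟩ hgM
  · rw [hg]
    exact (norm_indicator_le_norm_self _ _).trans (hfs.norm_approxBounded_le hC0 j t)
  · rw [hg, Set.indicator_of_notMem ht]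
  · simp only [hg]
    by_cases ht : t ∈ KN
    · simp only [Set.indicator_of_mem ht]
      exact hfs.tendsto_approxBounded_of_norm_le ((hC t).trans (le_max_left _ _))
    · simp only [Set.indicator_of_notMem ht, hfK t ht]
      exact tendsto_const_nhds

end MonotoneClass

/-! ### Fock space components of elements of L²(τ) -/

section Components

variable {T : Type*} [TopologicalSpace T] [T2Space T] [SecondCountableTopology T]
  [MeasurableSpace T] [BorelSpace T] {σ : Measure T} [IsLocallyFiniteMeasure σ]
  (S : Statistics σ) (lam : ℝ)

lemma fockInner_eq_sum {N : ℕ} {F : FockFin S} (hF : ∀ m, N < m → F m = 0) (G : FockFin S) :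
    fockInner S F G = ∑ m ∈ Finset.range (N + 1), (m.factorial : ℂ) * inner ℂ (F m) (G m) := by
  refine finsum_eq_sum_of_support_subset _ fun m hm => ?_
  by_contra hne
  apply hm
  have : F m = 0 := hF m (by
    simp only [Finset.coe_range, Set.mem_Iio] at hne
    omega)
  simp [this]

/-- All terms of the Fock norm are nonnegative and m! ≥ 1. The estimate makes the component map a
contraction, so that it extends to the completion. -/
lemma norm_component_le (F : FockFin S) (m : ℕ) : ‖F m‖ ^ 2 ≤ (fockInner S F F).re := by
  have h := Complex.reLm.toAddMonoidHom.map_finsum (hasFiniteSupport_fockInner S F F)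
  have hre : ∀ k : ℕ, ((k.factorial : ℂ) * inner ℂ (F k) (F k)).re = k.factorial * ‖F k‖ ^ 2 :=
    fun k => by
      rw [← Complex.ofReal_natCast, Complex.re_ofReal_mul]
      congr 1
      exact inner_self_eq_norm_sq (𝕜 := ℂ) (F k)
  have h2 : (fockInner S F F).re = ∑ᶠ k : ℕ, ((k.factorial : ℂ) * inner ℂ (F k) (F k)).re := h
  rw [h2]
  refine le_trans ?_ (single_le_finsum m ?_ fun k => ?_)
  · rw [hre]
    exact le_mul_of_one_le_left (sq_nonneg _) (by exact_mod_cast m.factorial_pos)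
  · refine (hasFiniteSupport_fockInner S F F).subset fun k hk => ?_
    intro h0
    apply hk
    simp only at h0 ⊢
    rw [h0, Complex.zero_re]
  · rw [hre]
    positivity

/-- The linear map `p ↦ (pΩ)⁽ᵐ⁾`. -/
def polyComponent (m : ℕ) : PreL2 S lam →L[ℂ] QSym S m :=
  LinearMap.mkContinuous
    { toFun := fun p => (p.1 (vacuum S)) m
      map_add' := fun _ _ => rfl
      map_smul' := fun _ _ => rfl } 1 fun p => by
    have h : ‖p‖ ^ 2 = (fockInner S (p.1 (vacuum S)) (p.1 (vacuum S))).re :=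
      (inner_self_eq_norm_sq (𝕜 := ℂ) p).symm
    rw [one_mul]
    exact (sq_le_sq₀ (norm_nonneg _) (norm_nonneg _)).1 ((norm_component_le S _ m).trans h.ge)

/-- The continuous linear map `L²(τ) → P_m L²(Tᵐ)` extending `p ↦ (pΩ)⁽ᵐ⁾`. -/
def component (m : ℕ) : L2tau S lam →L[ℂ] QSym S m :=
  (polyComponent S lam m).extend (UniformSpace.Completion.toComplL (𝕜 := ℂ) (E := PreL2 S lam))

lemma component_toL2tau (m : ℕ) (p : polyAlg S lam) :
    component S lam m (toL2tau S lam p) = (p.1 (vacuum S)) m :=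
  ContinuousLinearMap.extend_eq (polyComponent S lam m)
    (e := UniformSpace.Completion.toComplL (𝕜 := ℂ) (E := PreL2 S lam))
    UniformSpace.Completion.denseRange_coe (UniformSpace.Completion.isUniformInducing_coe _) p

lemma component_polyDeg {n : ℕ} {p : polyAlg S lam} (hp : p ∈ polyDeg S lam n) {m : ℕ}
    (hm : n < m) : (p.1 (vacuum S)) m = 0 := by
  induction hp using Submodule.span_induction with
  | mem p hp =>
    obtain ⟨k, hk, f, rfl⟩ := hp
    rw [monomial_vacuum S lam f ⟨_, prod_mem_B0 f⟩ fun t => rfl]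
    exact wickVector_eq_zero S lam (hk.trans_lt hm) _
  | zero => rfl
  | add p q _ _ hp hq => exact (congrArg₂ (· + ·) hp hq).trans (add_zero 0)
  | smul c p _ hp => exact (congrArg (c • ·) hp).trans (smul_zero c)

/-- For polynomials this is the definition of the scalar product, the sum being finite because a
polynomial of degree ≤ n has no component above n. Both sides are continuous in (x, y), so the
identity passes to the closure. -/
lemma inner_MP {n : ℕ} {x : L2tau S lam} (hx : x ∈ MP S lam n) (y : L2tau S lam) :
    inner ℂ x y = ∑ m ∈ Finset.range (n + 1),
      (m.factorial : ℂ) * inner ℂ (component S lam m x) (component S lam m y) := by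
  have hcl : IsClosed {z : L2tau S lam × L2tau S lam | inner ℂ z.1 z.2 = ∑ m ∈ Finset.range (n + 1),
      (m.factorial : ℂ) * inner ℂ (component S lam m z.1) (component S lam m z.2)} := by
    exact isClosed_eq (continuous_fst.inner continuous_snd) (continuous_finsetSum _ fun m _ =>
      continuous_const.mul (((component S lam m).continuous.comp continuous_fst).inner
        ((component S lam m).continuous.comp continuous_snd)))
  have hy : y ∈ closure (Set.range (toL2tau S lam)) :=
    UniformSpace.Completion.denseRange_coe (α := PreL2 S lam) y
  have h : (x, y) ∈ closure (((polyDeg S lam n).map (toL2tau S lam) : Set (L2tau S lam)) ×ˢ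
      Set.range (toL2tau S lam)) := by
    rw [closure_prod_eq]
    exact ⟨hx, hy⟩
  refine closure_minimal (t := {z : L2tau S lam × L2tau S lam | inner ℂ z.1 z.2 =
    ∑ m ∈ Finset.range (n + 1), (m.factorial : ℂ) *
      inner ℂ (component S lam m z.1) (component S lam m z.2)}) ?_ hcl h
  rintro ⟨_, _⟩ ⟨⟨p, hp, rfl⟩, ⟨q, rfl⟩⟩
  simp only [Set.mem_ofPred_eq, component_toL2tau]
  exact (UniformSpace.Completion.inner_coe (𝕜 := ℂ) (E := PreL2 S lam) p q).trans
    (fockInner_eq_sum S (fun m hm => component_polyDeg S lam hp hm) _)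

lemma eq_of_component_eq {n : ℕ} {x y : L2tau S lam} (hx : x ∈ MP S lam n) (hy : y ∈ MP S lam n)
    (h : ∀ m, component S lam m x = component S lam m y) : x = y := by
  rw [← sub_eq_zero, ← inner_self_eq_zero (𝕜 := ℂ), inner_MP S lam (Submodule.sub_mem _ hx hy)]
  refine Finset.sum_eq_zero fun m _ => ?_
  rw [map_sub, h, sub_self, inner_zero_left, mul_zero]

end Components

/-! ### Smeared products, their uniqueness, and the Wick products -/

section Smearing

variable {T : Type*} [TopologicalSpace T] [T2Space T] [SecondCountableTopology T]
  [MeasurableSpace T] [BorelSpace T] {σ : Measure T} [IsLocallyFiniteMeasure σ]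
  (S : Statistics σ) (lam : ℝ)

lemma isClosed_MP (n : ℕ) : IsClosed (MP S lam n : Set (L2tau S lam)) :=
  Submodule.isClosed_topologicalClosure _

lemma MP_mono {k n : ℕ} (h : k ≤ n) : MP S lam k ≤ MP S lam n := by
  refine Submodule.topologicalClosure_mono (Submodule.map_mono (Submodule.span_mono ?_))
  rintro p ⟨l, hl, f, rfl⟩
  exact ⟨l, hl.trans h, f, rfl⟩

lemma toL2tau_monomial_mem_MP {n : ℕ} (f : Fin n → B0 T ℝ) :
    toL2tau S lam (monomial S lam f) ∈ MP S lam n :=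
  Submodule.le_topologicalClosure _
    (Submodule.mem_map_of_mem (Submodule.subset_span ⟨n, le_rfl, f, rfl⟩))

lemma norm_sq_MP {n : ℕ} {x : L2tau S lam} (hx : x ∈ MP S lam n) :
    ‖x‖ ^ 2 = ∑ m ∈ Finset.range (n + 1), (m.factorial : ℝ) * ‖component S lam m x‖ ^ 2 := by
  rw [← inner_self_eq_norm_sq (𝕜 := ℂ), inner_MP S lam hx, map_sum]
  refine Finset.sum_congr rfl fun m _ => ?_
  rw [← inner_self_eq_norm_sq (𝕜 := ℂ)]
  change ((m.factorial : ℂ) * _).re = _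
  rw [← Complex.ofReal_natCast, Complex.re_ofReal_mul]
  rfl

/-- On MP⁽ⁿ⁾ the norm is a finite weighted sum of component norms. Both arguments are allowed to
vary so that the statement also detects Cauchy sequences. -/
lemma tendsto_MP_of_component {ι : Type*} {l : Filter ι} {n : ℕ} {x : ι → L2tau S lam}
    {y : ι → L2tau S lam} (hx : ∀ i, x i ∈ MP S lam n) (hy : ∀ i, y i ∈ MP S lam n)
    (h : ∀ m, Tendsto (fun i => dist (component S lam m (x i)) (component S lam m (y i))) l (𝓝 0)) :
    Tendsto (fun i => dist (x i) (y i)) l (𝓝 0) := by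
  have hsq : Tendsto (fun i => ‖x i - y i‖ ^ 2) l (𝓝 0) := by
    have h0 : (0 : ℝ) = ∑ m ∈ Finset.range (n + 1), (m.factorial : ℝ) * 0 ^ 2 := by simp
    simp only [fun i => norm_sq_MP S lam (Submodule.sub_mem _ (hx i) (hy i)), map_sub]
    rw [h0]
    refine tendsto_finsetSum _ fun m _ => Tendsto.const_mul _ (Tendsto.pow ?_ 2)
    simpa only [dist_eq_norm] using h m
  have := hsq.sqrt
  simpa [Real.sqrt_sq, dist_eq_norm] using this

/-- `x = ⟨f, ω^{⊗n}⟩`. -/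
def IsWickVector {n : ℕ} (f : B0 (Fin n → T) ℂ) (x : L2tau S lam) : Prop :=
  x ∈ MP S lam n ∧ ∀ m, component S lam m x = wickVector S lam f m

variable {S lam}

lemma IsWickVector.eq {n : ℕ} {f : B0 (Fin n → T) ℂ} {x y : L2tau S lam}
    (hx : IsWickVector S lam f x) (hy : IsWickVector S lam f y) : x = y :=
  eq_of_component_eq S lam hx.1 hy.1 fun m => (hx.2 m).trans (hy.2 m).symm

lemma IsWickVector.add {n : ℕ} {f g : B0 (Fin n → T) ℂ} {x y : L2tau S lam}
    (hx : IsWickVector S lam f x) (hy : IsWickVector S lam g y) :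
    IsWickVector S lam (f + g) (x + y) :=
  ⟨Submodule.add_mem _ hx.1 hy.1, fun m => by
    rw [map_add, hx.2, hy.2, wickVector_add, DirectSum.add_apply]⟩

lemma IsWickVector.smul {n : ℕ} {f : B0 (Fin n → T) ℂ} {x : L2tau S lam} (c : ℂ)
    (hx : IsWickVector S lam f x) : IsWickVector S lam (c • f) (c • x) :=
  ⟨Submodule.smul_mem _ c hx.1, fun m => by
    rw [map_smul, hx.2, wickVector_smul, DirectSum.smul_apply]⟩

lemma isWickVector_monomial {n : ℕ} (f : Fin n → B0 T ℝ) (g : B0 (Fin n → T) ℂ)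
    (hg : ∀ t, g.1 t = ∏ i, ((f i).1 (t i) : ℂ)) :
    IsWickVector S lam g (toL2tau S lam (monomial S lam f)) :=
  ⟨toL2tau_monomial_mem_MP S lam f, fun m => by
    rw [component_toL2tau, monomial_vacuum S lam f g hg]⟩

lemma IsWickVector.of_tendsto {n : ℕ} {g : ℕ → B0 (Fin n → T) ℂ} {g' : B0 (Fin n → T) ℂ}
    (h : BoundedConv g g') {x : ℕ → L2tau S lam} {x' : L2tau S lam}
    (hx : ∀ j, IsWickVector S lam (g j) (x j)) (hlim : Tendsto x atTop (𝓝 x')) :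
    IsWickVector S lam g' x' := by
  refine ⟨(isClosed_MP S lam n).mem_of_tendsto hlim (Eventually.of_forall fun j => (hx j).1),
    fun m => tendsto_nhds_unique (((component S lam m).continuous.tendsto _).comp hlim) ?_⟩
  refine (h.tendsto_wickVector S lam m).congr fun j => ?_
  exact ((hx j).2 m).symm

lemma IsWickVector.tendsto {n : ℕ} {g : ℕ → B0 (Fin n → T) ℂ} {g' : B0 (Fin n → T) ℂ}
    (h : BoundedConv g g') {x : ℕ → L2tau S lam} {x' : L2tau S lam}
    (hx : ∀ j, IsWickVector S lam (g j) (x j)) (hx' : IsWickVector S lam g' x') :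
    Tendsto x atTop (𝓝 x') := by
  rw [tendsto_iff_dist_tendsto_zero]
  refine tendsto_MP_of_component S lam (fun j => (hx j).1) (fun _ => hx'.1) fun m => ?_
  simp only [(hx _).2, hx'.2]
  exact tendsto_iff_dist_tendsto_zero.1 (h.tendsto_wickVector S lam m)

/-- The functions that have such an element form a subspace containing the tensor products. Under
bounded convergence the components converge, so the elements form a Cauchy sequence in MP⁽ⁿ⁾ and
completeness supplies the limit. -/
lemma exists_isWickVector {n : ℕ} (f : B0 (Fin n → T) ℂ) : ∃ x, IsWickVector S lam f x := by
  let M : Submodule ℂ (B0 (Fin n → T) ℂ) :=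
    { carrier := {f | ∃ x, IsWickVector S lam f x}
      add_mem' := fun ⟨x, hx⟩ ⟨y, hy⟩ => ⟨x + y, hx.add hy⟩
      zero_mem' := ⟨0, Submodule.zero_mem _, fun m => by
        have : wickVector S lam (0 : B0 (Fin n → T) ℂ) = 0 := by
          simpa using wickVector_smul S lam (0 : ℂ) (0 : B0 (Fin n → T) ℂ)
        rw [map_zero, this]
        rfl⟩
      smul_mem' := fun c _ ⟨x, hx⟩ => ⟨c • x, hx.smul c⟩ }
  refine B0_induction M (fun f g hg => ⟨_, isWickVector_monomial f g hg⟩)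
    (fun g g' hg hM => ?_) f
  choose x hx using hM
  have hc : CauchySeq x := by
    rw [cauchySeq_iff_tendsto_dist_atTop_0]
    refine tendsto_MP_of_component S lam (fun p => (hx p.1).1) (fun p => (hx p.2).1) fun m => ?_
    simp only [(hx _).2]
    exact cauchySeq_iff_tendsto_dist_atTop_0.1 (hg.tendsto_wickVector S lam m).cauchySeq
  obtain ⟨x', hx'⟩ := cauchySeq_tendsto_of_complete hc
  exact ⟨x', IsWickVector.of_tendsto hg hx hx'⟩

/-- The same monotone class argument applies to a given X, with its assumed continuity replacing
completeness. Uniqueness of the smearing follows through `IsWickVector.eq`. -/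
lemma IsSmearing.isWickVector {n : ℕ} {X : B0 (Fin n → T) ℂ →ₗ[ℂ] L2tau S lam}
    (hX : IsSmearing S lam n X) (f : B0 (Fin n → T) ℂ) : IsWickVector S lam f (X f) := by
  let M : Submodule ℂ (B0 (Fin n → T) ℂ) :=
    { carrier := {f | IsWickVector S lam f (X f)}
      add_mem' := fun {f g} hf hg => by
        change IsWickVector S lam (f + g) (X (f + g))
        rw [map_add]
        exact IsWickVector.add hf hg
      zero_mem' := by
        obtain ⟨x, hx⟩ := exists_isWickVector (S := S) (lam := lam) (0 : B0 (Fin n → T) ℂ)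
        have := hx.smul 0
        rwa [zero_smul, zero_smul, ← map_zero X] at this
      smul_mem' := fun c f hf => by
        change IsWickVector S lam (c • f) (X (c • f))
        rw [map_smul]
        exact IsWickVector.smul c hf }
  refine B0_induction M (fun f g hg => ?_) (fun g g' hg hM => ?_) f
  · change IsWickVector S lam g (X g)
    rw [hX.map_tensor f g hg]
    exact isWickVector_monomial f g hg
  · obtain ⟨C, K, hK, h1, h2, h3⟩ := hg
    exact IsWickVector.of_tendsto ⟨C, K, hK, h1, h2, h3⟩ hM (hX.continuous g g' C K hK h1 h2 h3)

lemma exists_isSmearing (n : ℕ) :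
    ∃ X : B0 (Fin n → T) ℂ →ₗ[ℂ] L2tau S lam, IsSmearing S lam n X := by
  choose x hx using fun f : B0 (Fin n → T) ℂ => exists_isWickVector (S := S) (lam := lam) f
  refine ⟨{ toFun := x
            map_add' := fun f g => (hx _).eq ((hx f).add (hx g))
            map_smul' := fun c f => (hx _).eq ((hx f).smul c) }, ?_, ?_⟩
  · exact fun f g hg => (hx g).eq (isWickVector_monomial f g hg)
  · exact fun g g' C K hK h1 h2 h3 =>
      IsWickVector.tendsto ⟨C, K, hK, h1, h2, h3⟩ (fun j => hx (g j)) (hx g')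

/-- If all n indices are kept, each is the maximum of its block and has mark +1, which forces the
partition into singletons. -/
lemma card_kept_lt {n : ℕ} {V : MarkedPartition n}
    (hV : V ≠ (MarkedPartition.blockDataEquiv n).symm (BlockData.trivial n)) : V.kept.card < n := by
  refine lt_of_le_of_ne (card_finset_fin_le _) fun h => hV ?_
  have huniv : V.kept = Finset.univ := Finset.card_eq_iff_eq_univ _ |>.1 (by simpa using h)
  have key : ∀ i, ∃ B, V.mark B = 1 ∧ V.max B = i := fun i => by
    have hi : i ∈ V.kept := huniv ▸ Finset.mem_univ i
    obtain ⟨B, hB, hBi⟩ := Finset.mem_image.1 hi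
    exact ⟨B, (Finset.mem_filter.1 hB).2, hBi⟩
  rw [Equiv.eq_symm_apply]
  refine BlockData.ext (funext fun i => ?_) (funext fun i => ?_)
  · obtain ⟨B, hB, rfl⟩ := key i
    change V.max (V.blockOf (V.max B)) = V.max B
    rw [V.blockOf_max]
  · obtain ⟨B, hB, rfl⟩ := key i
    refine (V.toBlockData_neg_false _).2 ?_
    rw [V.blockOf_max, hB]

lemma wickVector_eq_fockB0_add {n : ℕ} (f : B0 (Fin n → T) ℂ) : ∃ s : Finset (MarkedPartition n),
    (∀ V ∈ s, V.kept.card < n) ∧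
      wickVector S lam f = fockB0 S n f + ∑ V ∈ s, fockTerm S lam V f := by
  classical
  refine ⟨Finset.univ.erase ((MarkedPartition.blockDataEquiv n).symm (BlockData.trivial n)),
    fun V hV => card_kept_lt (Finset.ne_of_mem_erase hV), ?_⟩
  rw [← dataTerm_trivial S lam, wickVector]
  exact (Finset.add_sum_erase _ _ (Finset.mem_univ _)).symm

/-- Here w will be the Wick product and y the lower order part of ⟨f, ω^{⊗n}⟩. The nontrivial terms
have degree below n, so the induction hypothesis realizes each of them by an element with a single
component; subtracting these leaves only P_n f. The condition n ≤ k + 1 says that y lies in MP⁽ⁿ⁻¹⁾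
without a truncated subtraction. -/
lemma exists_component_eq_fockB0 {n : ℕ} (f : B0 (Fin n → T) ℂ) : ∃ w y : L2tau S lam,
    w ∈ MP S lam n ∧ (∀ m, component S lam m w = fockB0 S n f m) ∧
      (∀ k, n ≤ k + 1 → y ∈ MP S lam k) ∧ IsWickVector S lam f (w + y) := by
  induction n using Nat.strong_induction_on with
  | _ n ih =>
    obtain ⟨s, hs, hsum⟩ := wickVector_eq_fockB0_add (S := S) (lam := lam) f
    obtain ⟨x, hx⟩ := exists_isWickVector (S := S) (lam := lam) f
    choose w _ hw hwc _ _ using fun V : {V // V ∈ s} => ih _ (hs V.1 V.2) (V.1.reduce S lam f)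
    have hy : ∀ k, n ≤ k + 1 → ∑ V ∈ s.attach, w V ∈ MP S lam k := fun k hk =>
      Submodule.sum_mem _ fun V _ => MP_mono S lam
        (Nat.le_of_lt_succ ((hs V.1 V.2).trans_le hk)) (hw V)
    refine ⟨x - ∑ V ∈ s.attach, w V, ∑ V ∈ s.attach, w V,
      Submodule.sub_mem _ hx.1 (hy n n.le_succ), fun m => ?_, hy, by rwa [sub_add_cancel]⟩
    rw [map_sub, hx.2, hsum, map_sum, DirectSum.add_apply, DirectSum.sum_apply,
      ← Finset.sum_attach s, add_sub_assoc, ← Finset.sum_sub_distrib,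
      Finset.sum_eq_zero, add_zero]
    intro V _
    rw [hwc]
    exact sub_self _

/-- The decomposition X f = w + y is orthogonal: w has no component below degree n, hence is
orthogonal to MP⁽ⁿ⁻¹⁾, which contains y. -/
lemma IsSmearing.component_wick {n : ℕ} {X : B0 (Fin n → T) ℂ →ₗ[ℂ] L2tau S lam}
    (hX : IsSmearing S lam n X) (f : B0 (Fin n → T) ℂ) (m : ℕ) :
    component S lam m (wick S lam X f) = fockB0 S n f m := by
  obtain ⟨w, y, hw, hwc, hy, hwy⟩ := exists_component_eq_fockB0 (S := S) (lam := lam) f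
  have hXf : X f = w + y := (hX.isWickVector f).eq hwy
  suffices h : wick S lam X f = w by rw [h, hwc]
  -- In degree 0 there is no orthogonality condition; no lower terms exist, so X f = w already lies
  -- in OP⁽⁰⁾ = MP⁽⁰⁾.
  rcases n with _ | n
  · obtain ⟨s, hs, hsum⟩ := wickVector_eq_fockB0_add (S := S) (lam := lam) f
    have h0 : X f = w := by
      refine eq_of_component_eq S lam (hX.isWickVector f).1 hw fun m => ?_
      rw [(hX.isWickVector f).2, hwc, hsum, Finset.eq_empty_of_forall_notMem
        fun V hV => absurd (hs V hV) (Nat.not_lt_zero _), Finset.sum_empty, add_zero]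
    rw [wick, h0]
    exact Submodule.starProjection_eq_self_iff.2 hw
  · refine Submodule.eq_starProjection_of_mem_orthogonal ⟨hw, ?_⟩ ?_
    · refine (Submodule.mem_orthogonal _ _).2 fun u hu => ?_
      rw [inner_MP S lam hu]
      refine Finset.sum_eq_zero fun m hm => ?_
      rw [hwc, fockB0_eq_zero S (by rw [Finset.mem_range] at hm; omega), inner_zero_right, mul_zero]
    · rw [hXf, add_sub_cancel_left]
      refine (Submodule.mem_orthogonal _ _).2 fun u hu => ?_
      exact (Submodule.mem_orthogonal' _ _).1 hu.2 _ (hy n le_rfl)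

lemma wick_mem_MP {n : ℕ} (X : B0 (Fin n → T) ℂ →ₗ[ℂ] L2tau S lam) (f : B0 (Fin n → T) ℂ) :
    wick S lam X f ∈ MP S lam n := by
  have h : wick S lam X f ∈ OP S lam n := Submodule.starProjection_apply_mem _ _
  rcases n with _ | n
  · exact h
  · exact h.1

end Smearing

end QWick

end

theorem mainTheorem3 {T : Type*} [TopologicalSpace T] [PolishSpace T] [LocallyCompactSpace T]
    [MeasurableSpace T] [BorelSpace T] (σ : Measure T) [IsLocallyFiniteMeasure σ] [NullSingletonClass σ]
    (S : QWick.Statistics σ) (lam : ℝ) :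
    (∃! X : ∀ n : ℕ, QWick.B0 (Fin n → T) ℂ →ₗ[ℂ] QWick.L2tau S lam,
      ∀ n, QWick.IsSmearing S lam n (X n)) ∧
    ∀ X : ∀ n : ℕ, QWick.B0 (Fin n → T) ℂ →ₗ[ℂ] QWick.L2tau S lam,
      (∀ n, QWick.IsSmearing S lam n (X n)) →
      ∀ (n : ℕ) (f : QWick.B0 (Fin n → T) ℂ),
        X n f = ∑ V : QWick.MarkedPartition n,
          QWick.wick S lam (X V.kept.card) (V.reduce S lam f) := by
  refine ⟨?_, fun X hX n f => ?_⟩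
  · choose X hX using fun n => QWick.exists_isSmearing (S := S) (lam := lam) n
    refine ⟨X, hX, fun Y hY => funext fun n => LinearMap.ext fun f => ?_⟩
    exact ((hY n).isWickVector f).eq ((hX n).isWickVector f)
  -- Both sides lie in MP⁽ⁿ⁾, the right one because each term has degree at most n. Their components
  -- agree term by term in the sum defining `wickVector`.
  · refine QWick.eq_of_component_eq S lam ((hX n).isWickVector f).1
      (Submodule.sum_mem _ fun V _ => QWick.MP_mono S lam (card_finset_fin_le V.kept)
        (QWick.wick_mem_MP _ _)) fun m => ?_
    rw [((hX n).isWickVector f).2, QWick.wickVector, DirectSum.sum_apply, map_sum]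
    exact Finset.sum_congr rfl fun V _ => ((hX _).component_wick _ m).symm
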